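/- Let $N\ge 1$, let $\lambda$ be a partition of $N$, and let $q,s$ be nonzero elements of a field $K$ with $q^as^b\neq1$ for all integers $(a,b)\neq(0,0)$ (for instance $K=\mathbb C(q,s)$). Operators act on the right. Cells of $\lambda$ are pairs (row, column), rows being numbered from the longest one; the content of a cell is its column minus its row. *Module.* A reverse standard tableau (RST) $\mathbb T$ of shape $\lambda$ is a filling by $1,\dots,N$, each once, strictly decreasing along rows and along columns (as the column, respectively row, index grows). $\mathrm{CT}_{\mathbb T}[k]$ is the content of the cell of $k$, and $\mathbb T^{(k,l)}$ is $\mathbb T$ with $k,l$ exchanged. $V_\lambda$ has the RST as a basis. Put $m=\mathrm{CT}_{\mathbb T}[i+1]-\mathrm{CT}_{\mathbb T}[i]$. Then $\mathbb TT_i=s\mathbb T$ if $i,i+1$ are in the same row; $\mathbb TT_i=-\mathbb T$ if they are in the same column; otherwise $\mathbb TT_i=\mathbb T^{(i,i+1)}-\frac{1-s}{1-s^m}\mathbb T$ if the row of $i$ is smaller than that of $i+1$, and $\mathbb TT_i=\frac{s-1}{1-s^m}\mathbb T+\frac{s(1-s^{m+1})(1-s^{m-1})}{(1-s^m)^2}\mathbb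 T^{(i,i+1)}$ if it is larger. On $\mathcal M_\lambda=K[x_1,\dots,x_N]\otimes V_\lambda$ let, for $p\in K[x_1,\dots,x_N]$ and $u\in V_\lambda$, with $s_i$ exchanging $x_i$ and $x_{i+1}$, $$(p\otimes u)\mathbf T_i=(1-s)x_{i+1}\tfrac{p-ps_i}{x_i-x_{i+1}}\otimes u+ps_i\otimes uT_i,\qquad (p\otimes u)\mathbf w=p(qx_N,x_1,\dots,x_{N-1})\otimes uT_1\cdots T_{N-1},$$ and put $\Phi=\mathbf T_1^{-1}\cdots\mathbf T_{N-1}^{-1}x_N$, $\ \mathbf D_N=(1-\mathbf T_{N-1}^{-1}\cdots\mathbf T_1^{-1}\mathbf w)x_N^{-1}$, $\ \mathbf D_i=\frac1s\mathbf T_i\mathbf D_{i+1}\mathbf T_i$. *Form.* A star denotes the same object formed with the parameters $q^{-1},s^{-1}$. $\langle\cdot,\cdot\rangle$ is the bilinear pairing of $\mathcal M_\lambda^*$ with $\mathcal M_\lambda$ such that elements homogeneous of different degrees in $x$ are orthogonal, $\langle Px_i,Q\rangle=\langle P,Q\mathbf D_i\rangle$, and $\langle\mathbb T_1^*,\mathbb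 T_2\rangle=\delta_{\mathbb T_1,\mathbb T_2}\,\nu(\mathbb T_1)$ with $\nu(\mathbb T)=\prod\frac{(1-s^{d-1})(1-s^{d+1})}{(1-s^d)^2}$ over all $i<j$ with $d=\mathrm{CT}_{\mathbb T}[j]-\mathrm{CT}_{\mathbb T}[i]\ge2$. *Graph.* For $v\in\mathbb N^N$ let $r_v[i]=\#\{j\le i:v[j]\ge v[i]\}+\#\{j>i:v[j]>v[i]\}$ and let $v^+$ be its decreasing rearrangement. The vertices are the pairs $(\mathbb T,v)$, with spectral vector $\zeta[i]=q^{v[i]}s^{\mathrm{CT}_{\mathbb T}[r_v[i]]}$. There is an arrow $s_i$ from $(\mathbb T,v)$ to $(\mathbb T,vs_i)$ if $v[i]<v[i+1]$, and from $(\mathbb T,v)$ to $(\mathbb T^{(k,k+1)},v)$ if $v[i]=v[i+1]$, $k=r_v[i]$ and $\mathrm{CT}_{\mathbb T}[k]\ge\mathrm{CT}_{\mathbb T}[k+1]+2$; the target is written $\zeta s_i$. There is an affine arrow from $(\mathbb T,v)$ to $(\mathbb T,[v_2,\dots,v_N,v_1+1])$. The Macdonald polynomials $P_\zeta\in\mathcal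 M_\lambda$ are given by $P=\mathbb T_\lambda$ at $(\mathbb T_\lambda,0)$, where $\mathbb T_\lambda$ is filled column by column with $N,N-1,\dots,1$; by $P_{\zeta s_i}=P_\zeta\bigl(\mathbf T_i+\frac{1-s}{1-\zeta[i+1]/\zeta[i]}\bigr)$ along $s_i$; and by applying $\Phi$ along an affine arrow. *(Anti)symmetric polynomials.* For a filling $T$ of $\lambda$ by nonnegative integers, $\zeta\in T$ means that replacing each entry $k$ of $\mathbb T$ by $v^+[k]$ gives $T$. Let $\mathrm{root}(T)$ and $\mathrm{sink}(T)$ be the vertices of this set without incoming, respectively outgoing, arrow $s_i$, and let $\ell(\sigma_T)$ be the number of arrows of a shortest path of arrows $s_i$ from $\mathrm{root}(T)$ to $\mathrm{sink}(T)$. Put $b_{\zeta_{\mathrm{root}(T)}}=b^a_{\zeta_{\mathrm{root}(T)}}=1$ and, along arrows $s_i$, $$b_{\zeta s_i}=\frac{\zeta[i]-\zeta[i+1]}{s\zeta[i]-\zeta[i+1]}\,b_\zeta,\qquad b^a_{\zeta s_i}=-\frac{\zeta[i]-\zeta[i+1]}{\zeta[i]-s\zeta[i+1]}\,b^a_\zeta,$$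 and let $\mathfrak M_T=\sum_{\zeta\in T}b_\zeta P_\zeta$, $\ \mathfrak M^a_T=\sum_{\zeta\in T}b^a_\zeta P_\zeta$. Let $\phi_N(s)=\prod_{j=2}^N\frac{1-s^j}{1-s}$. Number the cells of $T$ by $N,N-1,\dots,1$ by increasing value, cells of equal value being taken row by row (from the longest row) and from left to right. Let $\mathfrak S_T\subset\mathfrak S_N$ be the group of permutations of these numbers preserving each row and the value of $T$, and let $\phi_T(s)=\sum_{\sigma\in\mathfrak S_T}s^{\ell(\sigma)}$ with $\ell$ the number of inversions. $\overline T$ is the conjugate (transposed) filling. **Theorem.** (1) If $T$ is weakly increasing along rows and strictly increasing along columns, then $$\langle\mathfrak M_T^*,\mathfrak M_T\rangle=\frac{\phi_N(s)}{\phi_T(s)}\,b_{\zeta_{\mathrm{sink}(T)}}\,\langle P^*_{\zeta_{\mathrm{root}(T)}},P_{\zeta_{\mathrm{root}(T)}}\rangle .$$ (2) If $T$ is strictly increasing along rows and weakly increasing along columns, then $$\langle(\mathfrak M_T^a)^*,\mathfrak M^a_T\rangle=(-1)^{\ell(\sigma_T)}\,\frac{\phi_N(s)}{\phi_{\overline T}(s)}\,b^a_{\zeta_{\mathrm{sink}(T)}}\,\langle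 P^*_{\zeta_{\mathrm{root}(T)}},P_{\zeta_{\mathrm{root}(T)}}\rangle .$$ -/

import Mathlib

noncomputable section

open scoped TensorProduct

namespace VVMac

/-! ## Tableaux -/

/-- A reverse standard tableau of shape `lam` with `N = n + 1` cells: the entries are indexed by
`Fin (n + 1)` (the entry `k + 1` of the usual numbering is `k : Fin (n + 1)`), `cell k` is the cell
`(row, column)` of the entry `k`, and the entries strictly decrease along rows (as the column index
grows) and along columns (as the row index grows). -/
@[ext]
structure RST (n : ℕ) (lam : YoungDiagram) where
  cell : Fin (n + 1) ≃ {c : ℕ × ℕ // c ∈ lam.cells}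
  row_anti : ∀ k l, (cell k).1.1 = (cell l).1.1 → (cell k).1.2 < (cell l).1.2 → l < k
  col_anti : ∀ k l, (cell k).1.2 = (cell l).1.2 → (cell k).1.1 < (cell l).1.1 → l < k

variable {n : ℕ} {lam : YoungDiagram} {K : Type*} [Field K]

instance : Finite (RST n lam) :=
  Finite.of_injective (fun A : RST n lam => A.cell) fun _ _ h => RST.ext h

/-- The row of the entry `k`. -/
def RST.row (A : RST n lam) (k : Fin (n + 1)) : ℕ := (A.cell k).1.1

/-- The column of the entry `k`. -/
def RST.col (A : RST n lam) (k : Fin (n + 1)) : ℕ := (A.cell k).1.2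

/-- The content (column minus row) of the entry `k`. -/
def RST.ct (A : RST n lam) (k : Fin (n + 1)) : ℤ := (A.col k : ℤ) - (A.row k : ℤ)

open Classical in
/-- The tableau with the entries `a` and `b` exchanged. It is used below only when the result is
again a reverse standard tableau; the value in the other cases is irrelevant. -/
def RST.exch (A : RST n lam) (a b : Fin (n + 1)) : RST n lam :=
  if h : (∀ k l, (A.cell (Equiv.swap a b k)).1.1 = (A.cell (Equiv.swap a b l)).1.1 →
        (A.cell (Equiv.swap a b k)).1.2 < (A.cell (Equiv.swap a b l)).1.2 → l < k) ∧
      (∀ k l, (A.cell (Equiv.swap a b k)).1.2 = (A.cell (Equiv.swap a b l)).1.2 →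
        (A.cell (Equiv.swap a b k)).1.1 < (A.cell (Equiv.swap a b l)).1.1 → l < k)
  then ⟨(Equiv.swap a b).trans A.cell, h.1, h.2⟩
  else A

/-- `A` is the tableau obtained by filling the shape with decreasing entries column by column,
the columns from left to right and each column from row `0` upwards. -/
def RST.IsColumnReading (A : RST n lam) : Prop := ∀ k l, A.col k < A.col l → l < k

/-! ## The action of the Hecke algebra on `V_lam`

Operators act on the right in the source conventions; `rightProd [A₁, …, A_k]` is
`P ↦ P A₁ A₂ ⋯ A_k`, in which `A₁` is applied first. -/

/-- The right-acting product of a list of operators: the first entry is applied first. -/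
def rightProd {V : Type*} [AddCommGroup V] [Module K V] (L : List (Module.End K V)) :
    Module.End K V := L.reverse.prod

/-- The operator `T_i` on the space `V_lam` with basis the reverse standard tableaux. -/
def tabT (s : K) (i : Fin n) : Module.End K (RST n lam →₀ K) :=
  Finsupp.linearCombination K fun A : RST n lam =>
    let a := i.castSucc
    let b := i.succ
    let m : ℤ := A.ct b - A.ct a
    if A.row a = A.row b then s • Finsupp.single A (1 : K)
    else if A.col a = A.col b then -Finsupp.single A (1 : K)
    else if A.row a < A.row b then
      Finsupp.single (A.exch a b) (1 : K) - ((1 - s) / (1 - s ^ m)) • Finsupp.single A (1 : K)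
    else
      ((s - 1) / (1 - s ^ m)) • Finsupp.single A (1 : K) +
        (s * (1 - s ^ (m + 1)) * (1 - s ^ (m - 1)) / (1 - s ^ m) ^ 2) •
          Finsupp.single (A.exch a b) (1 : K)

/-- `S = T_1 T_2 ⋯ T_{N-1}` on `V_lam`. -/
def tabS (s : K) : Module.End K (RST n lam →₀ K) :=
  rightProd ((List.finRange n).map fun i => tabT s i)

/-! ## Operators on polynomials in `x_1, …, x_N` -/

/-- The transposition `s_i` of the variables `x_i`, `x_{i+1}`. -/
def swapX (i : Fin n) : MvPolynomial (Fin (n + 1)) K →ₐ[K] MvPolynomial (Fin (n + 1)) K :=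
  MvPolynomial.rename (Equiv.swap i.castSucc i.succ)

theorem sub_swapX_dvd (i : Fin n) (f : MvPolynomial (Fin (n + 1)) K) :
    (MvPolynomial.X i.castSucc - MvPolynomial.X i.succ : MvPolynomial (Fin (n + 1)) K) ∣
      f - swapX i f := by
  induction f using MvPolynomial.induction_on with
  | C a => simp [swapX]
  | add p q hp hq =>
    have : p + q - swapX i (p + q) = (p - swapX i p) + (q - swapX i q) := by
      rw [map_add]; ring
    rw [this]; exact dvd_add hp hq
  | mul_X p k hp =>
    have : p * MvPolynomial.X k - swapX i (p * MvPolynomial.X k) =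
        (p - swapX i p) * MvPolynomial.X k +
          swapX i p * (MvPolynomial.X k - swapX i (MvPolynomial.X k)) := by
      rw [map_mul]; ring
    rw [this]
    refine dvd_add (hp.mul_right _) (Dvd.dvd.mul_left ?_ _)
    simp only [swapX, MvPolynomial.rename_X]
    by_cases h1 : k = i.castSucc
    · subst h1; simp
    · by_cases h2 : k = i.succ
      · subst h2
        rw [Equiv.swap_apply_right, ← dvd_neg, neg_sub]
      · rw [Equiv.swap_apply_of_ne_of_ne h1 h2]; simp

theorem X_sub_X_ne_zero (i : Fin n) :
    (MvPolynomial.X i.castSucc - MvPolynomial.X i.succ : MvPolynomial (Fin (n + 1)) K) ≠ 0 := by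
  intro h
  exact (Fin.castSucc_lt_succ (i := i)).ne (MvPolynomial.X_injective (sub_eq_zero.1 h))

/-- The divided difference `f ↦ (f - f s_i) / (x_i - x_{i+1})`. -/
def divDiff (i : Fin n) : MvPolynomial (Fin (n + 1)) K →ₗ[K] MvPolynomial (Fin (n + 1)) K where
  toFun f := (sub_swapX_dvd i f).choose
  map_add' f g := by
    apply mul_left_cancel₀ (X_sub_X_ne_zero (K := K) i)
    rw [mul_add, ← (sub_swapX_dvd i (f + g)).choose_spec, ← (sub_swapX_dvd i f).choose_spec,
      ← (sub_swapX_dvd i g).choose_spec, map_add]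
    ring
  map_smul' c f := by
    apply mul_left_cancel₀ (X_sub_X_ne_zero (K := K) i)
    rw [RingHom.id_apply, mul_smul_comm, ← (sub_swapX_dvd i (c • f)).choose_spec,
      ← (sub_swapX_dvd i f).choose_spec, map_smul, smul_sub]

/-- `δ_i = (1 - s) ∂_i x_{i+1}`: divided difference followed by multiplication. -/
def delta (s : K) (i : Fin n) : Module.End K (MvPolynomial (Fin (n + 1)) K) :=
  (1 - s) • (LinearMap.mulLeft K (MvPolynomial.X i.succ) ∘ₗ divDiff i)

/-- The affine operator on polynomials, `p(x_1, …, x_N) ↦ p(q x_N, x_1, …, x_{N-1})`. -/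
def wX (q : K) : MvPolynomial (Fin (n + 1)) K →ₐ[K] MvPolynomial (Fin (n + 1)) K :=
  MvPolynomial.aeval
    (Fin.cons (MvPolynomial.C q * MvPolynomial.X (Fin.last n))
      (fun i : Fin n => MvPolynomial.X i.castSucc))

/-- Division by the variable `x_j` (monomials not divisible by `x_j` are dropped; it is applied
below to polynomials divisible by `x_j`). -/
def divX (j : Fin (n + 1)) : Module.End K (MvPolynomial (Fin (n + 1)) K) where
  toFun f := f.divMonomial (Finsupp.single j 1)
  map_add' f g := MvPolynomial.add_divMonomial f g _
  map_smul' c f := by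
    ext m
    simp [MvPolynomial.coeff_divMonomial]

/-! ## Vector valued polynomials -/

/-- The space of vector valued polynomials `K[x_1, …, x_N] ⊗ V_lam`. -/
abbrev VVPoly (K : Type*) [Field K] (n : ℕ) (lam : YoungDiagram) : Type _ :=
  MvPolynomial (Fin (n + 1)) K ⊗[K] (RST n lam →₀ K)

/-- `𝐓_i = δ_i ⊗ 1 + s_i ⊗ T_i`. -/
def bT (s : K) (i : Fin n) : Module.End K (VVPoly K n lam) :=
  TensorProduct.map (delta s i) LinearMap.id +
    TensorProduct.map (swapX i).toLinearMap (tabT s i)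

/-- `𝐓_i⁻¹ = s⁻¹ (𝐓_i + 1 - s)`. -/
def bTinv (s : K) (i : Fin n) : Module.End K (VVPoly K n lam) :=
  s⁻¹ • (bT s i + (1 - s) • (1 : Module.End K (VVPoly K n lam)))

/-- `𝐰 = w ⊗ S`. -/
def bw (q s : K) : Module.End K (VVPoly K n lam) :=
  TensorProduct.map (wX q).toLinearMap (tabS s)

/-- Multiplication by the variable `x_j`. -/
def mulX (j : Fin (n + 1)) : Module.End K (VVPoly K n lam) :=
  TensorProduct.map (LinearMap.mulLeft K (MvPolynomial.X j)) LinearMap.id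

/-- The last Cherednik operator `Ξ_N = 𝐓_{N-1}⁻¹ ⋯ 𝐓_1⁻¹ 𝐰`. -/
def cherednikLast (q s : K) : Module.End K (VVPoly K n lam) :=
  rightProd (((List.finRange n).reverse.map fun i => bTinv s i) ++ [bw q s])

/-- The Dunkl operators: `𝐃_N = (1 - Ξ_N) x_N⁻¹` and `𝐃_i = s⁻¹ 𝐓_i 𝐃_{i+1} 𝐓_i`. -/
def dunkl (q s : K) (i : Fin (n + 1)) : Module.End K (VVPoly K n lam) :=
  Fin.reverseInduction (motive := fun _ => Module.End K (VVPoly K n lam))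
    (rightProd [1 - cherednikLast q s, TensorProduct.map (divX (Fin.last n)) LinearMap.id])
    (fun j D => s⁻¹ • rightProd [bT s j, D, bT s j]) i

/-- The raising operator `Φ = 𝐓_1⁻¹ ⋯ 𝐓_{N-1}⁻¹ x_N`. -/
def raising (s : K) : Module.End K (VVPoly K n lam) :=
  rightProd (((List.finRange n).map fun i => bTinv s i) ++ [mulX (Fin.last n)])

/-! ## The bilinear form -/

/-- `ν(A)`, the product over the pairs `i < j` with `CT[i] - CT[j] ≤ -2`. -/
def nu (s : K) (A : RST n lam) : K :=
  ∏ p : Fin (n + 1) × Fin (n + 1) with p.1 < p.2 ∧ A.ct p.1 - A.ct p.2 ≤ -2,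
    (1 - s ^ (A.ct p.2 - A.ct p.1 - 1)) * (1 - s ^ (A.ct p.2 - A.ct p.1 + 1)) /
      (1 - s ^ (A.ct p.2 - A.ct p.1)) ^ 2

/-- The linear form `Q ↦ ⟨A^*, Q⟩`: it is `ν(A)` at `A`, and it vanishes at the other tableaux and
at the homogeneous elements of positive degree. -/
def tabPair (s : K) (A : RST n lam) : VVPoly K n lam →ₗ[K] K :=
  nu s A • ((TensorProduct.lid K K).toLinearMap ∘ₗ
    TensorProduct.map (MvPolynomial.lcoeff K (0 : Fin (n + 1) →₀ ℕ)) (Finsupp.lapply A))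

/-- The bilinear form with `⟨A^*, B⟩ = δ_{A,B} ν(A)` on tableaux and
`⟨x_i P, Q⟩ = ⟨P, Q 𝐃_i⟩`, written out on the elements `x^u ⊗ A` of the left factor
(the operators `𝐃_i` commute). The left argument is an object for the parameters `q⁻¹, s⁻¹`, the
right argument one for the parameters `q, s`. -/
def form (q s : K) : VVPoly K n lam →ₗ[K] VVPoly K n lam →ₗ[K] K :=
  TensorProduct.lift <|
    (MvPolynomial.basisMonomials (Fin (n + 1)) K).constr K fun u =>
      Finsupp.linearCombination K fun A : RST n lam =>
        tabPair s A ∘ₗ ((List.finRange (n + 1)).map fun i => dunkl q s i ^ u i).prod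

/-! ## The Yang-Baxter graph -/

/-- A vertex of the Yang-Baxter graph, labelled by a reverse standard tableau and a multi-index. -/
structure Vertex (n : ℕ) (lam : YoungDiagram) where
  tab : RST n lam
  vec : Fin (n + 1) → ℕ

/-- The rank function `r_v`. -/
def rank (v : Fin (n + 1) → ℕ) (i : Fin (n + 1)) : Fin (n + 1) :=
  ⟨Finset.card {j | (j < i ∧ v i ≤ v j) ∨ (i < j ∧ v i < v j)}, by
    refine lt_of_lt_of_eq (Finset.card_lt_univ_of_notMem (x := i) ?_) (Fintype.card_fin _)
    simp⟩

/-- The content `CT[r_v[i]]`, that is the exponent of `s` in the `i`-th spectral value. -/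
def Vertex.ct (x : Vertex n lam) (i : Fin (n + 1)) : ℤ := x.tab.ct (rank x.vec i)

/-- The spectral vector `ζ[i] = q^{v[i]} s^{CT[r_v[i]]}`. -/
def Vertex.spec (q s : K) (x : Vertex n lam) (i : Fin (n + 1)) : K :=
  q ^ x.vec i * s ^ x.ct i

/-- The affine action `v ↦ [v_2, …, v_N, v_1 + 1]`. -/
def Vertex.affine (x : Vertex n lam) : Vertex n lam :=
  ⟨x.tab, Fin.snoc (fun i : Fin n => x.vec i.succ) (x.vec 0 + 1)⟩

/-- The arrows labelled by `s_i` that do not lead to the empty vertex: steps, which exchange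
`v[i] < v[i+1]`, and jumps, which exchange in the tableau the entries `r_v[i]`, `r_v[i+1]` when
`v[i] = v[i+1]` and the content of the first exceeds that of the second by at least `2`. These are
the arrows of the graph without affine edges. -/
inductive Arrow : Fin n → Vertex n lam → Vertex n lam → Prop
  | step (i : Fin n) (x : Vertex n lam) (h : x.vec i.castSucc < x.vec i.succ) :
      Arrow i x ⟨x.tab, x.vec ∘ Equiv.swap i.castSucc i.succ⟩
  | jump (i : Fin n) (x : Vertex n lam) (h : x.vec i.castSucc = x.vec i.succ)
      (hct : x.ct i.succ + 2 ≤ x.ct i.castSucc) :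
      Arrow i x ⟨x.tab.exch (rank x.vec i.castSucc) (rank x.vec i.succ), x.vec⟩

/-- `IsMacdonald q s x P`: `P` is obtained by following a path without fall of the Yang-Baxter graph
from the root to `x`. -/
inductive IsMacdonald (q s : K) : Vertex n lam → VVPoly K n lam → Prop
  | root (A : RST n lam) (hA : A.IsColumnReading) :
      IsMacdonald q s ⟨A, 0⟩ (1 ⊗ₜ Finsupp.single A 1)
  | arrow (i : Fin n) (x y : Vertex n lam) (P : VVPoly K n lam) (hP : IsMacdonald q s x P)
      (h : Arrow i x y) :
      IsMacdonald q s y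
        (bT s i P + ((1 - s) / (1 - x.spec q s i.succ / x.spec q s i.castSucc)) • P)
  | affine (x : Vertex n lam) (P : VVPoly K n lam) (hP : IsMacdonald q s x P) :
      IsMacdonald q s x.affine (raising s P)

open Classical in
/-- The nonsymmetric vector valued Macdonald polynomial `P_ζ` with `ζ` the spectral vector of `x`
(the value does not depend on the path). -/
def macdonald (q s : K) (x : Vertex n lam) : VVPoly K n lam :=
  if h : ∃ P, IsMacdonald q s x P then h.choose else 0

/-! ## Connected components

A filling is a function `T : ℕ × ℕ → ℕ` of which only the values on the cells of the shape are
used. -/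

/-- The decreasing rearrangement `v⁺`. -/
def decr (v : Fin (n + 1) → ℕ) (k : Fin (n + 1)) : ℕ := v (Tuple.sort v k.rev)

/-- The set of the vertices `(A, v)` of the connected component `H_T`: replacing each entry `k` of
`A` by `v⁺[k]` gives the filling `T`. -/
def component (n : ℕ) (lam : YoungDiagram) (T : ℕ × ℕ → ℕ) : Set (Vertex n lam) :=
  {x | ∀ k, T (x.tab.cell k).1 = decr x.vec k}

theorem component_finite (n : ℕ) (lam : YoungDiagram) (T : ℕ × ℕ → ℕ) :
    (component n lam T).Finite := by
  classical
  have hinj : Function.Injective fun x : Vertex n lam => (x.tab, x.vec) := by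
    rintro ⟨A, v⟩ ⟨B, w⟩ h
    simpa using h
  refine Set.Finite.of_finite_image (f := fun x : Vertex n lam => (x.tab, x.vec)) ?_ hinj.injOn
  refine Set.Finite.subset (Set.finite_univ.prod
    (Set.Finite.pi' fun _ : Fin (n + 1) => (lam.cells.image T).finite_toSet)) ?_
  rintro _ ⟨x, hx, rfl⟩
  refine ⟨trivial, fun i => ?_⟩
  have h := hx ((Tuple.sort x.vec).symm i).rev
  simp only [decr, Fin.rev_rev, Equiv.apply_symm_apply] at h
  change x.vec i ∈ _
  rw [← h]
  exact Finset.mem_coe.2 (Finset.mem_image_of_mem T (x.tab.cell _).2)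

/-- The root of `H_T`: the vertex without incoming arrow. -/
def IsRoot (T : ℕ × ℕ → ℕ) (x : Vertex n lam) : Prop :=
  x ∈ component n lam T ∧ ∀ i y, ¬ Arrow i y x

/-- The sink of `H_T`: the vertex without outgoing arrow. -/
def IsSink (T : ℕ × ℕ → ℕ) (x : Vertex n lam) : Prop :=
  x ∈ component n lam T ∧ ∀ i y, ¬ Arrow i x y

/-- `HPath d x y`: there is a directed path with `d` arrows from `x` to `y`. -/
inductive HPath : ℕ → Vertex n lam → Vertex n lam → Prop
  | nil (x : Vertex n lam) : HPath 0 x x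
  | cons (d : ℕ) (i : Fin n) (x y z : Vertex n lam) (h : HPath d x y) (h' : Arrow i y z) :
      HPath (d + 1) x z

/-- The least number of arrows of a directed path from `x` to `y`. -/
def pathLength (x y : Vertex n lam) : ℕ := sInf {d | HPath d x y}

/-- `T` is weakly increasing along rows and strictly increasing along columns. -/
def IsColumnStrict (lam : YoungDiagram) (T : ℕ × ℕ → ℕ) : Prop :=
  (∀ c ∈ lam.cells, ∀ d ∈ lam.cells, c.1 = d.1 → c.2 < d.2 → T c ≤ T d) ∧
    ∀ c ∈ lam.cells, ∀ d ∈ lam.cells, c.2 = d.2 → c.1 < d.1 → T c < T d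

/-- `T` is strictly increasing along rows and weakly increasing along columns. -/
def IsRowStrict (lam : YoungDiagram) (T : ℕ × ℕ → ℕ) : Prop :=
  (∀ c ∈ lam.cells, ∀ d ∈ lam.cells, c.1 = d.1 → c.2 < d.2 → T c < T d) ∧
    ∀ c ∈ lam.cells, ∀ d ∈ lam.cells, c.2 = d.2 → c.1 < d.1 → T c ≤ T d

/-! ## Symmetric and antisymmetric polynomials -/

/-- The coefficients `b_ζ`: `b = 1` at the root, and
`b_{ζ s_i} = (ζ[i] - ζ[i+1]) / (s ζ[i] - ζ[i+1]) b_ζ` along an arrow. -/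
inductive IsSymCoeff (q s : K) (T : ℕ × ℕ → ℕ) : Vertex n lam → K → Prop
  | root (x : Vertex n lam) (hx : IsRoot T x) : IsSymCoeff q s T x 1
  | arrow (i : Fin n) (x y : Vertex n lam) (b : K) (hb : IsSymCoeff q s T x b)
      (h : Arrow i x y) :
      IsSymCoeff q s T y
        ((x.spec q s i.castSucc - x.spec q s i.succ) /
          (s * x.spec q s i.castSucc - x.spec q s i.succ) * b)

/-- The coefficients `b^a_ζ`: `b^a = 1` at the root, and
`b^a_{ζ s_i} = - (ζ[i] - ζ[i+1]) / (ζ[i] - s ζ[i+1]) b^a_ζ` along an arrow. -/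
inductive IsAntiCoeff (q s : K) (T : ℕ × ℕ → ℕ) : Vertex n lam → K → Prop
  | root (x : Vertex n lam) (hx : IsRoot T x) : IsAntiCoeff q s T x 1
  | arrow (i : Fin n) (x y : Vertex n lam) (b : K) (hb : IsAntiCoeff q s T x b)
      (h : Arrow i x y) :
      IsAntiCoeff q s T y
        (-((x.spec q s i.castSucc - x.spec q s i.succ) /
          (x.spec q s i.castSucc - s * x.spec q s i.succ)) * b)

open Classical in
/-- The coefficient `b_ζ` with `ζ` the spectral vector of `x` (independent of the path). -/
def symCoeff (q s : K) (T : ℕ × ℕ → ℕ) (x : Vertex n lam) : K :=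
  if h : ∃ b, IsSymCoeff q s T x b then h.choose else 0

open Classical in
/-- The coefficient `b^a_ζ` with `ζ` the spectral vector of `x` (independent of the path). -/
def antiCoeff (q s : K) (T : ℕ × ℕ → ℕ) (x : Vertex n lam) : K :=
  if h : ∃ b, IsAntiCoeff q s T x b then h.choose else 0

/-- The symmetric Macdonald polynomial `𝔐_T = ∑_{ζ ∈ T} b_ζ P_ζ`. -/
def symMacdonald (n : ℕ) (lam : YoungDiagram) (q s : K) (T : ℕ × ℕ → ℕ) : VVPoly K n lam :=
  ∑ x ∈ (component_finite n lam T).toFinset, symCoeff q s T x • macdonald q s x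

/-- The antisymmetric Macdonald polynomial `𝔐^a_T = ∑_{ζ ∈ T} b^a_ζ P_ζ`. -/
def antiMacdonald (n : ℕ) (lam : YoungDiagram) (q s : K) (T : ℕ × ℕ → ℕ) : VVPoly K n lam :=
  ∑ x ∈ (component_finite n lam T).toFinset, antiCoeff q s T x • macdonald q s x

/-! ## Poincaré polynomials -/

/-- The Poincaré polynomial `φ_N(s) = ∏_{j=2}^N (1 - s^j) / (1 - s)` of the symmetric group. -/
def poincareSym (N : ℕ) (s : K) : K := ∏ j ∈ Finset.Icc 2 N, (1 - s ^ j) / (1 - s)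

/-- The entry (between `1` and `N`) at the cell `c` of the standardization `std_1 T`: the cells are
numbered decreasingly by increasing value of `T`, cells of equal value being read row by row from
row `0` upwards and from left to right. -/
def std (lam : YoungDiagram) (T : ℕ × ℕ → ℕ) (c : ℕ × ℕ) : ℕ :=
  Finset.card {d ∈ lam.cells | T c < T d} +
    Finset.card {d ∈ lam.cells | c.1 < d.1 ∧ T d = T c} +
    Finset.card {d ∈ lam.cells | d.1 = c.1 ∧ c.2 ≤ d.2 ∧ T d = T c}

/-- Membership in the group `𝔖_T`: the permutation of the entries of `std_1 T` leaves invariant the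
sets of entries of each row of `std_1 T`, and the induced permutation of the cells leaves `T`
invariant. -/
def InStabilizer (n : ℕ) (lam : YoungDiagram) (T : ℕ × ℕ → ℕ) (σ : Equiv.Perm (Fin (n + 1))) :
    Prop :=
  ∀ c ∈ lam.cells, ∀ d ∈ lam.cells, ∀ k : Fin (n + 1),
    std lam T c = k + 1 → std lam T d = σ k + 1 → c.1 = d.1 ∧ T c = T d

/-- The length (number of inversions) of a permutation. -/
def invLength (σ : Equiv.Perm (Fin (n + 1))) : ℕ :=
  Finset.card {p : Fin (n + 1) × Fin (n + 1) | p.1 < p.2 ∧ σ p.2 < σ p.1}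

open Classical in
/-- The Poincaré polynomial `φ_T(s) = ∑_{σ ∈ 𝔖_T} s^{ℓ(σ)}` of the group `𝔖_T`. -/
def poincare (n : ℕ) (lam : YoungDiagram) (T : ℕ × ℕ → ℕ) (s : K) : K :=
  ∑ σ : Equiv.Perm (Fin (n + 1)) with InStabilizer n lam T σ, s ^ invLength σ

/-- The conjugate filling, for the conjugate shape `lam.transpose`. -/
def conj (T : ℕ × ℕ → ℕ) : ℕ × ℕ → ℕ := fun c => T c.swap

end VVMac

end

/-!
The operators `𝐓_i`, the variables and `𝐰` make the vector valued polynomials a representation of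
the double affine Hecke algebra (`isDoubleAffine`). Endomorphisms act on the left here, so products
of operators appear in the order opposite to that of the right action.

*The graph.* A vertex `(A, v)` is the same thing as a sequence of labels, the label at position `i`
being the pair of the value `v[i]` and the cell of `r_v[i]` in `A`. An arrow `s_i` exchanges two
adjacent labels (`arrow_iff`) and the affine arrow rotates the sequence. The Yang-Baxter equation
(`intertwiner_braid`) and the relations between `𝐓_i` and the raising operator `Φ` show that the
Macdonald polynomial of a vertex does not depend on the path (`IsMacdonald.unique`). The Macdonald
polynomials span (`span_macdonald`), and they are eigenvectors of the Cherednik operators with the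
spectral vectors as eigenvalues (`cherednik_macdonald`).

*The form.* The last Dunkl operator annihilates the Macdonald polynomials with `v[N] = 0` and, up to
a factor and Hecke generators, undoes `Φ` on the other ones (`dunklLast_macdonald_affine`).
Identities between operators can be tested on Macdonald polynomials, and in this way the Dunkl
operators are seen to commute (`dunkl_commute`). Hence multiplication by a variable is adjoint to a
Dunkl operator on arbitrary vector valued polynomials (`form_mulX`), the `𝐓_i` are unitary
(`form_bT_bT`), and induction on the graph gives the orthogonality of the Macdonald polynomials
(`form_macdonald_of_ne`) and the ratio `(sζ - ζ')(ζ - sζ') / (s (ζ - ζ')²)` of the norms at the ends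
of an arrow (`form_macdonald_sw`), where `ζ`, `ζ'` are the spectral values of the exchanged labels.

*The sum.* In the component of a filling `T` the labels are fixed and only their order varies.
Orthogonality turns the norm of the symmetric polynomial into the sum over the vertices of `b* · b ·
‖P‖²`, and the ratios along arrows show that this term is proportional to the product of the weights
`(sζ_a - ζ_b) / (ζ_a - ζ_b)` over all pairs of labels, `a` standing before `b`
(`norm_mul_pairProd`). An ordering of the cells which is not a vertex has two adjacent cells in a
row in the wrong order, and its weight vanishes (`exists_vertex_of_symWeight`). So the sum can be
extended to all `N!` orderings of the cells, and it is the Poincaré polynomial `φ_N(s)`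
(`sum_perm_prod_div`, by Lagrange interpolation). The constant of proportionality is the norm at the
root divided by the weight of the root. In the product of this weight with the coefficient `b` of
the sink the pairs exchanged between the root and the sink cancel (`pairProd_mul_invProd`); the
pairs which are left are equal entries of a row, and their product telescopes to `φ_T(s)`
(`symWeight_root`, `poincare_eq_prod`). The antisymmetric case has the weights `(ζ_a - sζ_b) / (ζ_a
- ζ_b)`, with columns instead of rows, and a sign for each exchanged pair (`antiWeight_root`,
`neg_one_pow_pathLength`).
-/

noncomputable section

open scoped TensorProduct

namespace VVMac

variable {n : ℕ} {lam : YoungDiagram} {K : Type*} [Field K]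

/-! ### Reverse standard tableaux -/

theorem RST.mem_of_le (A : RST n lam) (k : Fin (n + 1)) {r c : ℕ} (hr : r ≤ A.row k)
    (hc : c ≤ A.col k) : ∃ m, A.row m = r ∧ A.col m = c := by
  have h : (r, c) ∈ lam.cells := lam.up_left_mem hr hc (A.cell k).2
  refine ⟨A.cell.symm ⟨(r, c), h⟩, ?_, ?_⟩ <;> simp [RST.row, RST.col]

theorem RST.entry_inj (A : RST n lam) {k l : Fin (n + 1)} (hr : A.row k = A.row l)
    (hc : A.col k = A.col l) : k = l :=
  A.cell.injective (Subtype.ext (Prod.ext hr hc))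

/-- The entries decrease from a cell to any cell weakly south-east of it. -/
theorem RST.entry_lt (A : RST n lam) {k l : Fin (n + 1)} (hr : A.row k ≤ A.row l)
    (hc : A.col k ≤ A.col l) (hne : k ≠ l) : l < k := by
  rcases hr.eq_or_lt with hr' | hr'
  · rcases hc.eq_or_lt with hc' | hc'
    · exact absurd (A.entry_inj hr' hc') hne
    · exact A.row_anti k l hr' hc'
  · rcases hc.eq_or_lt with hc' | hc'
    · exact A.col_anti k l hc' hr'
    · obtain ⟨m, hm1, hm2⟩ := A.mem_of_le l (r := A.row k) (c := A.col l) hr'.le le_rfl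
      exact (A.col_anti m l hm2 (lt_of_eq_of_lt hm1 hr')).trans
        (A.row_anti k m hm1.symm (lt_of_lt_of_eq hc' hm2.symm))

/-- Two entries on the same diagonal are separated by at least two other entries. -/
theorem RST.ct_eq_gap (A : RST n lam) {k l : Fin (n + 1)} (h : A.ct k = A.ct l) (hkl : k < l) :
    (k : ℕ) + 3 ≤ l := by
  unfold RST.ct at h
  have h1 : A.row l < A.row k := by
    by_contra hcon
    have := A.entry_lt (k := k) (l := l) (by omega) (by omega) hkl.ne
    exact absurd this hkl.not_gt
  obtain ⟨m, hm1, hm2⟩ := A.mem_of_le k (r := A.row l) (c := A.col k) h1.le le_rfl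
  obtain ⟨m', hm1', hm2'⟩ := A.mem_of_le k (r := A.row k) (c := A.col l) le_rfl (by omega)
  have a1 : m < l := A.entry_lt (by omega) (by omega) (by rintro rfl; omega)
  have a2 : k < m := A.entry_lt (by omega) (by omega) (by rintro rfl; omega)
  have b1 : m' < l := A.entry_lt (by omega) (by omega) (by rintro rfl; omega)
  have b2 : k < m' := A.entry_lt (by omega) (by omega) (by rintro rfl; omega)
  have c : m ≠ m' := by rintro rfl; omega
  omega

/-- The relative position of two consecutive entries: adjacent in a row, adjacent in a column, or
with contents differing by at least two. -/
theorem RST.consecutive_cases (A : RST n lam) {a b : Fin (n + 1)} (hab : (b : ℕ) = a + 1) :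
    (A.ct b - A.ct a = -1 ∧ A.row a = A.row b ∧ A.col a = A.col b + 1) ∨
    (A.ct b - A.ct a = 1 ∧ A.col a = A.col b ∧ A.row a = A.row b + 1) ∨
    (A.ct b - A.ct a ≤ -2 ∧ A.row a < A.row b ∧ A.col b < A.col a) ∨
    (2 ≤ A.ct b - A.ct a ∧ A.row b < A.row a ∧ A.col a < A.col b) := by
  have hlt : a < b := by rw [Fin.lt_def]; omega
  have hbetw : ∀ m : Fin (n + 1), a < m → m < b → False := by
    intro m h1 h2; rw [Fin.lt_def] at h1 h2; omega
  unfold RST.ct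
  rcases lt_trichotomy (A.row a) (A.row b) with h | h | h
  · rcases lt_or_ge (A.col b) (A.col a) with h' | h'
    · right; right; left; omega
    · exact absurd (A.entry_lt h.le h' hlt.ne) hlt.not_gt
  · rcases lt_or_ge (A.col b) (A.col a) with h' | h'
    · left
      refine ⟨?_, h, ?_⟩
      all_goals
        by_contra hc
        obtain ⟨m, hm1, hm2⟩ := A.mem_of_le a (r := A.row a) (c := A.col b + 1) le_rfl (by omega)
        exact hbetw m (A.entry_lt (by omega) (by omega) (by rintro rfl; omega))
          (A.entry_lt (by omega) (by omega) (by rintro rfl; omega))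
    · exact absurd (A.entry_lt h.le h' hlt.ne) hlt.not_gt
  · rcases lt_trichotomy (A.col a) (A.col b) with h' | h' | h'
    · right; right; right; omega
    · right; left
      refine ⟨?_, h', ?_⟩
      all_goals
        by_contra hc
        obtain ⟨m, hm1, hm2⟩ := A.mem_of_le a (r := A.row b + 1) (c := A.col a) (by omega) le_rfl
        exact hbetw m (A.entry_lt (by omega) (by omega) (by rintro rfl; omega))
          (A.entry_lt (by omega) (by omega) (by rintro rfl; omega))
    · exfalso
      obtain ⟨m, hm1, hm2⟩ := A.mem_of_le a (r := A.row b) (c := A.col a) (by omega) le_rfl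
      exact hbetw m (A.entry_lt (by omega) (by omega) (by rintro rfl; omega))
          (A.entry_lt (by omega) (by omega) (by rintro rfl; omega))

theorem RST.ct_ne (A : RST n lam) {a b : Fin (n + 1)} (hab : (b : ℕ) = a + 1) :
    A.ct b - A.ct a ≠ 0 := by
  rcases A.consecutive_cases hab with h | h | h | h <;> omega

theorem Fin.swap_lt_of_ne {a b k l : Fin (n + 1)} (hab : (b : ℕ) = a + 1)
    (h : Equiv.swap a b l < Equiv.swap a b k)
    (hne : ¬ (Equiv.swap a b l = a ∧ Equiv.swap a b k = b)) : l < k := by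
  rw [Equiv.swap_apply_def, Equiv.swap_apply_def] at *
  simp only [Fin.lt_def, Fin.ext_iff] at *
  split_ifs at * <;> simp_all <;> omega

theorem RST.exch_cell (A : RST n lam) {a b : Fin (n + 1)} (hab : (b : ℕ) = a + 1)
    (h : A.ct b - A.ct a ≤ -2 ∨ 2 ≤ A.ct b - A.ct a) :
    (A.exch a b).cell = (Equiv.swap a b).trans A.cell := by
  unfold RST.exch
  rw [dif_pos]
  have hc : A.row a ≠ A.row b ∧ A.col a ≠ A.col b := by
    rcases A.consecutive_cases hab with h' | h' | h' | h' <;> omega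
  refine ⟨fun k l h1 h2 => ?_, fun k l h1 h2 => ?_⟩
  · refine Fin.swap_lt_of_ne hab (A.row_anti _ _ h1 h2) ?_
    rintro ⟨e1, e2⟩
    rw [e1, e2] at h1
    exact hc.1 h1.symm
  · refine Fin.swap_lt_of_ne hab (A.col_anti _ _ h1 h2) ?_
    rintro ⟨e1, e2⟩
    rw [e1, e2] at h1
    exact hc.2 h1.symm

theorem RST.exch_ct (A : RST n lam) {a b : Fin (n + 1)} (hab : (b : ℕ) = a + 1)
    (h : A.ct b - A.ct a ≤ -2 ∨ 2 ≤ A.ct b - A.ct a) (k : Fin (n + 1)) :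
    (A.exch a b).ct k = A.ct (Equiv.swap a b k) := by
  simp [RST.ct, RST.row, RST.col, A.exch_cell hab h]

theorem RST.exch_exch (A : RST n lam) {a b : Fin (n + 1)} (hab : (b : ℕ) = a + 1)
    (h : A.ct b - A.ct a ≤ -2 ∨ 2 ≤ A.ct b - A.ct a) :
    (A.exch a b).exch a b = A := by
  apply RST.ext
  rw [RST.exch_cell _ hab, A.exch_cell hab h]
  · ext k <;> simp
  · rw [A.exch_ct hab h, A.exch_ct hab h]
    simp
    omega

/-! ### The action of the Hecke algebra on the tableaux -/

/-- The parameter `s` is nonzero and not a root of unity. -/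
structure NonRoot (s : K) : Prop where
  ne_zero : s ≠ 0
  zpow_eq_one : ∀ b : ℤ, s ^ b = 1 → b = 0

theorem NonRoot.one_sub_zpow {s : K} (h : NonRoot s) {m : ℤ} (hm : m ≠ 0) : 1 - s ^ m ≠ 0 :=
  fun h' => hm (h.zpow_eq_one m (sub_eq_zero.1 h').symm)

theorem NonRoot.one_sub {s : K} (h : NonRoot s) : 1 - s ≠ 0 := by
  simpa using h.one_sub_zpow one_ne_zero

theorem NonRoot.sub_one {s : K} (h : NonRoot s) : s - 1 ≠ 0 := by
  rw [← neg_sub]; exact neg_ne_zero.2 h.one_sub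

theorem NonRoot.inv {s : K} (h : NonRoot s) : NonRoot s⁻¹ :=
  ⟨inv_ne_zero h.ne_zero, fun b hb => by
    rw [inv_zpow, inv_eq_one] at hb; exact h.zpow_eq_one b hb⟩

/-- The diagonal coefficient of `T_i` at a tableau with `m = CT[i+1] - CT[i]`. -/
def tabDiag (s : K) (m : ℤ) : K := (s - 1) / (1 - s ^ m)

/-- The off-diagonal coefficient of `T_i` at a tableau with `m = CT[i+1] - CT[i]`; it vanishes
when the two entries cannot be exchanged. -/
def tabOff (s : K) (m : ℤ) : K :=
  if m ≤ -2 then 1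
  else if 2 ≤ m then s * (1 - s ^ (m + 1)) * (1 - s ^ (m - 1)) / (1 - s ^ m) ^ 2 else 0

/-- The product of the two off-diagonal coefficients of `T_i` on a pair of tableaux. -/
def tabProd (s : K) (m : ℤ) : K := s * (1 - s ^ (m + 1)) * (1 - s ^ (m - 1)) / (1 - s ^ m) ^ 2

theorem tabDiag_neg {s : K} (hs : NonRoot s) {m : ℤ} (hm : m ≠ 0) :
    tabDiag s (-m) = s - 1 - tabDiag s m := by
  have h1 := hs.one_sub_zpow hm
  have h2 := hs.one_sub_zpow (neg_ne_zero.2 hm)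
  have h3 := zpow_ne_zero m hs.ne_zero
  unfold tabDiag
  rw [zpow_neg] at *
  field_simp
  have h4 : s ^ m - 1 ≠ 0 := by rw [← neg_sub]; exact neg_ne_zero.2 h1
  rw [div_eq_iff h4]
  field_simp
  ring

theorem tabProd_eq {s : K} (hs : NonRoot s) {m : ℤ} (hm : m ≠ 0) :
    tabProd s m = (s - tabDiag s m) * (1 + tabDiag s m) := by
  have h1 := hs.one_sub_zpow hm
  have h3 := hs.ne_zero
  unfold tabDiag tabProd
  rw [zpow_add_one₀ h3, zpow_sub_one₀ h3]
  field_simp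
  ring

theorem tabProd_neg {s : K} (hs : NonRoot s) {m : ℤ} (hm : m ≠ 0) :
    tabProd s (-m) = tabProd s m := by
  rw [tabProd_eq hs hm, tabProd_eq hs (neg_ne_zero.2 hm), tabDiag_neg hs hm]
  ring

theorem tabOff_mul {s : K} (hs : NonRoot s) {m : ℤ} (hm : m ≤ -2 ∨ 2 ≤ m) :
    tabOff s m * tabOff s (-m) = tabProd s m := by
  rcases hm with h | h
  · rw [← tabProd_neg hs (by omega)]
    simp only [tabOff, tabProd, if_pos h, if_neg (show ¬ -m ≤ -2 by omega),
      if_pos (show 2 ≤ -m by omega), one_mul]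
  · simp only [tabOff, tabProd, if_neg (show ¬ m ≤ -2 by omega), if_pos h,
      if_pos (show -m ≤ -2 by omega), mul_one]

theorem tabOff_eq_zero (s : K) {m : ℤ} (hm : ¬ (m ≤ -2 ∨ 2 ≤ m)) : tabOff s m = 0 := by
  rw [tabOff, if_neg (by omega), if_neg (by omega)]

theorem tabProd_eq_zero (s : K) {m : ℤ} (hm0 : m ≠ 0) (hm : ¬ (m ≤ -2 ∨ 2 ≤ m)) :
    tabProd s m = 0 := by
  have : m = 1 ∨ m = -1 := by omega
  rcases this with rfl | rfl <;> simp [tabProd]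

theorem tabT_single {s : K} (hs : NonRoot s) (i : Fin n) (A : RST n lam) :
    tabT s i (Finsupp.single A (1 : K)) =
      tabDiag s (A.ct i.succ - A.ct i.castSucc) • Finsupp.single A (1 : K) +
      tabOff s (A.ct i.succ - A.ct i.castSucc) •
        Finsupp.single (A.exch i.castSucc i.succ) (1 : K) := by
  have hab : ((i.succ : Fin (n + 1)) : ℕ) = i.castSucc + 1 := by simp
  unfold tabT
  simp only [Finsupp.linearCombination_single, one_smul]
  rcases A.consecutive_cases hab with ⟨hm, h1, h2⟩ | ⟨hm, h1, h2⟩ | ⟨hm, h1, h2⟩ | ⟨hm, h1, h2⟩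
  · rw [if_pos h1, hm, tabOff_eq_zero s (by omega), zero_smul, add_zero]
    congr 1
    have := hs.ne_zero
    have := hs.sub_one
    rw [tabDiag, zpow_neg, zpow_one]
    field_simp
  · rw [if_neg (by omega), if_pos h1, hm, tabOff_eq_zero s (by omega), zero_smul, add_zero]
    rw [tabDiag, zpow_one, ← neg_sub s 1, div_neg, div_self hs.sub_one, neg_smul, one_smul]
  · rw [if_neg (by omega), if_neg (by omega), if_pos h1]
    simp only [tabDiag, tabOff, if_pos hm, one_smul]
    rw [sub_eq_neg_add, ← neg_smul, ← neg_div, neg_sub]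
  · rw [if_neg (by omega), if_neg (by omega), if_neg (by omega)]
    simp only [tabDiag, tabOff]
    rw [if_neg (by omega), if_pos hm]

/-- The second column of the matrix of `T_i` on a pair of exchanged tableaux, written for the
multiple of the tableau that occurs in the image of the first one (zero when the exchange is not
possible). -/
theorem tabT_exch {s : K} (hs : NonRoot s) (i : Fin n) (A : RST n lam) {m : ℤ}
    (hm : A.ct i.succ - A.ct i.castSucc = m) :
    tabT s i (tabOff s m • Finsupp.single (A.exch i.castSucc i.succ) (1 : K)) =
      tabProd s m • Finsupp.single A (1 : K) +
      tabDiag s (-m) • tabOff s m • Finsupp.single (A.exch i.castSucc i.succ) (1 : K) := by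
  have hab : ((i.succ : Fin (n + 1)) : ℕ) = i.castSucc + 1 := by simp
  have hm0 : m ≠ 0 := hm ▸ A.ct_ne hab
  by_cases h : m ≤ -2 ∨ 2 ≤ m
  · have h' := h
    rw [← hm] at h'
    rw [map_smul, tabT_single hs, A.exch_exch hab h', A.exch_ct hab h', A.exch_ct hab h',
      Equiv.swap_apply_left, Equiv.swap_apply_right, ← neg_sub, hm, smul_add, smul_smul, smul_smul,
      smul_smul, tabOff_mul hs h, add_comm, mul_comm]
  · rw [tabOff_eq_zero s h, tabProd_eq_zero s hm0 h]
    simp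

theorem tabT_quadratic {s : K} (hs : NonRoot s) (i : Fin n)  (u : RST n lam →₀ K) :
    tabT s i (tabT s i u) = (s - 1) • tabT s i u + s • u := by
  induction u using Finsupp.induction_linear with
  | zero => simp
  | add u v hu hv => rw [map_add, map_add, hu, hv]; module
  | single A c =>
    rw [← mul_one c, ← smul_eq_mul, ← Finsupp.smul_single, map_smul, map_smul, smul_comm _ c,
      smul_comm _ c, ← smul_add]
    congr 1
    have hab : ((i.succ : Fin (n + 1)) : ℕ) = i.castSucc + 1 := by simp
    have hm0 := A.ct_ne hab
    rw [tabT_single hs, map_add, tabT_exch hs i A rfl, map_smul, tabT_single hs]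
    set m := A.ct i.succ - A.ct i.castSucc
    rw [tabProd_eq hs hm0, tabDiag_neg hs hm0]
    module

theorem tabT_comm {s : K} (hs : NonRoot s) {i j : Fin n} (hij : (i : ℕ) + 2 ≤ j)
    (u : RST n lam →₀ K) : tabT s i (tabT s j u) = tabT s j (tabT s i u) := by
  induction u using Finsupp.induction_linear with
  | zero => simp
  | add u v hu hv => simp only [map_add, hu, hv]
  | single A c =>
    rw [← mul_one c, ← smul_eq_mul, ← Finsupp.smul_single]
    simp only [map_smul]
    congr 1
    have hi : ((i.succ : Fin (n + 1)) : ℕ) = i.castSucc + 1 := by simp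
    have hj : ((j.succ : Fin (n + 1)) : ℕ) = j.castSucc + 1 := by simp
    have n1 : i.castSucc ≠ j.castSucc := by simp [Fin.ext_iff]; omega
    have n2 : i.castSucc ≠ j.succ := by simp [Fin.ext_iff]; omega
    have n3 : i.succ ≠ j.castSucc := by simp [Fin.ext_iff]; omega
    have n4 : i.succ ≠ j.succ := by simp [Fin.ext_iff]; omega
    have ci : ∀ h, (A.exch i.castSucc i.succ).ct j.succ - (A.exch i.castSucc i.succ).ct j.castSucc
        = A.ct j.succ - A.ct j.castSucc := fun h => by
      rw [A.exch_ct hi h, A.exch_ct hi h, Equiv.swap_apply_of_ne_of_ne n2.symm n4.symm,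
        Equiv.swap_apply_of_ne_of_ne n1.symm n3.symm]
    have cj : ∀ h, (A.exch j.castSucc j.succ).ct i.succ - (A.exch j.castSucc j.succ).ct i.castSucc
        = A.ct i.succ - A.ct i.castSucc := fun h => by
      rw [A.exch_ct hj h, A.exch_ct hj h, Equiv.swap_apply_of_ne_of_ne n3 n4,
        Equiv.swap_apply_of_ne_of_ne n1 n2]
    rw [tabT_single hs j, tabT_single hs i]
    simp only [map_add, map_smul, tabT_single hs]
    by_cases h1 : A.ct i.succ - A.ct i.castSucc ≤ -2 ∨ 2 ≤ A.ct i.succ - A.ct i.castSucc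
    · by_cases h2 : A.ct j.succ - A.ct j.castSucc ≤ -2 ∨ 2 ≤ A.ct j.succ - A.ct j.castSucc
      · have e : (A.exch i.castSucc i.succ).exch j.castSucc j.succ =
            (A.exch j.castSucc j.succ).exch i.castSucc i.succ := by
          apply RST.ext
          rw [RST.exch_cell _ hj (by rw [ci h1]; exact h2), RST.exch_cell _ hi h1,
            RST.exch_cell _ hi (by rw [cj h2]; exact h1), RST.exch_cell _ hj h2,
            ← Equiv.trans_assoc, ← Equiv.trans_assoc]
          congr 1
          ext k
          simp only [Equiv.trans_apply, Equiv.swap_apply_def]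
          split_ifs <;> simp_all
        rw [ci h1, cj h2, e]
        module
      · rw [ci h1, tabOff_eq_zero s h2]
        module
    · by_cases h2 : A.ct j.succ - A.ct j.castSucc ≤ -2 ∨ 2 ≤ A.ct j.succ - A.ct j.castSucc
      · rw [cj h2, tabOff_eq_zero s h1]
        module
      · rw [tabOff_eq_zero s h1, tabOff_eq_zero s h2]
        module

/-- The braid relation on the orbit of a vector `e` under two operators, where `eᵢ`, `eᵢⱼ` stand for
the multiples of the successively exchanged basis vectors. -/
theorem braid_of_orbit {V : Type*} [AddCommGroup V] [Module K V] (T₁ T₂ : Module.End K V)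
    {e e₁ e₂ e₁₂ e₂₁ e' : V} {a₁ a₂ a₃ b₁ b₂ p₁ p₂ : K}
    (h1 : T₁ e = a₁ • e + e₁) (h11 : T₁ e₁ = p₁ • e + b₁ • e₁)
    (h2 : T₂ e = a₂ • e + e₂) (h22 : T₂ e₂ = p₂ • e + b₂ • e₂)
    (h12 : T₂ e₁ = a₃ • e₁ + e₁₂) (h21 : T₁ e₂ = a₃ • e₂ + e₂₁)
    (h121 : T₁ e₁₂ = a₂ • e₁₂ + e') (h212 : T₂ e₂₁ = a₁ • e₂₁ + e')
    (c0 : a₁ ^ 2 * a₂ + a₃ * p₁ = a₂ ^ 2 * a₁ + a₃ * p₂)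
    (c1 : a₁ * a₂ + a₃ * b₁ = a₂ * a₃) (c2 : a₁ * a₃ = a₁ * a₂ + a₃ * b₂) :
    T₁ (T₂ (T₁ e)) = T₂ (T₁ (T₂ e)) := by
  have l : T₁ (T₂ (T₁ e)) = (a₁ ^ 2 * a₂ + a₃ * p₁) • e + (a₁ * a₂ + a₃ * b₁) • e₁ +
      (a₁ * a₃) • e₂ + a₂ • e₁₂ + a₁ • e₂₁ + e' := by
    simp only [h1, h2, h12, h121, h11, h21, map_add, map_smul]; module
  have r : T₂ (T₁ (T₂ e)) = (a₂ ^ 2 * a₁ + a₃ * p₂) • e + (a₂ * a₃) • e₁ +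
      (a₁ * a₂ + a₃ * b₂) • e₂ + a₂ • e₁₂ + a₁ • e₂₁ + e' := by
    simp only [h1, h2, h12, h212, h22, h21, map_add, map_smul]; module
  rw [l, r, c0, c1, c2]

theorem RST.ct_ne_two (A : RST n lam) {a c : Fin (n + 1)} (hac : (c : ℕ) = a + 2) :
    A.ct c - A.ct a ≠ 0 := by
  intro h
  have := A.ct_eq_gap (k := a) (l := c) (by omega) (by rw [Fin.lt_def]; omega)
  omega

theorem tabDiag_rel {s : K} (hs : NonRoot s) {m₁ m₂ : ℤ} (h1 : m₁ ≠ 0) (h2 : m₂ ≠ 0)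
    (h3 : m₁ + m₂ ≠ 0) :
    tabDiag s m₁ * tabDiag s m₂ + tabDiag s (m₁ + m₂) * (s - 1 - tabDiag s m₁) =
      tabDiag s m₂ * tabDiag s (m₁ + m₂) := by
  have e1 := hs.one_sub_zpow h1
  have e2 := hs.one_sub_zpow h2
  have e3 := hs.one_sub_zpow h3
  unfold tabDiag
  rw [zpow_add₀ hs.ne_zero] at *
  generalize s ^ m₁ = u at *
  generalize s ^ m₂ = v at *
  field_simp
  ring

theorem swap_braid {α : Type*} [DecidableEq α] {a b d : α} (h1 : a ≠ b) (h2 : b ≠ d) (h3 : a ≠ d)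
    (k : α) : Equiv.swap a b (Equiv.swap b d (Equiv.swap a b k)) =
      Equiv.swap b d (Equiv.swap a b (Equiv.swap b d k)) := by
  have e1 := Equiv.swap_mul_swap_mul_swap (x := d) (y := b) (z := a) h2.symm h3.symm
  have e2 := Equiv.swap_mul_swap_mul_swap (x := a) (y := b) (z := d) h1 h3
  rw [Equiv.swap_comm b a, Equiv.swap_comm d b, Equiv.swap_comm a d, ← e2] at e1
  exact congrArg (fun σ : Equiv.Perm α => σ k) e1

theorem tabT_braid {s : K} (hs : NonRoot s) {i j : Fin n} (hij : (j : ℕ) = i + 1)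
    (u : RST n lam →₀ K) :
    tabT s i (tabT s j (tabT s i u)) = tabT s j (tabT s i (tabT s j u)) := by
  induction u using Finsupp.induction_linear with
  | zero => simp
  | add u v hu hv => simp only [map_add, hu, hv]
  | single A c =>
    rw [← mul_one c, ← smul_eq_mul, ← Finsupp.smul_single]
    simp only [map_smul]
    congr 1
    obtain ⟨a, ha⟩ : ∃ a, a = i.castSucc := ⟨_, rfl⟩
    obtain ⟨b, hb⟩ : ∃ b, b = i.succ := ⟨_, rfl⟩
    obtain ⟨d, hd⟩ : ∃ d, d = j.succ := ⟨_, rfl⟩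
    have hb' : b = j.castSucc := by rw [hb]; ext; simp [hij]
    have hab : (b : ℕ) = a + 1 := by simp [ha, hb]
    have hbd : (d : ℕ) = b + 1 := by simp [hd, hb']
    have nab : a ≠ b := by rintro rfl; omega
    have nbd : b ≠ d := by rintro rfl; omega
    have nad : a ≠ d := by rintro rfl; omega
    have T1 : ∀ B : RST n lam, tabT s i (Finsupp.single B (1 : K)) = _ := tabT_single hs i
    have T2 : ∀ B : RST n lam, tabT s j (Finsupp.single B (1 : K)) = _ := tabT_single hs j
    have X1 := fun m hm => tabT_exch hs i A (m := m) hm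
    have X2 := fun m hm => tabT_exch hs j A (m := m) hm
    rw [← ha, ← hb] at T1 X1
    rw [← hb', ← hd] at T2 X2
    have hm1 := A.ct_ne hab
    have hm2 := A.ct_ne hbd
    have hm3 := A.ct_ne_two (a := a) (c := d) (by omega)
    obtain ⟨m₁, e1⟩ : ∃ m, A.ct b - A.ct a = m := ⟨_, rfl⟩
    obtain ⟨m₂, e2⟩ : ∃ m, A.ct d - A.ct b = m := ⟨_, rfl⟩
    have e3 : A.ct d - A.ct a = m₁ + m₂ := by omega
    rw [e1] at hm1; rw [e2] at hm2; rw [e3] at hm3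
    -- the contents of the exchanged tableaux
    have C1 : ∀ B : RST n lam, ∀ m, B.ct b - B.ct a = m → (m ≤ -2 ∨ 2 ≤ m) →
        (B.exch a b).ct a = B.ct b ∧ (B.exch a b).ct b = B.ct a ∧ (B.exch a b).ct d = B.ct d := by
      intro B m hm h
      rw [← hm] at h
      simp [B.exch_ct hab h, Equiv.swap_apply_of_ne_of_ne nad.symm nbd.symm]
    have C2 : ∀ B : RST n lam, ∀ m, B.ct d - B.ct b = m → (m ≤ -2 ∨ 2 ≤ m) →
        (B.exch b d).ct a = B.ct a ∧ (B.exch b d).ct b = B.ct d ∧ (B.exch b d).ct d = B.ct b := by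
      intro B m hm h
      rw [← hm] at h
      simp [B.exch_ct hbd h, Equiv.swap_apply_of_ne_of_ne nab nad]
    refine braid_of_orbit (tabT s i) (tabT s j)
      (e₁ := tabOff s m₁ • Finsupp.single (A.exch a b) 1)
      (e₂ := tabOff s m₂ • Finsupp.single (A.exch b d) 1)
      (e₁₂ := (tabOff s m₁ * tabOff s (m₁ + m₂)) • Finsupp.single ((A.exch a b).exch b d) 1)
      (e₂₁ := (tabOff s m₂ * tabOff s (m₁ + m₂)) • Finsupp.single ((A.exch b d).exch a b) 1)
      (e' := (tabOff s m₁ * tabOff s (m₁ + m₂) * tabOff s m₂) •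
        Finsupp.single (((A.exch a b).exch b d).exch a b) 1)
      (a₁ := tabDiag s m₁) (a₂ := tabDiag s m₂) (a₃ := tabDiag s (m₁ + m₂))
      (b₁ := tabDiag s (-m₁)) (b₂ := tabDiag s (-m₂)) (p₁ := tabProd s m₁) (p₂ := tabProd s m₂)
      ?_ (X1 _ e1) ?_ (X2 _ e2) ?_ ?_ ?_ ?_ ?_ ?_ ?_
    · rw [T1, e1]
    · rw [T2, e2]
    · by_cases h1 : m₁ ≤ -2 ∨ 2 ≤ m₁
      · obtain ⟨f1, f2, f3⟩ := C1 A _ e1 h1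
        rw [map_smul, T2, f2, f3, e3]
        module
      · rw [tabOff_eq_zero s h1]; simp
    · by_cases h2 : m₂ ≤ -2 ∨ 2 ≤ m₂
      · obtain ⟨f1, f2, f3⟩ := C2 A _ e2 h2
        rw [map_smul, T1, f2, f1, e3]
        module
      · rw [tabOff_eq_zero s h2]; simp
    · by_cases h1 : m₁ ≤ -2 ∨ 2 ≤ m₁
      · by_cases h3 : m₁ + m₂ ≤ -2 ∨ 2 ≤ m₁ + m₂
        · obtain ⟨f1, f2, f3⟩ := C1 A _ e1 h1
          obtain ⟨g1, g2, g3⟩ := C2 (A.exch a b) (m₁ + m₂) (by omega) h3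
          rw [map_smul, T1, g1, g2, f1, f3, e2]
          module
        · rw [tabOff_eq_zero s h3]; simp
      · rw [tabOff_eq_zero s h1]; simp
    · by_cases h2 : m₂ ≤ -2 ∨ 2 ≤ m₂
      · by_cases h3 : m₁ + m₂ ≤ -2 ∨ 2 ≤ m₁ + m₂
        · obtain ⟨f1, f2, f3⟩ := C2 A _ e2 h2
          obtain ⟨g1, g2, g3⟩ := C1 (A.exch b d) (m₁ + m₂) (by omega) h3
          rw [map_smul, T2, g2, g3, f1, f3, e1]
          by_cases h1 : m₁ ≤ -2 ∨ 2 ≤ m₁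
          · obtain ⟨k1, k2, k3⟩ := C1 A _ e1 h1
            obtain ⟨l1, l2, l3⟩ := C2 (A.exch a b) (m₁ + m₂) (by omega) h3
            have e : ((A.exch a b).exch b d).exch a b = ((A.exch b d).exch a b).exch b d := by
              apply RST.ext
              rw [RST.exch_cell _ hab (by omega), RST.exch_cell _ hbd (by omega),
                RST.exch_cell _ hab (by omega), RST.exch_cell _ hbd (by omega),
                RST.exch_cell _ hab (by omega), RST.exch_cell _ hbd (by omega)]
              ext k : 1
              exact congrArg A.cell (swap_braid nab nbd nad k)
            rw [e]
            module
          · rw [tabOff_eq_zero s h1]; module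
        · rw [tabOff_eq_zero s h3]; simp
      · rw [tabOff_eq_zero s h2]; simp
    · have h12 := tabDiag_rel hs hm1 hm2 hm3
      rw [tabProd_eq hs hm1, tabProd_eq hs hm2]
      linear_combination (tabDiag s m₁ - tabDiag s m₂) * h12
    · rw [tabDiag_neg hs hm1]; exact tabDiag_rel hs hm1 hm2 hm3
    · rw [tabDiag_neg hs hm2]
      linear_combination -(tabDiag_rel hs hm1 hm2 hm3)

/-! ### The operators on vector valued polynomials -/

/-- The space `K[x] ⊗ V_lam` is generated by `1 ⊗ V_lam` under multiplication by the variables. -/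
theorem vv_induction {p : VVPoly K n lam → Prop} (hone : ∀ u, p (1 ⊗ₜ u))
    (hadd : ∀ v w, p v → p w → p (v + w)) (hX : ∀ j v, p v → p (mulX j v)) (v : VVPoly K n lam) :
    p v := by
  induction v using TensorProduct.induction_on with
  | zero => simpa using hone 0
  | add v w hv hw => exact hadd v w hv hw
  | tmul f u =>
    induction f using MvPolynomial.induction_on with
    | C a =>
      have : (MvPolynomial.C a : MvPolynomial (Fin (n + 1)) K) = a • 1 := by
        rw [MvPolynomial.smul_eq_C_mul, mul_one]
      rw [this, TensorProduct.smul_tmul]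
      exact hone _
    | add f g hf hg => rw [TensorProduct.add_tmul]; exact hadd _ _ hf hg
    | mul_X f j hf =>
      have := hX j _ hf
      rwa [mulX, TensorProduct.map_tmul, LinearMap.mulLeft_apply, mul_comm, LinearMap.id_apply]
        at this

theorem divDiff_spec (i : Fin n) (f : MvPolynomial (Fin (n + 1)) K) :
    (MvPolynomial.X i.castSucc - MvPolynomial.X i.succ) * divDiff i f = f - swapX i f :=
  (sub_swapX_dvd i f).choose_spec.symm

theorem divDiff_eq (i : Fin n) {f g : MvPolynomial (Fin (n + 1)) K}
    (h : f - swapX i f = (MvPolynomial.X i.castSucc - MvPolynomial.X i.succ) * g) :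
    divDiff i f = g :=
  mul_left_cancel₀ (X_sub_X_ne_zero (K := K) i) (by rw [divDiff_spec, h])

theorem swapX_X (i : Fin n) (j : Fin (n + 1)) :
    swapX (K := K) i (MvPolynomial.X j) =
      MvPolynomial.X (Equiv.swap i.castSucc i.succ j) := by
  simp [swapX]

theorem divDiff_X_castSucc (i : Fin n) (f : MvPolynomial (Fin (n + 1)) K) :
    divDiff i (MvPolynomial.X i.castSucc * f) = MvPolynomial.X i.succ * divDiff i f + f := by
  apply divDiff_eq
  rw [map_mul, swapX_X, Equiv.swap_apply_left]
  linear_combination (-MvPolynomial.X i.succ) * divDiff_spec i f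

theorem divDiff_X_succ (i : Fin n) (f : MvPolynomial (Fin (n + 1)) K) :
    divDiff i (MvPolynomial.X i.succ * f) = MvPolynomial.X i.castSucc * divDiff i f - f := by
  apply divDiff_eq
  rw [map_mul, swapX_X, Equiv.swap_apply_right]
  linear_combination (-MvPolynomial.X i.castSucc) * divDiff_spec i f

theorem divDiff_X_of_ne (i : Fin n) {j : Fin (n + 1)} (h1 : j ≠ i.castSucc) (h2 : j ≠ i.succ)
    (f : MvPolynomial (Fin (n + 1)) K) :
    divDiff i (MvPolynomial.X j * f) = MvPolynomial.X j * divDiff i f := by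
  apply divDiff_eq
  rw [map_mul, swapX_X, Equiv.swap_apply_of_ne_of_ne h1 h2]
  linear_combination (-MvPolynomial.X j) * divDiff_spec i f

theorem divDiff_one (i : Fin n) : divDiff i (1 : MvPolynomial (Fin (n + 1)) K) = 0 := by
  apply divDiff_eq; simp

theorem bT_one_tmul (s : K) (i : Fin n) (u : RST n lam →₀ K) :
    bT s i (1 ⊗ₜ u) = 1 ⊗ₜ tabT s i u := by
  simp [bT, delta, divDiff_one]

theorem bT_tmul (s : K) (i : Fin n) (f : MvPolynomial (Fin (n + 1)) K) (u : RST n lam →₀ K) :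
    bT s i (f ⊗ₜ u) = ((1 - s) • (MvPolynomial.X i.succ * divDiff i f)) ⊗ₜ u +
      swapX i f ⊗ₜ tabT s i u := by
  simp [bT, delta]

theorem mulX_tmul (j : Fin (n + 1)) (f : MvPolynomial (Fin (n + 1)) K) (u : RST n lam →₀ K) :
    mulX j (f ⊗ₜ u : VVPoly K n lam) = (MvPolynomial.X j * f) ⊗ₜ u := by
  simp [mulX]

theorem mulX_comm (i j : Fin (n + 1)) (v : VVPoly K n lam) :
    mulX i (mulX j v) = mulX j (mulX i v) := by
  induction v using TensorProduct.induction_on with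
  | zero => simp
  | add v w hv hw => simp only [map_add, hv, hw]
  | tmul f u => rw [mulX_tmul, mulX_tmul, mulX_tmul, mulX_tmul, mul_left_comm]

theorem bT_mulX_castSucc (s : K) (i : Fin n) (v : VVPoly K n lam) :
    bT s i (mulX i.castSucc v) = mulX i.succ (bT s i v) + (1 - s) • mulX i.succ v := by
  induction v using TensorProduct.induction_on with
  | zero => simp
  | add v w hv hw => simp only [map_add, hv, hw]; module
  | tmul f u =>
    simp only [mulX_tmul, bT_tmul, map_add, map_mul, swapX_X, Equiv.swap_apply_left,
      divDiff_X_castSucc, TensorProduct.smul_tmul']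
    rw [add_right_comm, ← TensorProduct.add_tmul]
    congr 2
    rw [mul_smul_comm, ← smul_add]
    ring_nf

theorem bT_mulX_succ (s : K) (i : Fin n) (v : VVPoly K n lam) :
    bT s i (mulX i.succ v) = mulX i.castSucc (bT s i v) - (1 - s) • mulX i.succ v := by
  induction v using TensorProduct.induction_on with
  | zero => simp
  | add v w hv hw => simp only [map_add, hv, hw]; module
  | tmul f u =>
    simp only [mulX_tmul, bT_tmul, map_add, map_mul, swapX_X, Equiv.swap_apply_right,
      divDiff_X_succ, TensorProduct.smul_tmul']
    rw [add_sub_right_comm, ← TensorProduct.sub_tmul]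
    congr 2
    rw [mul_smul_comm, ← smul_sub]
    ring_nf

theorem bT_mulX_of_ne (s : K) (i : Fin n) {j : Fin (n + 1)} (h1 : j ≠ i.castSucc)
    (h2 : j ≠ i.succ) (v : VVPoly K n lam) :
    bT s i (mulX j v) = mulX j (bT s i v) := by
  induction v using TensorProduct.induction_on with
  | zero => simp
  | add v w hv hw => simp only [map_add, hv, hw]
  | tmul f u =>
    simp only [mulX_tmul, bT_tmul, map_add, map_mul, swapX_X, Equiv.swap_apply_of_ne_of_ne h1 h2,
      divDiff_X_of_ne i h1 h2]
    congr 2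
    rw [mul_smul_comm, mul_left_comm]

theorem bT_quadratic {s : K} (hs : NonRoot s) (i : Fin n) (v : VVPoly K n lam) :
    bT s i (bT s i v) = (s - 1) • bT s i v + s • v := by
  induction v using vv_induction with
  | hone u =>
    rw [bT_one_tmul, bT_one_tmul, tabT_quadratic hs, TensorProduct.tmul_add,
      TensorProduct.tmul_smul, TensorProduct.tmul_smul]
  | hadd v w hv hw => rw [map_add, map_add, hv, hw]; module
  | hX j v hv =>
    by_cases h1 : j = i.castSucc
    · subst h1
      simp only [bT_mulX_castSucc, bT_mulX_succ, map_add, map_smul, hv]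
      module
    by_cases h2 : j = i.succ
    · subst h2
      simp only [bT_mulX_castSucc, bT_mulX_succ, map_sub, map_smul, hv, map_add]
      module
    simp only [bT_mulX_of_ne s i h1 h2, hv, map_add, map_smul]

theorem bT_comm {s : K} (hs : NonRoot s) {i j : Fin n} (hij : (i : ℕ) + 2 ≤ j)
    (v : VVPoly K n lam) : bT s i (bT s j v) = bT s j (bT s i v) := by
  induction v using vv_induction with
  | hone u => simp only [bT_one_tmul, tabT_comm hs hij]
  | hadd v w hv hw => simp only [map_add, hv, hw]
  | hX k v hv =>
    have n1 : i.castSucc ≠ j.castSucc := by simp [Fin.ext_iff]; omega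
    have n2 : i.castSucc ≠ j.succ := by simp [Fin.ext_iff]; omega
    have n3 : i.succ ≠ j.castSucc := by simp [Fin.ext_iff]; omega
    have n4 : i.succ ≠ j.succ := by simp [Fin.ext_iff]; omega
    by_cases h1 : k = i.castSucc
    · subst h1
      simp only [bT_mulX_castSucc, bT_mulX_of_ne s j n1 n2, bT_mulX_of_ne s j n3 n4, map_add,
        map_smul, hv]
    by_cases h2 : k = i.succ
    · subst h2
      simp only [bT_mulX_succ, bT_mulX_of_ne s j n1 n2, bT_mulX_of_ne s j n3 n4, map_sub,
        map_smul, hv]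
    by_cases h3 : k = j.castSucc
    · subst h3
      simp only [bT_mulX_castSucc, bT_mulX_of_ne s i n1.symm n3.symm,
        bT_mulX_of_ne s i n2.symm n4.symm, map_add, map_smul, hv]
    by_cases h4 : k = j.succ
    · subst h4
      simp only [bT_mulX_succ, bT_mulX_of_ne s i n1.symm n3.symm,
        bT_mulX_of_ne s i n2.symm n4.symm, map_sub, map_smul, hv]
    simp only [bT_mulX_of_ne s i h1 h2, bT_mulX_of_ne s j h3 h4, hv]

theorem bT_braid {s : K} (hs : NonRoot s) {i j : Fin n} (hij : (j : ℕ) = i + 1)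
    (v : VVPoly K n lam) :
    bT s i (bT s j (bT s i v)) = bT s j (bT s i (bT s j v)) := by
  induction v using vv_induction with
  | hone u => simp only [bT_one_tmul, tabT_braid hs hij]
  | hadd v w hv hw => simp only [map_add, hv, hw]
  | hX k v hv =>
    obtain ⟨a, ha⟩ : ∃ a, a = i.castSucc := ⟨_, rfl⟩
    obtain ⟨b, hb⟩ : ∃ b, b = i.succ := ⟨_, rfl⟩
    obtain ⟨d, hd⟩ : ∃ d, d = j.succ := ⟨_, rfl⟩
    have hb' : b = j.castSucc := by rw [hb]; ext; simp [hij]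
    have hab : (b : ℕ) = a + 1 := by simp [ha, hb]
    have hbd : (d : ℕ) = b + 1 := by simp [hd, hb']
    have nab : a ≠ b := by rintro rfl; omega
    have nbd : b ≠ d := by rintro rfl; omega
    have nad : a ≠ d := by rintro rfl; omega
    have i1 : ∀ w : VVPoly K n lam, _ := bT_mulX_castSucc s i
    have i2 : ∀ w : VVPoly K n lam, _ := bT_mulX_succ s i
    have i3 : ∀ k, _ → _ → ∀ w : VVPoly K n lam, _ := fun k h1 h2 =>
      bT_mulX_of_ne s i (j := k) h1 h2
    have j1 : ∀ w : VVPoly K n lam, _ := bT_mulX_castSucc s j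
    have j2 : ∀ w : VVPoly K n lam, _ := bT_mulX_succ s j
    have j3 : ∀ k, _ → _ → ∀ w : VVPoly K n lam, _ := fun k h1 h2 =>
      bT_mulX_of_ne s j (j := k) h1 h2
    rw [← ha, ← hb] at i1 i2 i3
    rw [← hb', ← hd] at j1 j2 j3
    have i3d := i3 d nad.symm nbd.symm
    have j3a := j3 a nab nad
    by_cases h1 : k = a
    · subst h1
      simp only [i1, i3d, j1, j3a, map_add, map_smul, hv, bT_quadratic hs]
      module
    by_cases h2 : k = b
    · subst h2
      simp only [i1, i2, i3d, j1, j2, j3a, map_add, map_sub, map_smul, hv]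
      module
    by_cases h3 : k = d
    · subst h3
      simp only [i2, i3d, j1, j2, j3a, map_add, map_sub, map_smul, hv, bT_quadratic hs]
      module
    simp only [i3 k h1 h2, j3 k h2 h3, hv]

theorem bTinv_apply (s : K) (i : Fin n) (v : VVPoly K n lam) :
    bTinv s i v = s⁻¹ • (bT s i v + (1 - s) • v) := by
  simp [bTinv]

theorem bw_tmul (q s : K) (f : MvPolynomial (Fin (n + 1)) K) (u : RST n lam →₀ K) :
    bw q s (f ⊗ₜ u) = wX q f ⊗ₜ tabS s u := by
  simp [bw]

theorem bw_mulX_succ (q s : K) (j : Fin n) (v : VVPoly K n lam) :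
    bw q s (mulX j.succ v) = mulX j.castSucc (bw q s v) := by
  induction v using TensorProduct.induction_on with
  | zero => simp
  | add v w hv hw => simp only [map_add, hv, hw]
  | tmul f u => simp [mulX_tmul, bw_tmul, wX]

theorem bw_mulX_zero (q s : K) (v : VVPoly K n lam) :
    bw q s (mulX 0 v) = q • mulX (Fin.last n) (bw q s v) := by
  induction v using TensorProduct.induction_on with
  | zero => simp
  | add v w hv hw => simp only [map_add, hv, hw, smul_add]
  | tmul f u =>
    simp only [mulX_tmul, bw_tmul, map_mul, TensorProduct.smul_tmul']
    congr 1
    simp [wX, MvPolynomial.smul_eq_C_mul, mul_assoc]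

/-! ### Relations in the double affine Hecke algebra -/

section Ring

variable {R : Type*} [Ring R]

/-- The product `h (k-1) ⋯ h 1 h 0`. -/
def downProd (h : ℕ → R) : ℕ → R
  | 0 => 1
  | k + 1 => h k * downProd h k

/-- The product `h 0 h 1 ⋯ h (k-1)`. -/
def upProd (h : ℕ → R) : ℕ → R
  | 0 => 1
  | k + 1 => upProd h k * h k

theorem downProd_succ' (h : ℕ → R) (k : ℕ) :
    downProd h (k + 1) = downProd (fun i => h (i + 1)) k * h 0 := by
  induction k with
  | zero => simp [downProd]
  | succ k ih => rw [downProd, ih, downProd, mul_assoc]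

theorem upProd_succ' (h : ℕ → R) (k : ℕ) :
    upProd h (k + 1) = h 0 * upProd (fun i => h (i + 1)) k := by
  induction k with
  | zero => simp [upProd]
  | succ k ih => rw [upProd, ih, upProd, mul_assoc]

theorem upProd_mul_downProd {n : ℕ} {g h : ℕ → R} (H : ∀ i < n, g i * h i = 1) :
    ∀ k ≤ n, upProd g k * downProd h k = 1
  | 0, _ => by simp [upProd, downProd]
  | k + 1, hk => by
    rw [upProd, downProd, mul_assoc, ← mul_assoc (g k), H k (by omega), one_mul,
      upProd_mul_downProd H k (by omega)]

theorem downProd_mul_upProd {n : ℕ} {g h : ℕ → R} (H : ∀ i < n, g i * h i = 1) :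
    ∀ k ≤ n, downProd g k * upProd h k = 1
  | 0, _ => by simp [upProd, downProd]
  | k + 1, hk => by
    rw [downProd_succ', upProd_succ', mul_assoc, ← mul_assoc (g 0), H 0 (by omega), one_mul]
    exact downProd_mul_upProd (n := k) (fun i hi => H (i + 1) (by omega)) k le_rfl

/-- `g i` commutes with `h j` when `i` and `j` differ by at least two. -/
def FarComm (n : ℕ) (g h : ℕ → R) : Prop :=
  ∀ i j, i < n → j < n → (i + 2 ≤ j ∨ j + 2 ≤ i) → g i * h j = h j * g i

theorem FarComm.downProd_comm {g h : ℕ → R} (hc : FarComm n g h) {j : ℕ} (hj : j < n) :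
    ∀ k < j, g j * downProd h k = downProd h k * g j
  | 0, _ => by simp [downProd]
  | k + 1, hk => by
    rw [downProd, ← mul_assoc, hc j k hj (by omega) (by omega), mul_assoc,
      hc.downProd_comm hj k (by omega), mul_assoc]

theorem FarComm.upProd_comm {g h : ℕ → R} (hc : FarComm n g h) {j : ℕ} (hj : j < n) :
    ∀ k < j, g j * upProd h k = upProd h k * g j
  | 0, _ => by simp [upProd]
  | k + 1, hk => by
    rw [upProd, ← mul_assoc, hc.upProd_comm hj k (by omega), mul_assoc,
      hc j k hj (by omega) (by omega), mul_assoc]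

theorem mul_downProd_shift {g h : ℕ → R} (hc : FarComm n g h)
    (hb : ∀ i, i + 1 < n → g i * (h (i + 1) * h i) = h (i + 1) * h i * g (i + 1)) {i : ℕ} :
    ∀ k ≤ n, i + 1 < k → g i * downProd h k = downProd h k * g (i + 1)
  | 0, _, h => by omega
  | k + 1, hk, hi => by
    rcases Nat.lt_or_ge (i + 1) k with h' | h'
    · rw [downProd, ← mul_assoc, hc i k (by omega) (by omega) (by omega), mul_assoc,
        mul_downProd_shift hc hb k (by omega) h', mul_assoc]
    · obtain rfl : k = i + 1 := by omega
      rw [downProd, downProd, ← mul_assoc (h (i + 1)), ← mul_assoc, hb i (by omega), mul_assoc,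
        hc.downProd_comm (by omega) i (by omega), mul_assoc, mul_assoc, mul_assoc]

theorem upProd_mul_shift {g h : ℕ → R} (hc : FarComm n g h)
    (hb : ∀ i, i + 1 < n → h i * h (i + 1) * g i = g (i + 1) * (h i * h (i + 1))) {i : ℕ} :
    ∀ k ≤ n, i + 1 < k → upProd h k * g i = g (i + 1) * upProd h k
  | 0, _, h => by omega
  | k + 1, hk, hi => by
    rcases Nat.lt_or_ge (i + 1) k with h' | h'
    · rw [upProd, mul_assoc, ← hc i k (by omega) (by omega) (by omega), ← mul_assoc,
        upProd_mul_shift hc hb k (by omega) h', mul_assoc]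
    · obtain rfl : k = i + 1 := by omega
      rw [upProd, upProd, mul_assoc (upProd h i), mul_assoc, hb i (by omega), ← mul_assoc,
        ← hc.upProd_comm (by omega) i (by omega), mul_assoc]

theorem mul_downProd_shift_prod {g h : ℕ → R} (hc : FarComm n g h)
    (hb : ∀ i, i + 1 < n → g i * (h (i + 1) * h i) = h (i + 1) * h i * g (i + 1)) :
    ∀ j < n, downProd g j * downProd h n = downProd h n * downProd (fun i => g (i + 1)) j
  | 0, _ => by simp [downProd]
  | j + 1, hj => by
    rw [downProd, mul_assoc, mul_downProd_shift_prod hc hb j (by omega), ← mul_assoc,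
      mul_downProd_shift hc hb n le_rfl hj, downProd, mul_assoc]

theorem upProd_mul_shift_prod {g h : ℕ → R} (hc : FarComm n g h)
    (hb : ∀ i, i + 1 < n → h i * h (i + 1) * g i = g (i + 1) * (h i * h (i + 1))) :
    ∀ j < n, upProd h n * downProd g j = downProd (fun i => g (i + 1)) j * upProd h n
  | 0, _ => by simp [downProd]
  | j + 1, hj => by
    rw [downProd, ← mul_assoc, upProd_mul_shift hc hb n le_rfl hj, mul_assoc,
      upProd_mul_shift_prod hc hb j (by omega), downProd, mul_assoc]

variable [Algebra K R]

/-- The inverse `s⁻¹ (T_i + 1 - s)` of a Hecke generator. -/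
def heckeInv (s : K) (T : ℕ → R) (i : ℕ) : R := s⁻¹ • (T i + (1 - s) • (1 : R))

/-- The elements `T 0, …, T (n-1)` satisfy the relations of the Hecke algebra of the symmetric
group. -/
structure IsHecke (s : K) (n : ℕ) (T : ℕ → R) : Prop where
  ne_zero : s ≠ 0
  quad : ∀ i < n, T i * T i = (s - 1) • T i + s • (1 : R)
  comm : ∀ i j, i + 2 ≤ j → j < n → T i * T j = T j * T i
  braid : ∀ i, i + 1 < n → T i * T (i + 1) * T i = T (i + 1) * T i * T (i + 1)

/-- The relations of the double affine Hecke algebra used for the vector valued polynomials. -/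
structure IsDoubleAffine (q s : K) (n : ℕ) (T X : ℕ → R) (W : R) : Prop extends
    IsHecke s n T where
  T_X : ∀ i < n, T i * X i = s • (X (i + 1) * heckeInv s T i)
  T_X_of_ne : ∀ i j, i < n → j ≤ n → j ≠ i → j ≠ i + 1 → T i * X j = X j * T i
  X_comm : ∀ i j, i ≤ n → j ≤ n → X i * X j = X j * X i
  W_T : ∀ i, i + 1 < n → W * T (i + 1) = T i * W
  W_X : ∀ i < n, W * X (i + 1) = X i * W
  W_X_zero : W * X 0 = q • (X n * W)

namespace IsHecke

variable {s : K} {T : ℕ → R} (H : IsHecke s n T)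
include H

theorem mul_inv {i : ℕ} (hi : i < n) : T i * heckeInv s T i = 1 := by
  rw [heckeInv, mul_smul_comm, mul_add, H.quad i hi, mul_smul_comm, mul_one]
  have : (s - 1) • T i + s • (1 : R) + (1 - s) • T i = s • (1 : R) := by module
  rw [this, smul_smul, inv_mul_cancel₀ H.ne_zero, one_smul]

theorem inv_mul {i : ℕ} (hi : i < n) : heckeInv s T i * T i = 1 := by
  rw [heckeInv, smul_mul_assoc, add_mul, H.quad i hi, smul_mul_assoc, one_mul]
  have : (s - 1) • T i + s • (1 : R) + (1 - s) • T i = s • (1 : R) := by module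
  rw [this, smul_smul, inv_mul_cancel₀ H.ne_zero, one_smul]

omit H in
theorem commute_inv {i : ℕ} {x : R} (h : T i * x = x * T i) :
    heckeInv s T i * x = x * heckeInv s T i := by
  rw [heckeInv, smul_mul_assoc, mul_smul_comm, add_mul, mul_add, h]
  simp

theorem far : FarComm n T T := by
  rintro i j hi hj (h | h)
  · exact H.comm i j h hj
  · exact (H.comm j i h hi).symm

theorem far_inv : FarComm n T (heckeInv s T) := fun i j hi hj h =>
  (commute_inv (H.far j i hj hi h.symm)).symm

theorem far_inv_inv : FarComm n (heckeInv s T) (heckeInv s T) := fun i j hi hj h =>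
  commute_inv (H.far_inv i j hi hj h)

theorem braid_mixed {i : ℕ} (hi : i + 1 < n) :
    T i * (heckeInv s T (i + 1) * heckeInv s T i) =
      heckeInv s T (i + 1) * heckeInv s T i * T (i + 1) := by
  have a1 := H.mul_inv (i := i) (by omega)
  have a2 := H.inv_mul (i := i) (by omega)
  have b1 := H.mul_inv hi
  have b2 := H.inv_mul hi
  have hb := H.braid i hi
  generalize heckeInv s T i = a' at *
  generalize heckeInv s T (i + 1) = b' at *
  generalize T i = a at *
  generalize T (i + 1) = b at *
  have e : b * a * b' = a' * b * a := by
    calc b * a * b' = a' * a * (b * a * b') := by rw [a2, one_mul]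
      _ = a' * (a * b * a) * b' := by simp only [mul_assoc]
      _ = a' * b * a * (b * b') := by rw [hb]; simp only [mul_assoc]
      _ = a' * b * a := by rw [b1, mul_one]
  calc a * (b' * a') = b' * b * (a * (b' * a')) := by rw [b2, one_mul]
    _ = b' * (b * a * b') * a' := by simp only [mul_assoc]
    _ = b' * a' * b * (a * a') := by rw [e]; simp only [mul_assoc]
    _ = b' * a' * b := by rw [a1, mul_one]

theorem braid_mixed' {i : ℕ} (hi : i + 1 < n) :
    heckeInv s T i * heckeInv s T (i + 1) * T i =
      T (i + 1) * (heckeInv s T i * heckeInv s T (i + 1)) := by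
  have a1 := H.mul_inv (i := i) (by omega)
  have a2 := H.inv_mul (i := i) (by omega)
  have b1 := H.mul_inv hi
  have b2 := H.inv_mul hi
  have hb := H.braid i hi
  generalize heckeInv s T i = a' at *
  generalize heckeInv s T (i + 1) = b' at *
  generalize T i = a at *
  generalize T (i + 1) = b at *
  have e : b' * a * b = a * b * a' := by
    calc b' * a * b = b' * a * b * (a * a') := by rw [a1, mul_one]
      _ = b' * (a * b * a) * a' := by simp only [mul_assoc]
      _ = b' * b * (a * b * a') := by rw [hb]; simp only [mul_assoc]
      _ = a * b * a' := by rw [b2, one_mul]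
  calc a' * b' * a = a' * b' * a * (b * b') := by rw [b1, mul_one]
    _ = a' * (b' * a * b) * b' := by simp only [mul_assoc]
    _ = a' * a * (b * a' * b') := by rw [e]; simp only [mul_assoc]
    _ = b * (a' * b') := by rw [a2, one_mul, mul_assoc]

theorem braid_inv {i : ℕ} (hi : i + 1 < n) :
    heckeInv s T i * (heckeInv s T (i + 1) * heckeInv s T i) =
      heckeInv s T (i + 1) * heckeInv s T i * heckeInv s T (i + 1) := by
  have a2 := H.inv_mul (i := i) (by omega)
  have b1 := H.mul_inv hi
  have e := H.braid_mixed hi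
  generalize heckeInv s T i = a' at *
  generalize heckeInv s T (i + 1) = b' at *
  generalize T i = a at *
  generalize T (i + 1) = b at *
  calc a' * (b' * a') = a' * (b' * a' * b) * b' := by
        rw [mul_assoc, mul_assoc (b' * a'), b1, mul_one]
    _ = a' * a * (b' * a' * b') := by rw [← e]; simp only [mul_assoc]
    _ = b' * a' * b' := by rw [a2, one_mul]

theorem braid_inv' {i : ℕ} (hi : i + 1 < n) :
    heckeInv s T i * heckeInv s T (i + 1) * heckeInv s T i =
      heckeInv s T (i + 1) * (heckeInv s T i * heckeInv s T (i + 1)) := by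
  rw [mul_assoc, H.braid_inv hi, mul_assoc]

/-- Conjugation by the product `T_{n-1}⁻¹ ⋯ T_0⁻¹` shifts the indices. -/
theorem T_mul_down {i : ℕ} (hi : i + 1 < n) : T i * downProd (heckeInv s T) n =
    downProd (heckeInv s T) n * T (i + 1) :=
  mul_downProd_shift H.far_inv (fun _ h => H.braid_mixed h) n le_rfl hi

theorem up_mul_T {i : ℕ} (hi : i + 1 < n) : upProd (heckeInv s T) n * T i =
    T (i + 1) * upProd (heckeInv s T) n :=
  upProd_mul_shift H.far_inv (fun _ h => H.braid_mixed' h) n le_rfl hi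

theorem down_mul_down {j : ℕ} (hj : j < n) :
    downProd (heckeInv s T) j * downProd (heckeInv s T) n =
      downProd (heckeInv s T) n * downProd (fun i => heckeInv s T (i + 1)) j :=
  mul_downProd_shift_prod H.far_inv_inv (fun _ h => H.braid_inv h) j hj

theorem up_mul_down {j : ℕ} (hj : j < n) :
    upProd (heckeInv s T) n * downProd (heckeInv s T) j =
      downProd (fun i => heckeInv s T (i + 1)) j * upProd (heckeInv s T) n :=
  upProd_mul_shift_prod H.far_inv_inv (fun _ h => H.braid_inv' h) j hj

end IsHecke

/-- The elements `E_n = E` and `E_i = s⁻¹ T_i E_{i+1} T_i`, in descending order: `descAux k` is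
`E_{n-k}`. -/
def descAux (s : K) (n : ℕ) (T : ℕ → R) (E : R) : ℕ → R
  | 0 => E
  | k + 1 => s⁻¹ • (T (n - (k + 1)) * descAux s n T E k * T (n - (k + 1)))

/-- The elements `E_n = E` and `E_i = s⁻¹ T_i E_{i+1} T_i`; for suitable `E` these are the
Cherednik operators and the Dunkl operators. -/
def desc (s : K) (n : ℕ) (T : ℕ → R) (E : R) (j : ℕ) : R := descAux s n T E (n - j)

theorem desc_last (s : K) (n : ℕ) (T : ℕ → R) (E : R) : desc s n T E n = E := by
  simp [desc, descAux]

theorem desc_of_lt (s : K) {n : ℕ} (T : ℕ → R) (E : R) {j : ℕ} (hj : j < n) :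
    desc s n T E j = s⁻¹ • (T j * desc s n T E (j + 1) * T j) := by
  obtain ⟨k, rfl⟩ : ∃ k, n = j + (k + 1) := ⟨n - j - 1, by omega⟩
  have h1 : j + (k + 1) - j = k + 1 := by omega
  have h2 : j + (k + 1) - (j + 1) = k := by omega
  have h3 : j + (k + 1) - (k + 1) = j := by omega
  simp [desc, h1, h2, descAux, h3]

namespace IsHecke

variable {s : K} {T : ℕ → R} (H : IsHecke s n T)
include H

theorem T_mul_desc {E : R} (hE : ∀ i, i + 1 < n → T i * E = E * T i) :
    ∀ k j, j + k = n → ∀ i < n, i ≠ j → i + 1 ≠ j →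
      T i * desc s n T E j = desc s n T E j * T i
  | 0, j, hj, i, hi, _, h2 => by
    obtain rfl : j = n := by omega
    rw [desc_last, hE i (by omega)]
  | k + 1, j, hj, i, hi, h1, h2 => by
    by_cases hij : i = j + 1
    · subst hij
      have hjj := T_mul_desc hE (k - 1) (j + 2) (by omega) j (by omega) (by omega) (by omega)
      rw [desc_of_lt s T E (j := j) (by omega), desc_of_lt s T E (j := j + 1) (by omega)]
      have hb := H.braid j (by omega)
      generalize desc s n T E (j + 2) = e at *
      simp only [mul_smul_comm, smul_mul_assoc]
      congr 2
      calc T (j + 1) * (T j * (T (j + 1) * e * T (j + 1)) * T j)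
          = (T (j + 1) * T j * T (j + 1)) * e * T (j + 1) * T j := by simp only [mul_assoc]
        _ = T j * T (j + 1) * (T j * e) * T (j + 1) * T j := by rw [← hb]; simp only [mul_assoc]
        _ = T j * T (j + 1) * e * (T j * T (j + 1) * T j) := by rw [hjj]; simp only [mul_assoc]
        _ = T j * (T (j + 1) * e * T (j + 1)) * T j * T (j + 1) := by
          rw [hb]; simp only [mul_assoc]
    · have ih := T_mul_desc hE k (j + 1) (by omega) i hi hij (by omega)
      have hc := H.far i j hi (by omega) (by omega)
      rw [desc_of_lt s T E (j := j) (by omega), mul_smul_comm, smul_mul_assoc, ← mul_assoc,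
        ← mul_assoc, hc, mul_assoc (T j), ih, ← mul_assoc, mul_assoc (T j * _), hc, ← mul_assoc]

theorem T_desc_comm {E : R} (hE : ∀ i, i + 1 < n → T i * E = E * T i) {i j : ℕ} (hj : j ≤ n)
    (hi : i < n) (h1 : i ≠ j) (h2 : i + 1 ≠ j) : T i * desc s n T E j = desc s n T E j * T i :=
  H.T_mul_desc hE (n - j) j (by omega) i hi h1 h2

theorem desc_succ_mul_T (E : R) {i : ℕ} (hi : i < n) :
    desc s n T E (i + 1) * T i = T i * desc s n T E i + (1 - s) • desc s n T E i := by
  have h : desc s n T E (i + 1) * T i = s • (heckeInv s T i * desc s n T E i) := by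
    rw [desc_of_lt s T E hi, mul_smul_comm, smul_smul, mul_inv_cancel₀ H.ne_zero, one_smul,
      mul_assoc, ← mul_assoc, H.inv_mul hi, one_mul]
  rw [h, heckeInv, smul_mul_assoc, smul_smul, mul_inv_cancel₀ H.ne_zero, one_smul, add_mul,
    smul_mul_assoc, one_mul]

theorem T_mul_desc_succ (E : R) {i : ℕ} (hi : i < n) :
    T i * desc s n T E (i + 1) = desc s n T E i * T i + (1 - s) • desc s n T E i := by
  have h : T i * desc s n T E (i + 1) = s • (desc s n T E i * heckeInv s T i) := by
    rw [desc_of_lt s T E hi, smul_mul_assoc, smul_smul, mul_inv_cancel₀ H.ne_zero, one_smul,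
      mul_assoc, H.mul_inv hi, mul_one]
  rw [h, heckeInv, mul_smul_comm, smul_smul, mul_inv_cancel₀ H.ne_zero, one_smul, mul_add,
    mul_smul_comm, mul_one]

/-- If the two last of the elements `E_i` commute then all of them do. -/
theorem desc_comm {E : R} (hE : ∀ i, i + 1 < n → T i * E = E * T i)
    (h0 : ∀ m, m + 1 = n → desc s n T E m * E = E * desc s n T E m) {i j : ℕ}
    (hij : i < j) (hj : j ≤ n) : Commute (desc s n T E i) (desc s n T E j) := by
  have conj : ∀ i x, i < n → Commute (T i) x → Commute (desc s n T E (i + 1)) x →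
      Commute (desc s n T E i) x := by
    intro i x hi h1 h2
    rw [desc_of_lt s T E hi]
    exact ((h1.mul_left h2).mul_left h1).smul_left _
  have step : ∀ k i, i + 1 + k = n → Commute (desc s n T E i) (desc s n T E (i + 1)) := by
    intro k
    induction k with
    | zero =>
      intro i hi
      have e : desc s n T E (i + 1) = E := by rw [show i + 1 = n by omega, desc_last]
      rw [e]
      exact h0 i (by omega)
    | succ k ih =>
      intro i hi
      refine (conj (i + 1) _ (by omega) ?_ ?_).symm
      · exact H.T_desc_comm hE (by omega) (by omega) (by omega) (by omega)
      · exact (conj i _ (by omega) (H.T_desc_comm hE (by omega) (by omega) (by omega) (by omega))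
          (ih (i + 1) (by omega))).symm
  obtain ⟨k, rfl⟩ : ∃ k, j = i + 1 + k := ⟨j - i - 1, by omega⟩
  clear hij
  induction k generalizing i with
  | zero => exact step (n - i - 1) i (by omega)
  | succ k ih =>
    refine conj i _ (by omega) (H.T_desc_comm hE (by omega) (by omega) (by omega) (by omega)) ?_
    have := ih (i := i + 1) (by omega)
    rwa [show i + 1 + 1 + k = i + 1 + (k + 1) by omega] at this

end IsHecke

/-- The raising element `Φ = X_n T_{n-1}⁻¹ ⋯ T_0⁻¹`. -/
def phi (s : K) (n : ℕ) (T X : ℕ → R) : R := X n * downProd (heckeInv s T) n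

/-- The last Cherednik element `Ξ = W T_0⁻¹ ⋯ T_{n-1}⁻¹`. -/
def xiLast (s : K) (n : ℕ) (T : ℕ → R) (W : R) : R := W * upProd (heckeInv s T) n

namespace IsDoubleAffine

variable {q s : K} {T X : ℕ → R} {W : R} (H : IsDoubleAffine q s n T X W)
include H

theorem inv_mul_X {i : ℕ} (hi : i < n) :
    heckeInv s T i * X (i + 1) = s⁻¹ • (X i * T i) := by
  have h := H.T_X i hi
  have a1 := H.mul_inv hi
  have a2 := H.inv_mul hi
  calc heckeInv s T i * X (i + 1) = s⁻¹ • (heckeInv s T i * (s • (X (i + 1) * heckeInv s T i))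
        * T i) := by
        rw [mul_smul_comm, smul_mul_assoc, smul_smul, inv_mul_cancel₀ H.ne_zero, one_smul,
          mul_assoc, mul_assoc, a2, mul_one]
    _ = s⁻¹ • (X i * T i) := by rw [← h, ← mul_assoc, a2, one_mul]

theorem T_mul_X_mul_X {i : ℕ} (hi : i < n) :
    T i * (X (i + 1) * X i) = X (i + 1) * X i * T i := by
  rw [H.X_comm (i + 1) i (by omega) (by omega), ← mul_assoc, H.T_X i hi, smul_mul_assoc, mul_assoc,
    H.inv_mul_X hi, mul_smul_comm, smul_smul, mul_inv_cancel₀ H.ne_zero, one_smul, ← mul_assoc,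
    H.X_comm (i + 1) i (by omega) (by omega)]

theorem T_mul_phi {i : ℕ} (hi : i + 1 < n) : T i * phi s n T X = phi s n T X * T (i + 1) := by
  rw [phi, ← mul_assoc, H.T_X_of_ne i n (by omega) le_rfl (by omega) (by omega), mul_assoc,
    H.T_mul_down hi, mul_assoc]

theorem X_comm_downProd : ∀ k < n,
    downProd (heckeInv s T) k * X n = X n * downProd (heckeInv s T) k
  | 0, _ => by simp [downProd]
  | k + 1, hk => by
    rw [downProd, mul_assoc, X_comm_downProd k (by omega), ← mul_assoc, ← mul_assoc,
      IsHecke.commute_inv (H.T_X_of_ne k n (by omega) le_rfl (by omega) (by omega))]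

theorem X_comm_upProd : ∀ k < n,
    upProd (heckeInv s T) k * X n = X n * upProd (heckeInv s T) k
  | 0, _ => by simp [upProd]
  | k + 1, hk => by
    rw [upProd, mul_assoc,
      IsHecke.commute_inv (H.T_X_of_ne k n (by omega) le_rfl (by omega) (by omega)), ← mul_assoc,
      X_comm_upProd k (by omega), mul_assoc]

end IsDoubleAffine

section Last

variable {q s : K} {m : ℕ} {T X : ℕ → R} {W : R}

theorem IsHecke.last_T_mul_down (H : IsHecke s (m + 1) T) :
    T m * downProd (heckeInv s T) (m + 1) = downProd (heckeInv s T) m := by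
  rw [downProd, ← mul_assoc, H.mul_inv (by omega), one_mul]

theorem IsHecke.down_mul_first_T (H : IsHecke s (m + 1) T) :
    downProd (heckeInv s T) (m + 1) * T 0 = downProd (fun i => heckeInv s T (i + 1)) m := by
  rw [downProd_succ', mul_assoc, H.inv_mul (by omega), mul_one]

theorem IsHecke.up_mul_last_T (H : IsHecke s (m + 1) T) :
    upProd (heckeInv s T) (m + 1) * T m = upProd (heckeInv s T) m := by
  rw [upProd, mul_assoc, H.inv_mul (by omega), mul_one]

theorem IsHecke.last_T_mul_down_mul (H : IsHecke s (m + 1) T) :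
    T m * (downProd (heckeInv s T) (m + 1) * downProd (fun i => heckeInv s T (i + 1)) m) =
      downProd (heckeInv s T) (m + 1) * downProd (fun i => heckeInv s T (i + 1)) m * T 0 := by
  rw [← mul_assoc, H.last_T_mul_down, ← H.down_mul_down (by omega), mul_assoc, H.down_mul_first_T]

namespace IsDoubleAffine

variable (H : IsDoubleAffine q s (m + 1) T X W)
include H

theorem phi_mul_phi : phi s (m + 1) T X * phi s (m + 1) T X =
    s⁻¹ • (X (m + 1) * X m * T m *
      (downProd (heckeInv s T) (m + 1) * downProd (fun i => heckeInv s T (i + 1)) m)) := by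
  rw [← H.down_mul_down (by omega), phi]
  have h1 := H.X_comm_downProd m (by omega)
  have h2 := H.inv_mul_X (i := m) (by omega)
  have hd : downProd (heckeInv s T) (m + 1) = heckeInv s T m * downProd (heckeInv s T) m := rfl
  rw [hd]
  generalize downProd (heckeInv s T) m = d at *
  calc X (m + 1) * (heckeInv s T m * d) * (X (m + 1) * (heckeInv s T m * d))
      = X (m + 1) * heckeInv s T m * (d * X (m + 1)) * (heckeInv s T m * d) := by
        simp only [mul_assoc]
    _ = X (m + 1) * (heckeInv s T m * X (m + 1)) * d * (heckeInv s T m * d) := by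
        rw [h1]; simp only [mul_assoc]
    _ = _ := by
        rw [h2]
        simp only [mul_smul_comm, smul_mul_assoc, mul_assoc]

theorem T_mul_phi_mul_phi : T m * (phi s (m + 1) T X * phi s (m + 1) T X) =
    phi s (m + 1) T X * phi s (m + 1) T X * T 0 := by
  have h1 := H.T_mul_X_mul_X (i := m) (by omega)
  have h2 := H.last_T_mul_down_mul
  rw [H.phi_mul_phi, mul_smul_comm, smul_mul_assoc]
  generalize downProd (heckeInv s T) (m + 1) * downProd (fun i => heckeInv s T (i + 1)) m = d at *
  congr 1
  calc T m * (X (m + 1) * X m * T m * d) = T m * (X (m + 1) * X m) * (T m * d) := by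
        simp only [mul_assoc]
    _ = X (m + 1) * X m * T m * d * T 0 := by rw [h1, h2]; simp only [mul_assoc]

theorem T_xi_T_mul_phi : T m * xiLast s (m + 1) T W * T m * phi s (m + 1) T X =
    s • (phi s (m + 1) T X * xiLast s (m + 1) T W) := by
  have h1 := H.up_mul_last_T
  have h2 := H.X_comm_upProd m (by omega)
  have h3 := H.T_X m (by omega)
  have h4 := H.W_X m (by omega)
  have h5 := H.up_mul_down (j := m) (by omega)
  have hd : downProd (heckeInv s T) (m + 1) = heckeInv s T m * downProd (heckeInv s T) m := rfl
  have hu : upProd (heckeInv s T) (m + 1) = upProd (heckeInv s T) m * heckeInv s T m := rfl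
  -- moving `W` through the shifted product
  have h6 : ∀ k ≤ m, downProd (heckeInv s T) k * W =
      W * downProd (fun i => heckeInv s T (i + 1)) k := by
    intro k
    induction k with
    | zero => intro _; simp [downProd]
    | succ k ih =>
      intro hk
      have hw : heckeInv s T k * W = W * heckeInv s T (k + 1) := by
        simp only [heckeInv, smul_mul_assoc, mul_smul_comm, add_mul, mul_add, one_mul, mul_one,
          H.W_T k (by omega)]
      rw [downProd, mul_assoc, ih (by omega), ← mul_assoc, hw, mul_assoc, downProd]
  have h7 := h6 m le_rfl
  rw [xiLast, phi]
  calc T m * (W * upProd (heckeInv s T) (m + 1)) * T m *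
        (X (m + 1) * downProd (heckeInv s T) (m + 1))
      = T m * W * (upProd (heckeInv s T) (m + 1) * T m) * X (m + 1) *
          downProd (heckeInv s T) (m + 1) := by simp only [mul_assoc]
    _ = T m * W * (upProd (heckeInv s T) m * X (m + 1)) * downProd (heckeInv s T) (m + 1) := by
        rw [h1]; simp only [mul_assoc]
    _ = T m * (W * X (m + 1)) * (upProd (heckeInv s T) m * downProd (heckeInv s T) (m + 1)) := by
        rw [h2]; simp only [mul_assoc]
    _ = T m * X m * (W * (upProd (heckeInv s T) m * heckeInv s T m *
          downProd (heckeInv s T) m)) := by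
        rw [h4, hd]; simp only [mul_assoc]
    _ = s • (X (m + 1) * (heckeInv s T m * (W * downProd (fun i => heckeInv s T (i + 1)) m) *
          upProd (heckeInv s T) (m + 1))) := by
        rw [h3, ← hu, h5]; simp only [smul_mul_assoc, mul_assoc]
    _ = s • (X (m + 1) * downProd (heckeInv s T) (m + 1) *
          (W * upProd (heckeInv s T) (m + 1))) := by
        rw [← h7, hd]; simp only [mul_assoc]

end IsDoubleAffine
end Last

namespace IsDoubleAffine

variable {q s : K} {T X : ℕ → R} {W : R} (H : IsDoubleAffine q s n T X W)
include H

theorem T_mul_xi {i : ℕ} (hi : i + 1 < n) : T i * xiLast s n T W = xiLast s n T W * T i := by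
  rw [xiLast, mul_assoc, H.up_mul_T hi, ← mul_assoc, ← H.W_T i hi, mul_assoc]

theorem xi_mul_phi : ∀ k j, j + 1 + k = n → desc s n T (xiLast s n T W) j * phi s n T X =
    phi s n T X * desc s n T (xiLast s n T W) (j + 1)
  | 0, j, hj => by
    obtain rfl : n = j + 1 := by omega
    rw [desc_last, desc_of_lt s T _ (by omega), desc_last, smul_mul_assoc, H.T_xi_T_mul_phi,
      smul_smul, inv_mul_cancel₀ H.ne_zero, one_smul]
  | k + 1, j, hj => by
    have ih := xi_mul_phi k (j + 1) (by omega)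
    have h := H.T_mul_phi (i := j) (by omega)
    conv_rhs => rw [desc_of_lt s T _ (j := j + 1) (by omega), mul_smul_comm]
    rw [desc_of_lt s T _ (j := j) (by omega), smul_mul_assoc, mul_assoc, h]
    congr 1
    calc T j * desc s n T (xiLast s n T W) (j + 1) * (phi s n T X * T (j + 1))
        = T j * (desc s n T (xiLast s n T W) (j + 1) * phi s n T X) * T (j + 1) := by
          simp only [mul_assoc]
      _ = T j * phi s n T X * desc s n T (xiLast s n T W) (j + 1 + 1) * T (j + 1) := by
          rw [ih]; simp only [mul_assoc]
      _ = _ := by rw [h]; simp only [mul_assoc]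

theorem xiLast_mul_phi : xiLast s n T W * phi s n T X =
    q • (phi s n T X * desc s n T (xiLast s n T W) 0) := by
  have h1 : ∀ k ≤ n, downProd (heckeInv s T) k * desc s n T (xiLast s n T W) 0 =
      s⁻¹ ^ k • (desc s n T (xiLast s n T W) k * downProd T k) := by
    intro k
    induction k with
    | zero => intro _; simp [downProd]
    | succ k ih =>
      intro hk
      rw [downProd, mul_assoc, ih (by omega), desc_of_lt s T _ (j := k) (by omega), downProd,
        smul_mul_assoc, mul_smul_comm, mul_smul_comm, smul_smul, pow_succ, ← mul_assoc,
        ← mul_assoc, ← mul_assoc, H.inv_mul (by omega), one_mul, mul_assoc]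
  have h2 : ∀ k ≤ n, upProd (heckeInv s T) k * X k = s⁻¹ ^ k • (X 0 * upProd T k) := by
    intro k
    induction k with
    | zero => intro _; simp [upProd]
    | succ k ih =>
      intro hk
      rw [upProd, mul_assoc, H.inv_mul_X (by omega), mul_smul_comm, ← mul_assoc, ih (by omega),
        smul_mul_assoc, smul_smul, upProd, mul_assoc, pow_succ']
  have h3 := upProd_mul_downProd (fun i hi => H.mul_inv (i := i) hi) n le_rfl
  have h4 := upProd_mul_downProd (fun i hi => H.inv_mul (i := i) hi) n le_rfl
  have l : xiLast s n T W * phi s n T X = s⁻¹ ^ n • q • (X n * W) := by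
    calc xiLast s n T W * phi s n T X = W * (upProd (heckeInv s T) n * X n) *
          downProd (heckeInv s T) n := by rw [xiLast, phi]; simp only [mul_assoc]
      _ = s⁻¹ ^ n • (W * X 0 * (upProd T n * downProd (heckeInv s T) n)) := by
          rw [h2 n le_rfl]; simp only [smul_mul_assoc, mul_smul_comm, mul_assoc]
      _ = _ := by rw [h3, mul_one, H.W_X_zero]
  have r : phi s n T X * desc s n T (xiLast s n T W) 0 = s⁻¹ ^ n • (X n * W) := by
    rw [phi, mul_assoc, h1 n le_rfl, desc_last, xiLast, mul_assoc, h4, mul_one, mul_smul_comm]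
  rw [l, r, smul_comm]

end IsDoubleAffine
end Ring

/-! ### The double affine Hecke algebra acting on vector valued polynomials -/

/-- The family `f`, with natural numbers as indices. -/
def natFam {m : ℕ} {R : Type*} [Ring R] (f : Fin m → R) (i : ℕ) : R :=
  if h : i < m then f ⟨i, h⟩ else 0

theorem natFam_val {m : ℕ} {R : Type*} [Ring R] (f : Fin m → R) (i : Fin m) :
    natFam f i = f i := by
  simp [natFam]

theorem natFam_of_lt {m : ℕ} {R : Type*} [Ring R] (f : Fin m → R) {i : ℕ} (h : i < m) :
    natFam f i = f ⟨i, h⟩ := by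
  simp [natFam, h]

theorem map_finRange_eq {R : Type*} (f : Fin n → R) (g : ℕ → R) (h : ∀ i : Fin n, f i = g i) :
    (List.finRange n).map f = (List.range n).map g := by
  rw [← List.map_coe_finRange_eq_range, List.map_map]
  exact List.map_congr_left fun i _ => h i

theorem prod_map_range_eq_upProd {R : Type*} [Ring R] (g : ℕ → R) (k : ℕ) :
    ((List.range k).map g).prod = upProd g k := by
  induction k with
  | zero => simp [upProd]
  | succ k ih => rw [List.range_succ, List.map_append, List.prod_append, ih]; simp [upProd]

theorem prod_reverse_map_range_eq_downProd {R : Type*} [Ring R] (g : ℕ → R) (k : ℕ) :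
    ((List.range k).map g).reverse.prod = downProd g k := by
  induction k with
  | zero => simp [downProd]
  | succ k ih =>
    rw [List.range_succ, List.map_append, List.reverse_append, List.prod_append, ih]
    simp [downProd]

theorem isHecke_tabT {s : K} (hs : NonRoot s) :
    IsHecke s n (natFam fun i => (tabT s i : Module.End K (RST n lam →₀ K))) where
  ne_zero := hs.ne_zero
  quad i hi := by
    rw [natFam_of_lt _ hi]
    apply LinearMap.ext; intro u
    exact tabT_quadratic hs _ u
  comm i j hij hj := by
    rw [natFam_of_lt _ hj, natFam_of_lt _ (show i < n by omega)]
    apply LinearMap.ext; intro u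
    exact tabT_comm hs hij u
  braid i hi := by
    rw [natFam_of_lt _ hi, natFam_of_lt _ (show i < n by omega)]
    apply LinearMap.ext; intro u
    exact tabT_braid hs (i := ⟨i, by omega⟩) (j := ⟨i + 1, hi⟩) rfl u

theorem tabS_eq (s : K) : (tabS s : Module.End K (RST n lam →₀ K)) =
    downProd (natFam fun i => tabT s i) n := by
  rw [tabS, rightProd, map_finRange_eq _ (natFam fun i => tabT s i) fun i => (natFam_val _ i).symm]
  exact prod_reverse_map_range_eq_downProd
    (natFam fun i => (tabT s i : Module.End K (RST n lam →₀ K))) n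

theorem tabS_tabT {s : K} (hs : NonRoot s) {i j : Fin n} (hij : (j : ℕ) = i + 1)
    (u : RST n lam →₀ K) : tabS s (tabT s j u) = tabT s i (tabS s u) := by
  have H := isHecke_tabT (n := n) (lam := lam) hs
  have h := mul_downProd_shift (i := i) H.far (fun i hi => by rw [← mul_assoc, H.braid i hi]) n
    le_rfl (by omega)
  rw [← tabS_eq, ← hij, natFam_val, natFam_val] at h
  exact (congrArg (fun f => f u) h).symm

theorem bw_bT {s : K} (hs : NonRoot s) (q : K) {i j : Fin n} (hij : (j : ℕ) = i + 1)
    (v : VVPoly K n lam) : bw q s (bT s j v) = bT s i (bw q s v) := by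
  induction v using vv_induction with
  | hone u => simp only [bT_one_tmul, bw_tmul, map_one, tabS_tabT hs hij]
  | hadd v w hv hw => simp only [map_add, hv, hw]
  | hX k v hv =>
    have hj : j.castSucc = i.succ := by ext; simp [hij]
    by_cases h1 : k = j.castSucc
    · subst h1
      rw [bT_mulX_castSucc, map_add, map_smul, bw_mulX_succ, bw_mulX_succ, hv, hj, bw_mulX_succ,
        bT_mulX_castSucc]
    by_cases h2 : k = j.succ
    · subst h2
      rw [bT_mulX_succ, map_sub, map_smul, bw_mulX_succ, hj, bw_mulX_succ, hv, bT_mulX_succ]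
    rw [bT_mulX_of_ne s j h1 h2]
    rcases Fin.eq_zero_or_eq_succ k with rfl | ⟨k, rfl⟩
    · rw [bw_mulX_zero, bw_mulX_zero, hv, map_smul, bT_mulX_of_ne]
      · simp [Fin.ext_iff]; omega
      · simp [Fin.ext_iff]; omega
    · rw [bw_mulX_succ, bw_mulX_succ, hv, bT_mulX_of_ne]
      · intro h; apply h1; rw [hj]; simpa using h
      · intro h; apply h2; rw [← hj] at h; simpa using h

theorem heckeInv_bT (s : K) (i : Fin n) :
    heckeInv s (natFam fun i => (bT s i : Module.End K (VVPoly K n lam))) i = bTinv s i := by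
  rw [heckeInv, natFam_val, bTinv]

theorem isDoubleAffine {s : K} (hs : NonRoot s) (q : K) :
    IsDoubleAffine q s n (natFam fun i => (bT s i : Module.End K (VVPoly K n lam)))
      (natFam fun j => mulX j) (bw q s) where
  ne_zero := hs.ne_zero
  quad i hi := by
    rw [natFam_of_lt _ hi]
    apply LinearMap.ext; intro u
    exact bT_quadratic hs _ u
  comm i j hij hj := by
    rw [natFam_of_lt _ hj, natFam_of_lt _ (show i < n by omega)]
    apply LinearMap.ext; intro u
    exact bT_comm hs hij u
  braid i hi := by
    rw [natFam_of_lt _ hi, natFam_of_lt _ (show i < n by omega)]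
    apply LinearMap.ext; intro u
    exact bT_braid hs (i := ⟨i, by omega⟩) (j := ⟨i + 1, hi⟩) rfl u
  T_X i hi := by
    have h := heckeInv_bT (lam := lam) s ⟨i, hi⟩
    rw [h, natFam_of_lt _ hi, natFam_of_lt _ (show i < n + 1 by omega),
      natFam_of_lt _ (show i + 1 < n + 1 by omega)]
    apply LinearMap.ext; intro u
    have := bT_mulX_castSucc s ⟨i, hi⟩ u
    simp only [Module.End.mul_apply, LinearMap.smul_apply, bTinv_apply, map_smul, map_add,
      smul_smul,
      mul_inv_cancel₀ hs.ne_zero, one_smul]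
    exact this
  T_X_of_ne i j hi hj h1 h2 := by
    rw [natFam_of_lt _ hi, natFam_of_lt _ (show j < n + 1 by omega)]
    apply LinearMap.ext; intro u
    exact bT_mulX_of_ne s ⟨i, hi⟩ (by simpa [Fin.ext_iff] using h1)
      (by simpa [Fin.ext_iff] using h2) u
  X_comm i j hi hj := by
    rw [natFam_of_lt _ (show i < n + 1 by omega), natFam_of_lt _ (show j < n + 1 by omega)]
    apply LinearMap.ext; intro u
    exact mulX_comm _ _ u
  W_T i hi := by
    rw [natFam_of_lt _ hi, natFam_of_lt _ (show i < n by omega)]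
    apply LinearMap.ext; intro u
    exact bw_bT hs q (i := ⟨i, by omega⟩) (j := ⟨i + 1, hi⟩) rfl u
  W_X i hi := by
    rw [natFam_of_lt _ (show i < n + 1 by omega), natFam_of_lt _ (show i + 1 < n + 1 by omega)]
    apply LinearMap.ext; intro u
    exact bw_mulX_succ q s ⟨i, hi⟩ u
  W_X_zero := by
    rw [natFam_of_lt _ (show 0 < n + 1 by omega), natFam_of_lt _ (show n < n + 1 by omega)]
    apply LinearMap.ext; intro u
    exact bw_mulX_zero q s u

theorem raising_eq (s : K) : (raising s : Module.End K (VVPoly K n lam)) =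
    phi s n (natFam fun i => bT s i) (natFam fun j => mulX j) := by
  have e := map_finRange_eq (fun i => (bTinv s i : Module.End K (VVPoly K n lam)))
    (heckeInv s (natFam fun i => bT s i)) fun i => (heckeInv_bT s i).symm
  rw [raising, rightProd, e, List.reverse_append, List.prod_append]
  refine congrArg₂ (· * ·) ?_ (prod_reverse_map_range_eq_downProd
    (heckeInv s (natFam fun i => (bT s i : Module.End K (VVPoly K n lam)))) n)
  rw [natFam_of_lt _ (Nat.lt_succ_self n)]
  simp [Fin.last]

theorem cherednikLast_eq (q s : K) : (cherednikLast q s : Module.End K (VVPoly K n lam)) =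
    xiLast s n (natFam fun i => bT s i) (bw q s) := by
  have e := map_finRange_eq (fun i => (bTinv s i : Module.End K (VVPoly K n lam)))
    (heckeInv s (natFam fun i => bT s i)) fun i => (heckeInv_bT s i).symm
  rw [cherednikLast, rightProd, List.map_reverse, e, List.reverse_append, List.prod_append,
    List.reverse_reverse]
  refine congrArg₂ (· * ·) ?_ (prod_map_range_eq_upProd
    (heckeInv s (natFam fun i => (bT s i : Module.End K (VVPoly K n lam)))) n)
  simp

/-- Division by the last variable. -/
def divLast : Module.End K (VVPoly K n lam) :=
  TensorProduct.map (divX (Fin.last n)) LinearMap.id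

theorem dunkl_eq (q s : K) (j : Fin (n + 1)) : (dunkl q s j : Module.End K (VVPoly K n lam)) =
    desc s n (natFam fun i => bT s i) (divLast * (1 - cherednikLast q s)) j := by
  induction j using Fin.reverseInduction with
  | last =>
    rw [dunkl, Fin.reverseInduction_last, Fin.val_last, desc_last]
    simp [rightProd, divLast]
  | cast i ih =>
    have : (dunkl q s i.castSucc : Module.End K (VVPoly K n lam)) =
        s⁻¹ • rightProd [bT s i, dunkl q s i.succ, bT s i] := by
      rw [dunkl, Fin.reverseInduction_castSucc]; rfl
    rw [this, ih, Fin.val_castSucc, desc_of_lt s _ _ i.isLt, natFam_val, Fin.val_succ]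
    simp [rightProd, mul_assoc]

theorem divLast_mulX (v : VVPoly K n lam) : divLast (mulX (Fin.last n) v) = v := by
  induction v using TensorProduct.induction_on with
  | zero => simp
  | add v w hv hw => simp only [map_add, hv, hw]
  | tmul f u =>
    rw [mulX_tmul, divLast, TensorProduct.map_tmul]
    congr 1
    exact MvPolynomial.X_mul_divMonomial _ _

/-! ### Products over pairs of positions -/

theorem lt_swap_iff {i : Fin n} {k l : Fin (n + 1)}
    (h : ¬ (k = i.castSucc ∧ l = i.succ)) (h' : ¬ (k = i.succ ∧ l = i.castSucc)) :
    Equiv.swap i.castSucc i.succ k < Equiv.swap i.castSucc i.succ l ↔ k < l := by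
  rw [Equiv.swap_apply_def, Equiv.swap_apply_def]
  simp only [Fin.ext_iff, Fin.lt_def, Fin.val_castSucc, Fin.val_succ] at *
  split_ifs <;> simp only [Fin.val_castSucc, Fin.val_succ] <;> omega

open Classical in
/-- The effect of exchanging two adjacent positions on a product over pairs of positions. -/
@[to_additive]
theorem prod_pairs_swap {α M : Type*} [CommMonoid M] (F : α → α → M) (f : Fin (n + 1) → α)
    (i : Fin n) :
    (∏ p : Fin (n + 1) × Fin (n + 1) with p.1 < p.2,
      F (f (Equiv.swap i.castSucc i.succ p.1)) (f (Equiv.swap i.castSucc i.succ p.2))) *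
        F (f i.castSucc) (f i.succ) =
    (∏ p : Fin (n + 1) × Fin (n + 1) with p.1 < p.2, F (f p.1) (f p.2)) *
        F (f i.succ) (f i.castSucc) := by
  have hmem : (i.castSucc, i.succ) ∈
      ({p | p.1 < p.2} : Finset (Fin (n + 1) × Fin (n + 1))) := by
    simp
  rw [← Finset.mul_prod_erase _ _ hmem, ← Finset.mul_prod_erase _ _ hmem]
  simp only [Equiv.swap_apply_left, Equiv.swap_apply_right]
  have : ∏ p ∈ ({p | p.1 < p.2} : Finset (Fin (n + 1) × Fin (n + 1))).erase (i.castSucc, i.succ),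
      F (f (Equiv.swap i.castSucc i.succ p.1)) (f (Equiv.swap i.castSucc i.succ p.2)) =
      ∏ p ∈ ({p | p.1 < p.2} : Finset (Fin (n + 1) × Fin (n + 1))).erase (i.castSucc, i.succ),
      F (f p.1) (f p.2) := by
    refine Finset.prod_equiv ((Equiv.swap i.castSucc i.succ).prodCongr
      (Equiv.swap i.castSucc i.succ)) ?_ ?_
    · rintro ⟨k, l⟩
      simp only [Finset.mem_erase, Finset.mem_filter, Finset.mem_univ, true_and, ne_eq,
        Equiv.prodCongr_apply, Prod.map, Prod.mk.injEq]
      by_cases h : k = i.castSucc ∧ l = i.succ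
      · obtain ⟨rfl, rfl⟩ := h
        simp [(Fin.castSucc_lt_succ (i := i)).le]
      · by_cases h' : k = i.succ ∧ l = i.castSucc
        · obtain ⟨rfl, rfl⟩ := h'
          simp [(Fin.castSucc_lt_succ (i := i)).le]
        · rw [lt_swap_iff h h', Equiv.swap_apply_eq_iff, Equiv.swap_apply_eq_iff,
            Equiv.swap_apply_left, Equiv.swap_apply_right]
          tauto
    · rintro ⟨k, l⟩ _; rfl
  rw [this, mul_right_comm, mul_right_comm (F (f i.castSucc) (f i.succ)),
    mul_comm (F (f i.succ) (f i.castSucc)) (F (f i.castSucc) (f i.succ))]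

/-! ### The rank function -/

/-- The strict total order on positions that is computed by `rank`. -/
def Before {m : ℕ} (v : Fin m → ℕ) (i j : Fin m) : Prop := v j < v i ∨ (v i = v j ∧ i < j)

theorem rank_lt {v : Fin (n + 1) → ℕ} {i j : Fin (n + 1)} (h : Before v i j) :
    rank v i < rank v j := by
  rw [Fin.lt_def]
  unfold Before at h
  unfold rank
  dsimp only
  apply Finset.card_lt_card
  rw [Finset.ssubset_iff_of_subset]
  · refine ⟨i, ?_, ?_⟩
    · simp only [Finset.mem_filter, Finset.mem_univ, true_and]
      rcases lt_trichotomy i j with h' | rfl | h' <;> omega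
    · simp
  · intro k
    simp only [Finset.mem_filter, Finset.mem_univ, true_and]
    rcases eq_or_ne k j with rfl | hk
    · simp only [Fin.lt_def] at *
      omega
    · simp only [Fin.lt_def, ne_eq, Fin.ext_iff] at *
      omega

theorem before_or {v : Fin (n + 1) → ℕ} {i j : Fin (n + 1)} (h : i ≠ j) :
    Before v i j ∨ Before v j i := by
  unfold Before; simp only [Fin.lt_def, ne_eq, Fin.ext_iff] at *; omega

theorem rank_lt_iff {v : Fin (n + 1) → ℕ} {i j : Fin (n + 1)} :
    rank v i < rank v j ↔ Before v i j := by
  refine ⟨fun h => ?_, rank_lt⟩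
  have hne : i ≠ j := by rintro rfl; exact lt_irrefl _ h
  exact (before_or hne).resolve_right fun h' => (rank_lt h').not_gt h

theorem rank_injective (v : Fin (n + 1) → ℕ) : Function.Injective (rank v) := by
  intro i j h
  by_contra hne
  rcases before_or (v := v) hne with h' | h'
  · exact (rank_lt h').ne h
  · exact (rank_lt h').ne' h

theorem rank_bijective (v : Fin (n + 1) → ℕ) : Function.Bijective (rank v) :=
  (Finite.injective_iff_bijective).1 (rank_injective v)

theorem rank_unique {v : Fin (n + 1) → ℕ} {f : Fin (n + 1) → Fin (n + 1)}
    (h : ∀ i j, Before v i j → f i < f j) : f = rank v := by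
  let e := Equiv.ofBijective _ (rank_bijective v)
  have hm : StrictMono (f ∘ e.symm) := by
    intro a b hab
    apply h
    rw [← rank_lt_iff]
    change e (e.symm a) < e (e.symm b)
    simpa using hab
  have hid : f ∘ e.symm = id :=
    (hm.range_inj strictMono_id).1 (by
      rw [(Finite.surjective_of_injective hm.injective).range_eq, Set.range_id])
  funext i
  have := congrFun hid (e i)
  simpa [e] using this

theorem rank_zero : rank (0 : Fin (n + 1) → ℕ) = id :=
  (rank_unique fun i j h => by simpa [Before] using h).symm

theorem rank_comp_swap {v : Fin (n + 1) → ℕ} {i : Fin n} (h : v i.castSucc ≠ v i.succ)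
    (k : Fin (n + 1)) : rank (v ∘ Equiv.swap i.castSucc i.succ) k =
      rank v (Equiv.swap i.castSucc i.succ k) := by
  refine congrFun (rank_unique (f := fun k => rank v (Equiv.swap i.castSucc i.succ k)) ?_).symm k
  intro a b hab
  apply rank_lt
  unfold Before at *
  simp only [Function.comp_apply] at hab
  by_cases h1 : a = i.castSucc ∧ b = i.succ
  · obtain ⟨rfl, rfl⟩ := h1
    simp only [Equiv.swap_apply_left, Equiv.swap_apply_right] at *
    omega
  by_cases h2 : a = i.succ ∧ b = i.castSucc
  · obtain ⟨rfl, rfl⟩ := h2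
    simp only [Equiv.swap_apply_left, Equiv.swap_apply_right] at *
    omega
  rwa [lt_swap_iff h1 h2]

theorem rank_succ_of_eq {v : Fin (n + 1) → ℕ} {i : Fin n} (h : v i.castSucc = v i.succ) :
    (rank v i.succ : ℕ) = rank v i.castSucc + 1 := by
  have h1 : rank v i.castSucc < rank v i.succ :=
    rank_lt (Or.inr ⟨h, Fin.castSucc_lt_succ⟩)
  by_contra hne
  rw [Fin.lt_def] at h1
  obtain ⟨c, hc⟩ := (rank_bijective v).2 ⟨rank v i.castSucc + 1, by omega⟩
  have h2 : Before v i.castSucc c := rank_lt_iff.1 (by rw [hc, Fin.lt_def]; simp)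
  have h3 : Before v c i.succ := rank_lt_iff.1 (by rw [hc, Fin.lt_def]; simp; omega)
  unfold Before at h2 h3
  simp only [Fin.lt_def, Fin.val_castSucc, Fin.val_succ] at h2 h3
  omega

/-! ### Vertices as sequences of labels -/

/-- A label: a value of the multi-index together with a cell of the shape. -/
abbrev Label (lam : YoungDiagram) : Type := ℕ × {c : ℕ × ℕ // c ∈ lam.cells}

/-- The content of the cell of a label. -/
def Label.ct (l : Label lam) : ℤ := (l.2.1.2 : ℤ) - l.2.1.1

/-- The label at position `i` of the vertex `(A, v)`: the value `v[i]` and the cell of the entry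
`r_v[i]` in `A`. Arrows exchange adjacent labels. -/
def Vertex.lab (x : Vertex n lam) (i : Fin (n + 1)) : Label lam :=
  (x.vec i, x.tab.cell (rank x.vec i))

theorem Vertex.lab_ct (x : Vertex n lam) (i : Fin (n + 1)) : (x.lab i).ct = x.ct i := rfl

/-- The spectral value of a label. -/
def Label.spec (q s : K) (l : Label lam) : K := q ^ l.1 * s ^ l.ct

theorem Vertex.lab_spec (q s : K) (x : Vertex n lam) (i : Fin (n + 1)) :
    (x.lab i).spec q s = x.spec q s i := rfl

theorem Vertex.lab_injective : Function.Injective (Vertex.lab : Vertex n lam → _) := by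
  rintro ⟨A, v⟩ ⟨B, w⟩ h
  obtain rfl : v = w := funext fun i => congrArg Prod.fst (congrFun h i)
  have hA : A = B := by
    apply RST.ext
    ext k : 1
    obtain ⟨i, rfl⟩ := (rank_bijective v).2 k
    exact congrArg Prod.snd (congrFun h i)
  rw [hA]

theorem Vertex.lab_snd_bijective (x : Vertex n lam) :
    Function.Bijective fun i => (x.lab i).2 :=
  x.tab.cell.bijective.comp (rank_bijective x.vec)

/-- There is an arrow exchanging two adjacent labels `l, l'`. -/
def UpRel (l l' : Label lam) : Prop := l.1 < l'.1 ∨ (l.1 = l'.1 ∧ l'.ct + 2 ≤ l.ct)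

theorem UpRel.trans {l l' l'' : Label lam} (h : UpRel l l') (h' : UpRel l' l'') :
    UpRel l l'' := by
  unfold UpRel at *; omega

theorem UpRel.asymm {l l' : Label lam} (h : UpRel l l') : ¬ UpRel l' l := by
  unfold UpRel at *; omega

/-- The vertex obtained by exchanging the labels at `i`, `i + 1` (when this is a vertex). -/
def Vertex.sw (i : Fin n) (x : Vertex n lam) : Vertex n lam :=
  if x.vec i.castSucc = x.vec i.succ then
    ⟨x.tab.exch (rank x.vec i.castSucc) (rank x.vec i.succ), x.vec⟩
  else ⟨x.tab, x.vec ∘ Equiv.swap i.castSucc i.succ⟩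

theorem Vertex.sw_lab {i : Fin n} {x : Vertex n lam}
    (h : UpRel (x.lab i.castSucc) (x.lab i.succ) ∨ UpRel (x.lab i.succ) (x.lab i.castSucc))
    (k : Fin (n + 1)) : (x.sw i).lab k = x.lab (Equiv.swap i.castSucc i.succ k) := by
  by_cases hv : x.vec i.castSucc = x.vec i.succ
  · simp only [Vertex.sw, if_pos hv]
    have hct : x.tab.ct (rank x.vec i.succ) - x.tab.ct (rank x.vec i.castSucc) ≤ -2 ∨
        2 ≤ x.tab.ct (rank x.vec i.succ) - x.tab.ct (rank x.vec i.castSucc) := by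
      unfold UpRel at h
      change _ ∨ 2 ≤ (x.lab i.succ).ct - (x.lab i.castSucc).ct
      change (x.lab i.succ).ct - (x.lab i.castSucc).ct ≤ -2 ∨ _
      have e1 : (x.lab i.castSucc).1 = x.vec i.castSucc := rfl
      have e2 : (x.lab i.succ).1 = x.vec i.succ := rfl
      omega
    refine Prod.ext ?_ ?_
    · change x.vec k = x.vec _
      rw [Equiv.swap_apply_def]
      split_ifs with h1 h2
      · rw [h1, hv]
      · rw [h2, hv]
      · rfl
    · change (x.tab.exch _ _).cell (rank x.vec k) = x.tab.cell (rank x.vec _)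
      rw [RST.exch_cell _ (rank_succ_of_eq hv) hct, (rank_injective x.vec).map_swap]
      rfl
  · simp only [Vertex.sw, if_neg hv]
    refine Prod.ext rfl ?_
    change x.tab.cell (rank (x.vec ∘ _) k) = x.tab.cell (rank x.vec _)
    rw [rank_comp_swap hv]

theorem arrow_iff {i : Fin n} {x y : Vertex n lam} :
    Arrow i x y ↔ UpRel (x.lab i.castSucc) (x.lab i.succ) ∧ y = x.sw i := by
  constructor
  · intro harr
    cases harr with
    | step h => exact ⟨Or.inl h, by simp [Vertex.sw, h.ne]⟩
    | jump h hct => exact ⟨Or.inr ⟨h, hct⟩, by simp [Vertex.sw, h]⟩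
  · rintro ⟨h | ⟨h, hct⟩, rfl⟩
    · have h' : x.vec i.castSucc < x.vec i.succ := h
      simp only [Vertex.sw, if_neg h'.ne]
      exact Arrow.step i x h'
    · have h' : x.vec i.castSucc = x.vec i.succ := h
      simp only [Vertex.sw, if_pos h']
      exact Arrow.jump i x h' hct

theorem Vertex.sw_sw {i : Fin n} {x : Vertex n lam}
    (h : UpRel (x.lab i.castSucc) (x.lab i.succ) ∨ UpRel (x.lab i.succ) (x.lab i.castSucc)) :
    (x.sw i).sw i = x := by
  apply Vertex.lab_injective
  funext k
  rw [Vertex.sw_lab, Vertex.sw_lab h, Equiv.swap_apply_self]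
  rw [Vertex.sw_lab h, Vertex.sw_lab h, Equiv.swap_apply_left, Equiv.swap_apply_right]
  exact h.symm

theorem arrow_iff' {i : Fin n} {x y : Vertex n lam} :
    Arrow i x y ↔ UpRel (y.lab i.succ) (y.lab i.castSucc) ∧ x = y.sw i := by
  rw [arrow_iff]
  constructor
  · rintro ⟨h, rfl⟩
    rw [Vertex.sw_lab (Or.inl h), Vertex.sw_lab (Or.inl h), Equiv.swap_apply_left,
      Equiv.swap_apply_right, Vertex.sw_sw (Or.inl h)]
    exact ⟨h, rfl⟩
  · rintro ⟨h, rfl⟩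
    rw [Vertex.sw_lab (Or.inr h), Vertex.sw_lab (Or.inr h), Equiv.swap_apply_left,
      Equiv.swap_apply_right, Vertex.sw_sw (Or.inr h)]
    exact ⟨h, rfl⟩

/-- The label after an affine step around the end of the sequence. -/
def Label.up (l : Label lam) : Label lam := (l.1 + 1, l.2)

theorem rank_snoc (v : Fin (n + 1) → ℕ) :
    rank (Fin.snoc (fun i : Fin n => v i.succ) (v 0 + 1) : Fin (n + 1) → ℕ) =
      Fin.snoc (α := fun _ => Fin (n + 1)) (fun i : Fin n => rank v i.succ) (rank v 0) := by
  refine (rank_unique ?_).symm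
  intro a b
  unfold Before
  induction a using Fin.lastCases with
  | last =>
    induction b using Fin.lastCases with
    | last => simp
    | cast b =>
      simp only [Fin.snoc_last, Fin.snoc_castSucc]
      intro h
      apply rank_lt
      unfold Before
      have : ¬ Fin.last n < b.castSucc := (Fin.castSucc_lt_last b).not_gt
      have : 0 < b.succ := Fin.succ_pos b
      by_cases hb : v b.succ = v 0
      · exact Or.inr ⟨hb.symm, this⟩
      · left; omega
  | cast a =>
    induction b using Fin.lastCases with
    | last =>
      simp only [Fin.snoc_last, Fin.snoc_castSucc]
      intro h
      apply rank_lt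
      unfold Before
      left; omega
    | cast b =>
      simp only [Fin.snoc_castSucc]
      intro h
      apply rank_lt
      unfold Before
      simp only [Fin.lt_def, Fin.val_castSucc, Fin.val_succ] at *
      omega

theorem Vertex.affine_lab_castSucc (x : Vertex n lam) (i : Fin n) :
    x.affine.lab i.castSucc = x.lab i.succ := by
  simp [Vertex.lab, Vertex.affine, rank_snoc]

theorem Vertex.affine_lab_last (x : Vertex n lam) :
    x.affine.lab (Fin.last n) = (x.lab 0).up := by
  simp [Vertex.lab, Vertex.affine, rank_snoc, Label.up]

theorem Vertex.exists_affine {y : Vertex n lam} (h : y.vec (Fin.last n) ≠ 0) :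
    ∃ x : Vertex n lam, x.affine = y := by
  refine ⟨⟨y.tab, Fin.cons (y.vec (Fin.last n) - 1) fun i => y.vec i.castSucc⟩, ?_⟩
  obtain ⟨A, v⟩ := y
  simp only [Vertex.affine]
  congr 1
  funext k
  induction k using Fin.lastCases with
  | last => simp only [Fin.snoc_last, Fin.cons_zero]; simp only at h; omega
  | cast k => simp

theorem Vertex.affine_vec_last (x : Vertex n lam) : x.affine.vec (Fin.last n) = x.vec 0 + 1 := by
  simp [Vertex.affine]

/-! ### Induction on the graph -/

/-- The degree of the polynomials at a vertex. -/
def Vertex.deg (x : Vertex n lam) : ℕ := ∑ i, x.vec i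

open Classical in
/-- The number of pairs of positions which could be the result of an exchange along an arrow. -/
def Vertex.inv (x : Vertex n lam) : ℕ :=
  ∑ p : Fin (n + 1) × Fin (n + 1) with p.1 < p.2, if UpRel (x.lab p.2) (x.lab p.1) then 1 else 0

theorem Vertex.deg_affine (x : Vertex n lam) : x.affine.deg = x.deg + 1 := by
  rw [Vertex.deg, Vertex.deg, Fin.sum_univ_castSucc, Fin.sum_univ_succ]
  simp [Vertex.affine]
  ring

theorem Vertex.deg_sw {i : Fin n} {x : Vertex n lam}
    (h : UpRel (x.lab i.castSucc) (x.lab i.succ) ∨ UpRel (x.lab i.succ) (x.lab i.castSucc)) :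
    (x.sw i).deg = x.deg := by
  unfold Vertex.deg
  rw [← Equiv.sum_comp (Equiv.swap i.castSucc i.succ) x.vec]
  exact Finset.sum_congr rfl fun k _ => congrArg Prod.fst (Vertex.sw_lab h k)

theorem Vertex.inv_sw {i : Fin n} {x : Vertex n lam}
    (h : UpRel (x.lab i.succ) (x.lab i.castSucc)) : x.inv = (x.sw i).inv + 1 := by
  classical
  have := sum_pairs_swap (fun l l' : Label lam => if UpRel l' l then 1 else 0) x.lab i
  simp only [if_pos h, if_neg h.asymm, add_zero] at this
  unfold Vertex.inv
  simp only [Vertex.sw_lab (Or.inr h)]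
  exact this.symm

/-- The predecessor relation for induction on the graph. -/
def Vertex.Smaller (x y : Vertex n lam) : Prop :=
  x.deg < y.deg ∨ (x.deg = y.deg ∧ x.inv < y.inv)

theorem Vertex.Smaller.trans {x y z : Vertex n lam} (h : x.Smaller y) (h' : y.Smaller z) :
    x.Smaller z := by
  unfold Vertex.Smaller at *; omega

theorem Vertex.smaller_affine (x : Vertex n lam) : x.Smaller x.affine :=
  Or.inl (by rw [Vertex.deg_affine]; omega)

theorem Vertex.smaller_sw {i : Fin n} {x : Vertex n lam}
    (h : UpRel (x.lab i.succ) (x.lab i.castSucc)) : (x.sw i).Smaller x :=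
  Or.inr ⟨Vertex.deg_sw (Or.inr h), by rw [Vertex.inv_sw h]; omega⟩

theorem Vertex.graph_induction {p : Vertex n lam → Prop}
    (h : ∀ y, (∀ z : Vertex n lam, z.Smaller y → p z) → p y) (y : Vertex n lam) : p y := by
  have wf : WellFounded (Vertex.Smaller : Vertex n lam → Vertex n lam → Prop) := by
    refine Subrelation.wf (r := InvImage (Prod.Lex (· < ·) (· < ·)) fun x => (x.deg, x.inv)) ?_
      (InvImage.wf _ (wellFounded_lt.prod_lex wellFounded_lt))
    rintro x z (h | ⟨h1, h2⟩)
    · exact Prod.Lex.left _ _ h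
    · change Prod.Lex _ _ (x.deg, x.inv) (z.deg, z.inv)
      rw [h1]
      exact Prod.Lex.right _ h2
  exact wf.induction y h

/-! ### The Macdonald polynomials do not depend on the path -/

/-- The parameters `q, s` are nonzero and multiplicatively independent. -/
structure Generic (q s : K) : Prop where
  q_ne_zero : q ≠ 0
  s_ne_zero : s ≠ 0
  indep : ∀ a b : ℤ, q ^ a * s ^ b = 1 → a = 0 ∧ b = 0

theorem Generic.nonRoot {q s : K} (h : Generic q s) : NonRoot s :=
  ⟨h.s_ne_zero, fun b hb => (h.indep 0 b (by simpa using hb)).2⟩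

theorem Generic.inv {q s : K} (h : Generic q s) : Generic q⁻¹ s⁻¹ :=
  ⟨inv_ne_zero h.q_ne_zero, inv_ne_zero h.s_ne_zero, fun a b hab => by
    have := h.indep (-a) (-b) (by simpa [zpow_neg] using hab)
    omega⟩

theorem Label.spec_ne_zero {q s : K} (h : Generic q s) (l : Label lam) : l.spec q s ≠ 0 :=
  mul_ne_zero (pow_ne_zero _ h.q_ne_zero) (zpow_ne_zero _ h.s_ne_zero)

/-- Spectral values of labels, up to a power of `s`, determine the value and the content. -/
theorem Label.spec_eq {q s : K} (h : Generic q s) {l l' : Label lam} {k : ℤ}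
    (e : l.spec q s = s ^ k * l'.spec q s) : l.1 = l'.1 ∧ l.ct = l'.ct + k := by
  have hq := h.q_ne_zero
  have hs := h.s_ne_zero
  have := h.indep (l.1 - l'.1) (l.ct - l'.ct - k) (by
    unfold Label.spec at e
    rw [zpow_sub₀ hq, zpow_sub₀ hs, zpow_sub₀ hs, zpow_natCast, zpow_natCast]
    field_simp
    rw [e]
    ring)
  omega

theorem Label.spec_div_ne {q s : K} (h : Generic q s) {l l' : Label lam}
    (hl : l.1 = l'.1 → l.ct ≠ l'.ct) : 1 - l'.spec q s / l.spec q s ≠ 0 := by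
  intro h0
  have e := (div_eq_one_iff_eq (l.spec_ne_zero h)).1 (sub_eq_zero.1 h0).symm
  have := Label.spec_eq h (k := 0) (by rw [e]; simp : l.spec q s = s ^ (0 : ℤ) * l'.spec q s)
  exact hl this.1 (by omega)

theorem UpRel.spec_div_ne {q s : K} (h : Generic q s) {l l' : Label lam} (hl : UpRel l l') :
    1 - l'.spec q s / l.spec q s ≠ 0 :=
  Label.spec_div_ne h fun e => by unfold UpRel at hl; omega

/-- The constant `(1 - s) / (1 - ζ[i+1] / ζ[i])` added to `𝐓_i` along an arrow. -/
def arrowConst (q s : K) (l l' : Label lam) : K := (1 - s) / (1 - l'.spec q s / l.spec q s)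

/-- The operator `𝐓_i + (1 - s) / (1 - ζ[i+1] / ζ[i])`. -/
def intertwiner (q s : K) (i : Fin n) (l l' : Label lam) : Module.End K (VVPoly K n lam) :=
  bT s i + arrowConst q s l l' • (1 : Module.End K (VVPoly K n lam))

theorem intertwiner_apply (q s : K) (i : Fin n) (l l' : Label lam) (P : VVPoly K n lam) :
    intertwiner q s i l l' P = bT s i P + arrowConst q s l l' • P := by
  simp [intertwiner]

theorem intertwiner_comm {q s : K} (h : Generic q s) {i j : Fin n} (hij : (i : ℕ) + 2 ≤ j)
    (l₁ l₂ l₃ l₄ : Label lam) (P : VVPoly K n lam) :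
    intertwiner q s i l₁ l₂ (intertwiner q s j l₃ l₄ P) =
      intertwiner q s j l₃ l₄ (intertwiner q s i l₁ l₂ P) := by
  simp only [intertwiner_apply, map_add, map_smul, bT_comm h.nonRoot hij]
  module

/-- The Yang-Baxter equation. -/
theorem intertwiner_braid {q s : K} (h : Generic q s) {i j : Fin n} (hij : (j : ℕ) = i + 1)
    {l₁ l₂ l₃ : Label lam} (h12 : 1 - l₂.spec q s / l₁.spec q s ≠ 0)
    (h13 : 1 - l₃.spec q s / l₁.spec q s ≠ 0) (h23 : 1 - l₃.spec q s / l₂.spec q s ≠ 0)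
    (P : VVPoly K n lam) :
    intertwiner q s i l₂ l₃ (intertwiner q s j l₁ l₃ (intertwiner q s i l₁ l₂ P)) =
      intertwiner q s j l₁ l₂ (intertwiner q s i l₁ l₃ (intertwiner q s j l₂ l₃ P)) := by
  have key : arrowConst q s l₁ l₃ * (s - 1 + arrowConst q s l₁ l₂ + arrowConst q s l₂ l₃) =
      arrowConst q s l₁ l₂ * arrowConst q s l₂ l₃ := by
    unfold arrowConst
    have e : l₃.spec q s / l₁.spec q s =
        l₃.spec q s / l₂.spec q s * (l₂.spec q s / l₁.spec q s) := by
      have := l₂.spec_ne_zero h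
      have := l₁.spec_ne_zero h
      field_simp
    rw [e] at h13 ⊢
    generalize l₃.spec q s / l₂.spec q s = u at *
    generalize l₂.spec q s / l₁.spec q s = v at *
    field_simp
    ring
  simp only [intertwiner_apply, map_add, map_smul, bT_quadratic h.nonRoot,
    bT_braid h.nonRoot hij]
  generalize arrowConst q s l₁ l₃ = β at *
  generalize arrowConst q s l₁ l₂ = γ at *
  generalize arrowConst q s l₂ l₃ = α at *
  have k1 : β * (s - 1) = γ * α - β * γ - β * α := by linear_combination key
  simp only [smul_add, smul_smul, k1]
  module

theorem isMacdonald_of_sw {q s : K} {y : Vertex n lam} {i : Fin n} {Q : VVPoly K n lam}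
    (hd : UpRel (y.lab i.succ) (y.lab i.castSucc)) (hQ : IsMacdonald q s (y.sw i) Q) :
    IsMacdonald q s y (intertwiner q s i (y.lab i.succ) (y.lab i.castSucc) Q) := by
  have := IsMacdonald.arrow i (y.sw i) y Q hQ (arrow_iff'.2 ⟨hd, rfl⟩)
  rw [← Vertex.lab_spec, ← Vertex.lab_spec, Vertex.sw_lab (Or.inr hd), Vertex.sw_lab (Or.inr hd),
    Equiv.swap_apply_left, Equiv.swap_apply_right] at this
  rw [intertwiner_apply]
  exact this

theorem IsMacdonald.cases_vertex {q s : K} {y : Vertex n lam} {P : VVPoly K n lam}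
    (h : IsMacdonald q s y P) :
    (∃ A : RST n lam, A.IsColumnReading ∧ y = ⟨A, 0⟩ ∧ P = 1 ⊗ₜ Finsupp.single A 1) ∨
    (∃ i Q, UpRel (y.lab i.succ) (y.lab i.castSucc) ∧ IsMacdonald q s (y.sw i) Q ∧
      P = intertwiner q s i (y.lab i.succ) (y.lab i.castSucc) Q) ∨
    ∃ x Q, y = x.affine ∧ IsMacdonald q s x Q ∧ P = raising s Q := by
  cases h with
  | root A hA => exact Or.inl ⟨A, hA, rfl, rfl⟩
  | arrow i x _ Q hQ harr =>
    obtain ⟨hd, rfl⟩ := arrow_iff'.1 harr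
    refine Or.inr (Or.inl ⟨i, Q, hd, hQ, ?_⟩)
    rw [intertwiner_apply, ← Vertex.lab_spec, ← Vertex.lab_spec, Vertex.sw_lab (Or.inr hd),
      Vertex.sw_lab (Or.inr hd), Equiv.swap_apply_left, Equiv.swap_apply_right]
    rfl
  | affine x Q hQ => exact Or.inr (Or.inr ⟨x, Q, rfl, hQ, rfl⟩)

theorem RST.isColumnReading_iff (A : RST n lam) :
    A.IsColumnReading ↔ ∀ i : Fin n, ¬ A.ct i.castSucc + 2 ≤ A.ct i.succ := by
  have hab : ∀ i : Fin n, ((i.succ : Fin (n + 1)) : ℕ) = i.castSucc + 1 := by simp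
  constructor
  · intro hA i hi
    rcases A.consecutive_cases (hab i) with h | h | h | h
    · omega
    · omega
    · omega
    · exact (hA _ _ h.2.2).not_gt Fin.castSucc_lt_succ
  · intro h k l hkl
    have hanti : Antitone A.col := by
      rw [Fin.antitone_iff_succ_le]
      intro i
      rcases A.consecutive_cases (hab i) with h' | h' | h' | h'
      · omega
      · omega
      · omega
      · have := h i; omega
    by_contra hcon
    exact absurd (hanti (not_lt.1 hcon)) (not_le.2 hkl)

theorem Vertex.lab_zero (A : RST n lam) (k : Fin (n + 1)) :
    (⟨A, 0⟩ : Vertex n lam).lab k = (0, A.cell k) := by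
  simp [Vertex.lab, rank_zero]

theorem Label.ct_mk_cell (A : RST n lam) (k : Fin (n + 1)) (v : ℕ) :
    Label.ct ((v, A.cell k) : Label lam) = A.ct k := rfl

/-- Every vertex is the root of the graph or has a predecessor. -/
theorem Vertex.predecessor (y : Vertex n lam) :
    (∃ A : RST n lam, A.IsColumnReading ∧ y = ⟨A, 0⟩) ∨
    (∃ i : Fin n, UpRel (y.lab i.succ) (y.lab i.castSucc)) ∨ ∃ x : Vertex n lam, y = x.affine := by
  by_cases h0 : y.vec (Fin.last n) = 0
  swap
  · obtain ⟨x, hx⟩ := Vertex.exists_affine h0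
    exact Or.inr (Or.inr ⟨x, hx.symm⟩)
  by_cases h : ∃ i : Fin n, UpRel (y.lab i.succ) (y.lab i.castSucc)
  · exact Or.inr (Or.inl h)
  push Not at h
  have hmono : Monotone y.vec := by
    rw [Fin.monotone_iff_le_succ]
    intro i
    have := h i
    unfold UpRel at this
    simp only [Vertex.lab] at this
    omega
  obtain ⟨A, v⟩ := y
  have hv : v = 0 := by
    funext k
    have := hmono (Fin.le_last k)
    simp only at this h0
    simp only [Pi.zero_apply]
    omega
  subst hv
  refine Or.inl ⟨A, ?_, rfl⟩
  rw [RST.isColumnReading_iff]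
  intro i hi
  apply h i
  rw [Vertex.lab_zero, Vertex.lab_zero]
  exact Or.inr ⟨rfl, hi⟩

theorem exists_isMacdonald (q s : K) (y : Vertex n lam) : ∃ P, IsMacdonald q s y P := by
  induction y using Vertex.graph_induction with
  | h y ih =>
    rcases y.predecessor with ⟨A, hA, rfl⟩ | ⟨i, hi⟩ | ⟨x, rfl⟩
    · exact ⟨_, IsMacdonald.root A hA⟩
    · obtain ⟨Q, hQ⟩ := ih _ (Vertex.smaller_sw hi)
      exact ⟨_, isMacdonald_of_sw hi hQ⟩
    · obtain ⟨Q, hQ⟩ := ih _ x.smaller_affine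
      exact ⟨_, IsMacdonald.affine x Q hQ⟩

theorem isMacdonald_macdonald (q s : K) (y : Vertex n lam) :
    IsMacdonald q s y (macdonald q s y) := by
  have h := exists_isMacdonald q s y
  rw [macdonald, dif_pos h]
  exact h.choose_spec

theorem bT_raising {s : K} (hs : NonRoot s) {i j : Fin n} (hij : (j : ℕ) = i + 1)
    (P : VVPoly K n lam) : bT s i (raising s P) = raising s (bT s j P) := by
  have h := (isDoubleAffine (n := n) (lam := lam) hs 1).T_mul_phi (i := i) (by omega)
  rw [← raising_eq, ← hij, natFam_val, natFam_val] at h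
  exact congrArg (fun f => f P) h

theorem bT_raising_raising {s : K} (hs : NonRoot s) {i j : Fin n} (hi : (i : ℕ) + 1 = n)
    (hj : (j : ℕ) = 0) (P : VVPoly K n lam) :
    bT s i (raising s (raising s P)) = raising s (raising s (bT s j P)) := by
  obtain ⟨m, rfl⟩ : ∃ m, n = m + 1 := ⟨i, hi.symm⟩
  have h := (isDoubleAffine (n := m + 1) (lam := lam) hs 1).T_mul_phi_mul_phi
  rw [← raising_eq, natFam_of_lt _ (show m < m + 1 by omega),
    natFam_of_lt _ (show 0 < m + 1 by omega)] at h
  have e1 : i = ⟨m, by omega⟩ := by ext; simp; omega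
  have e2 : j = ⟨0, by omega⟩ := by ext; simp [hj]
  rw [e1, e2]
  exact congrArg (fun f => f P) h

theorem Label.up_spec (q s : K) (l : Label lam) : l.up.spec q s = q * l.spec q s := by
  simp only [Label.spec, Label.up, pow_succ, Label.ct]
  ring

theorem arrowConst_up {q s : K} (h : Generic q s) (l l' : Label lam) :
    arrowConst q s l.up l'.up = arrowConst q s l l' := by
  rw [arrowConst, arrowConst, Label.up_spec, Label.up_spec, mul_div_mul_left _ _ h.q_ne_zero]

theorem UpRel.up_iff {l l' : Label lam} : UpRel l.up l'.up ↔ UpRel l l' := by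
  unfold UpRel Label.up Label.ct; simp

theorem intertwiner_raising {q s : K} (h : Generic q s) {i j : Fin n} (hij : (j : ℕ) = i + 1)
    (l l' : Label lam) (P : VVPoly K n lam) :
    intertwiner q s i l l' (raising s P) = raising s (intertwiner q s j l l' P) := by
  simp only [intertwiner_apply, bT_raising h.nonRoot hij, map_add, map_smul]

theorem intertwiner_raising_raising {q s : K} (h : Generic q s) {i j : Fin n}
    (hi : (i : ℕ) + 1 = n) (hj : (j : ℕ) = 0) (l l' : Label lam) (P : VVPoly K n lam) :
    intertwiner q s i l.up l'.up (raising s (raising s P)) =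
      raising s (raising s (intertwiner q s j l l' P)) := by
  simp only [intertwiner_apply, bT_raising_raising h.nonRoot hi hj, map_add, map_smul,
    arrowConst_up h]

theorem Vertex.affine_injective : Function.Injective (Vertex.affine : Vertex n lam → _) := by
  intro x y h
  apply Vertex.lab_injective
  funext k
  rcases Fin.eq_zero_or_eq_succ k with rfl | ⟨k, rfl⟩
  · have := congrArg (fun z => z.lab (Fin.last n)) h
    simp only [Vertex.affine_lab_last, Label.up, Prod.mk.injEq] at this
    exact Prod.ext (by omega) this.2
  · have := congrArg (fun z => z.lab k.castSucc) h
    simpa only [Vertex.affine_lab_castSucc] using this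

/-- Exchanging labels away from the end commutes with the affine step. -/
theorem Vertex.affine_sw {i j : Fin n} (hij : (j : ℕ) = i + 1) {x : Vertex n lam}
    (hd : UpRel (x.lab j.succ) (x.lab j.castSucc)) :
    x.affine.sw i = (x.sw j).affine ∧
      UpRel (x.affine.lab i.succ) (x.affine.lab i.castSucc) := by
  have hs : i.succ = j.castSucc := by ext; simp [hij]
  have hd' : UpRel (x.affine.lab i.succ) (x.affine.lab i.castSucc) := by
    rw [hs, Vertex.affine_lab_castSucc, Vertex.affine_lab_castSucc, hs]
    exact hd
  refine ⟨?_, hd'⟩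
  apply Vertex.lab_injective
  funext k
  rw [Vertex.sw_lab (Or.inr hd')]
  induction k using Fin.lastCases with
  | last =>
    rw [Equiv.swap_apply_of_ne_of_ne, Vertex.affine_lab_last, Vertex.affine_lab_last,
      Vertex.sw_lab (Or.inr hd), Equiv.swap_apply_of_ne_of_ne]
    · simp [Fin.ext_iff]; omega
    · simp [Fin.ext_iff]
    · simp [Fin.ext_iff]; omega
    · simp [Fin.ext_iff]; omega
  | cast k =>
    have : Equiv.swap i.castSucc i.succ k.castSucc = (Equiv.swap i j k).castSucc := by
      rw [hs, (Fin.castSucc_injective n).map_swap]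
    rw [this, Vertex.affine_lab_castSucc, Vertex.affine_lab_castSucc, Vertex.sw_lab (Or.inr hd),
      (Fin.succ_injective n).map_swap, hs]

theorem Vertex.affine_affine_lab {m : ℕ} (x : Vertex (m + 1) lam) :
    x.affine.affine.lab (Fin.last (m + 1)) = (x.lab 1).up ∧
    x.affine.affine.lab (Fin.last m).castSucc = (x.lab 0).up ∧
    ∀ k : Fin m, x.affine.affine.lab k.castSucc.castSucc = x.lab k.succ.succ := by
  refine ⟨?_, ?_, fun k => ?_⟩
  · rw [Vertex.affine_lab_last]
    have := x.affine_lab_castSucc 0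
    rw [Fin.castSucc_zero, Fin.succ_zero_eq_one] at this
    rw [this]
  · rw [Vertex.affine_lab_castSucc, Fin.succ_last, Vertex.affine_lab_last]
  · rw [Vertex.affine_lab_castSucc, Fin.succ_castSucc, Vertex.affine_lab_castSucc]

theorem Vertex.affine_affine_sw {m : ℕ} {x : Vertex (m + 1) lam}
    (hd : UpRel (x.lab 1) (x.lab 0)) :
    x.affine.affine.sw (Fin.last m) = (x.sw 0).affine.affine ∧
      UpRel (x.affine.affine.lab (Fin.last m).succ)
        (x.affine.affine.lab (Fin.last m).castSucc) := by
  obtain ⟨h1, h2, h3⟩ := x.affine_affine_lab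
  obtain ⟨k1, k2, k3⟩ := (x.sw 0).affine_affine_lab
  have hd0 : UpRel (x.lab (0 : Fin (m + 1)).castSucc) (x.lab (0 : Fin (m + 1)).succ) ∨
      UpRel (x.lab (0 : Fin (m + 1)).succ) (x.lab (0 : Fin (m + 1)).castSucc) := Or.inr hd
  have hd' : UpRel (x.affine.affine.lab (Fin.last m).succ)
      (x.affine.affine.lab (Fin.last m).castSucc) := by
    rw [Fin.succ_last, h1, h2]
    exact UpRel.up_iff.2 hd
  refine ⟨?_, hd'⟩
  apply Vertex.lab_injective
  funext k
  rw [Vertex.sw_lab (Or.inr hd')]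
  induction k using Fin.lastCases with
  | last =>
    rw [k1, Vertex.sw_lab hd0, Fin.succ_last, Equiv.swap_apply_right, h2, Fin.castSucc_zero,
      Fin.succ_zero_eq_one, Equiv.swap_apply_right]
  | cast k =>
    induction k using Fin.lastCases with
    | last =>
      rw [k2, Vertex.sw_lab hd0, Fin.succ_last, Equiv.swap_apply_left, h1, Fin.castSucc_zero,
        Fin.succ_zero_eq_one, Equiv.swap_apply_left]
    | cast k =>
      rw [k3, Vertex.sw_lab hd0, Equiv.swap_apply_of_ne_of_ne, h3, Equiv.swap_apply_of_ne_of_ne]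
      · simp [Fin.ext_iff]
      · simp [Fin.ext_iff]
      · simp [Fin.ext_iff]; omega
      · simp [Fin.ext_iff]; omega

/-- Two predecessors by exchanges at distant positions have a common predecessor. -/
theorem Vertex.sw_comm {i j : Fin n} (hij : (i : ℕ) + 2 ≤ j) {y : Vertex n lam}
    (hi : UpRel (y.lab i.succ) (y.lab i.castSucc)) (hj : UpRel (y.lab j.succ) (y.lab j.castSucc)) :
    (y.sw i).sw j = (y.sw j).sw i ∧
    ((y.sw i).lab j.succ = y.lab j.succ ∧ (y.sw i).lab j.castSucc = y.lab j.castSucc) ∧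
    (y.sw j).lab i.succ = y.lab i.succ ∧ (y.sw j).lab i.castSucc = y.lab i.castSucc := by
  have n1 : i.castSucc ≠ j.castSucc := by simp [Fin.ext_iff]; omega
  have n2 : i.castSucc ≠ j.succ := by simp [Fin.ext_iff]; omega
  have n3 : i.succ ≠ j.castSucc := by simp [Fin.ext_iff]; omega
  have n4 : i.succ ≠ j.succ := by simp [Fin.ext_iff]; omega
  have e1 : (y.sw i).lab j.succ = y.lab j.succ := by
    rw [Vertex.sw_lab (Or.inr hi), Equiv.swap_apply_of_ne_of_ne n2.symm n4.symm]
  have e2 : (y.sw i).lab j.castSucc = y.lab j.castSucc := by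
    rw [Vertex.sw_lab (Or.inr hi), Equiv.swap_apply_of_ne_of_ne n1.symm n3.symm]
  have e3 : (y.sw j).lab i.succ = y.lab i.succ := by
    rw [Vertex.sw_lab (Or.inr hj), Equiv.swap_apply_of_ne_of_ne n3 n4]
  have e4 : (y.sw j).lab i.castSucc = y.lab i.castSucc := by
    rw [Vertex.sw_lab (Or.inr hj), Equiv.swap_apply_of_ne_of_ne n1 n2]
  refine ⟨?_, ⟨e1, e2⟩, e3, e4⟩
  apply Vertex.lab_injective
  funext k
  rw [Vertex.sw_lab (Or.inr (by rwa [e1, e2])), Vertex.sw_lab (Or.inr hi),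
    Vertex.sw_lab (Or.inr (by rwa [e3, e4])), Vertex.sw_lab (Or.inr hj)]
  congr 1
  simp only [Equiv.swap_apply_def]
  split_ifs <;> simp_all

/-- The labels after exchanges at two neighbouring positions. -/
theorem Vertex.sw_sw_lab {i j : Fin n} (hij : (j : ℕ) = i + 1) {y : Vertex n lam}
    (h : UpRel (y.lab i.succ) (y.lab i.castSucc)) :
    (y.sw i).lab i.castSucc = y.lab j.castSucc ∧ (y.sw i).lab j.castSucc = y.lab i.castSucc ∧
      (y.sw i).lab j.succ = y.lab j.succ := by
  have hs : i.succ = j.castSucc := by ext; simp [hij]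
  rw [Vertex.sw_lab (Or.inr h), Vertex.sw_lab (Or.inr h), Vertex.sw_lab (Or.inr h),
    Equiv.swap_apply_left, hs, Equiv.swap_apply_right, Equiv.swap_apply_of_ne_of_ne]
  · simp
  · simp [Fin.ext_iff]; omega
  · simp [Fin.ext_iff]

theorem Vertex.sw_sw_lab' {i j : Fin n} (hij : (j : ℕ) = i + 1) {y : Vertex n lam}
    (h : UpRel (y.lab j.succ) (y.lab j.castSucc)) :
    (y.sw j).lab i.castSucc = y.lab i.castSucc ∧ (y.sw j).lab j.castSucc = y.lab j.succ ∧
      (y.sw j).lab j.succ = y.lab j.castSucc := by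
  rw [Vertex.sw_lab (Or.inr h), Vertex.sw_lab (Or.inr h), Vertex.sw_lab (Or.inr h),
    Equiv.swap_apply_left, Equiv.swap_apply_right, Equiv.swap_apply_of_ne_of_ne]
  · simp
  · simp [Fin.ext_iff]; omega
  · simp [Fin.ext_iff]; omega

theorem Vertex.sw_braid {i j : Fin n} (hij : (j : ℕ) = i + 1) {y : Vertex n lam}
    (hi : UpRel (y.lab j.castSucc) (y.lab i.castSucc))
    (hj : UpRel (y.lab j.succ) (y.lab j.castSucc)) :
    ((y.sw i).sw j).sw i = ((y.sw j).sw i).sw j := by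
  have hs : i.succ = j.castSucc := by ext; simp [hij]
  have hi' : UpRel (y.lab i.succ) (y.lab i.castSucc) := by rwa [hs]
  have nab : i.castSucc ≠ j.castSucc := by simp [Fin.ext_iff]; omega
  have nad : i.castSucc ≠ j.succ := by simp [Fin.ext_iff]; omega
  have nbd : j.castSucc ≠ j.succ := by simp [Fin.ext_iff]
  obtain ⟨a1, a2, a3⟩ := Vertex.sw_sw_lab hij hi'
  have h2 : UpRel ((y.sw i).lab j.succ) ((y.sw i).lab j.castSucc) := by
    rw [a2, a3]; exact hj.trans hi
  obtain ⟨b1, b2, b3⟩ := Vertex.sw_sw_lab' hij h2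
  have h3 : UpRel (((y.sw i).sw j).lab i.succ) (((y.sw i).sw j).lab i.castSucc) := by
    rw [hs, b1, b2, a1, a3]; exact hj
  obtain ⟨c1, c2, c3⟩ := Vertex.sw_sw_lab' hij hj
  have h4 : UpRel ((y.sw j).lab i.succ) ((y.sw j).lab i.castSucc) := by
    rw [hs, c1, c2]; exact hj.trans hi
  obtain ⟨d1, d2, d3⟩ := Vertex.sw_sw_lab hij h4
  have h5 : UpRel (((y.sw j).sw i).lab j.succ) (((y.sw j).sw i).lab j.castSucc) := by
    rw [d2, d3, c1, c3]; exact hi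
  apply Vertex.lab_injective
  funext k
  rw [Vertex.sw_lab (Or.inr h3), Vertex.sw_lab (Or.inr h2), Vertex.sw_lab (Or.inr hi'),
    Vertex.sw_lab (Or.inr h5), Vertex.sw_lab (Or.inr h4), Vertex.sw_lab (Or.inr hj), hs,
    swap_braid nab nbd nad]

/-- The value of the Macdonald polynomial does not depend on the path: two different last steps of
a path have a common continuation backwards, and the Yang-Baxter equation and the relations of the
raising operator identify the results. -/
theorem IsMacdonald.unique {q s : K} (h : Generic q s) {y : Vertex n lam} {P P' : VVPoly K n lam}
    (hP : IsMacdonald q s y P) (hP' : IsMacdonald q s y P') : P = P' := by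
  induction y using Vertex.graph_induction generalizing P P' with
  | h y ih =>
  have U : ∀ z : Vertex n lam, z.Smaller y → ∀ Q, IsMacdonald q s z Q → Q = macdonald q s z :=
    fun z hz Q hQ => ih z hz hQ (isMacdonald_macdonald q s z)
  have rel1 : ∀ z : Vertex n lam, z.Smaller y → ∀ i : Fin n,
      UpRel (z.lab i.succ) (z.lab i.castSucc) → macdonald q s z =
        intertwiner q s i (z.lab i.succ) (z.lab i.castSucc) (macdonald q s (z.sw i)) :=
    fun z hz i hi => (U z hz _ (isMacdonald_of_sw hi (isMacdonald_macdonald q s _))).symm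
  have rel2 : ∀ z : Vertex n lam, z.affine.Smaller y →
      macdonald q s z.affine = raising s (macdonald q s z) :=
    fun z hz => (U _ hz _ (IsMacdonald.affine z _ (isMacdonald_macdonald q s z))).symm
  -- two exchanges at distant positions
  have far : ∀ i j : Fin n, (i : ℕ) + 2 ≤ j → UpRel (y.lab i.succ) (y.lab i.castSucc) →
      UpRel (y.lab j.succ) (y.lab j.castSucc) →
      intertwiner q s i (y.lab i.succ) (y.lab i.castSucc) (macdonald q s (y.sw i)) =
      intertwiner q s j (y.lab j.succ) (y.lab j.castSucc) (macdonald q s (y.sw j)) := by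
    intro i j hij hi hj
    obtain ⟨e, ⟨e1, e2⟩, e3, e4⟩ := Vertex.sw_comm hij hi hj
    rw [rel1 _ (Vertex.smaller_sw hi) j (by rwa [e1, e2]),
      rel1 _ (Vertex.smaller_sw hj) i (by rwa [e3, e4]), e1, e2, e3, e4, e,
      intertwiner_comm h hij]
  -- two exchanges at neighbouring positions
  have near : ∀ i j : Fin n, (j : ℕ) = i + 1 → UpRel (y.lab i.succ) (y.lab i.castSucc) →
      UpRel (y.lab j.succ) (y.lab j.castSucc) →
      intertwiner q s i (y.lab i.succ) (y.lab i.castSucc) (macdonald q s (y.sw i)) =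
      intertwiner q s j (y.lab j.succ) (y.lab j.castSucc) (macdonald q s (y.sw j)) := by
    intro i j hij hi' hj
    have hs : i.succ = j.castSucc := by ext; simp [hij]
    have hi : UpRel (y.lab j.castSucc) (y.lab i.castSucc) := hs ▸ hi'
    obtain ⟨a1, a2, a3⟩ := Vertex.sw_sw_lab hij hi'
    have h2 : UpRel ((y.sw i).lab j.succ) ((y.sw i).lab j.castSucc) := by
      rw [a2, a3]; exact hj.trans hi
    obtain ⟨b1, b2, b3⟩ := Vertex.sw_sw_lab' hij h2
    have h3 : UpRel (((y.sw i).sw j).lab i.succ) (((y.sw i).sw j).lab i.castSucc) := by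
      rw [hs, b1, b2, a1, a3]; exact hj
    obtain ⟨c1, c2, c3⟩ := Vertex.sw_sw_lab' hij hj
    have h4 : UpRel ((y.sw j).lab i.succ) ((y.sw j).lab i.castSucc) := by
      rw [hs, c1, c2]; exact hj.trans hi
    obtain ⟨d1, d2, d3⟩ := Vertex.sw_sw_lab hij h4
    have h5 : UpRel (((y.sw j).sw i).lab j.succ) (((y.sw j).sw i).lab j.castSucc) := by
      rw [d2, d3, c1, c3]; exact hi
    have s2 := Vertex.smaller_sw hi'
    have s3 := Vertex.smaller_sw hj
    rw [rel1 _ s2 j h2, rel1 _ ((Vertex.smaller_sw h2).trans s2) i h3,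
      rel1 _ s3 i h4, rel1 _ ((Vertex.smaller_sw h4).trans s3) j h5, hs, a2, a3, b1, b2, a1, a3,
      c1, c2, d2, d3, c1, c3, Vertex.sw_braid hij hi hj]
    exact intertwiner_braid h hij (hj.spec_div_ne h) ((hj.trans hi).spec_div_ne h)
      (hi.spec_div_ne h) _
  -- an exchange and an affine arrow; at the last position two affine arrows can be undone
  have aff : ∀ x : Vertex n lam, y = x.affine → ∀ i : Fin n,
      UpRel (y.lab i.succ) (y.lab i.castSucc) → raising s (macdonald q s x) =
      intertwiner q s i (y.lab i.succ) (y.lab i.castSucc) (macdonald q s (y.sw i)) := by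
    rintro x rfl i hi
    have hx := x.smaller_affine
    by_cases hin : (i : ℕ) + 1 < n
    · obtain ⟨j, hij⟩ : ∃ j : Fin n, (j : ℕ) = i + 1 := ⟨⟨i + 1, hin⟩, rfl⟩
      have hs : i.succ = j.castSucc := by ext; simp [hij]
      have e1 : x.affine.lab i.succ = x.lab j.succ := by rw [hs, Vertex.affine_lab_castSucc]
      have e2 : x.affine.lab i.castSucc = x.lab j.castSucc := by
        rw [Vertex.affine_lab_castSucc, hs]
      rw [e1, e2] at hi ⊢
      obtain ⟨k1, k2⟩ := Vertex.affine_sw hij hi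
      have hsm : (x.sw j).affine.Smaller x.affine := k1 ▸ Vertex.smaller_sw k2
      rw [rel1 x hx j hi, k1, rel2 _ hsm, intertwiner_raising h hij]
    · obtain ⟨m, rfl⟩ : ∃ m, n = m + 1 := ⟨i, by omega⟩
      obtain rfl : i = Fin.last m := by ext; simp; omega
      have hlast : x.vec (Fin.last (m + 1)) ≠ 0 := by
        rw [Fin.succ_last, Vertex.affine_lab_last, Vertex.affine_lab_castSucc, Fin.succ_last] at hi
        have : x.vec 0 + 1 < x.vec (Fin.last (m + 1)) ∨ x.vec 0 + 1 = x.vec (Fin.last (m + 1)) :=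
          hi.imp id And.left
        omega
      obtain ⟨z, rfl⟩ := Vertex.exists_affine hlast
      obtain ⟨e1, e2, -⟩ := z.affine_affine_lab
      rw [Fin.succ_last, e1, e2, UpRel.up_iff] at hi
      rw [Fin.succ_last, e1, e2]
      obtain ⟨k1, k2⟩ := Vertex.affine_affine_sw hi
      have hsm : (z.sw 0).affine.affine.Smaller z.affine.affine := k1 ▸ Vertex.smaller_sw k2
      rw [k1, rel2 _ hsm, rel2 _ ((Vertex.smaller_affine _).trans hsm), rel2 z hx,
        rel1 z (z.smaller_affine.trans hx) 0 hi]
      exact (intertwiner_raising_raising h (by simp) (by simp) _ _ _).symm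
  -- the root of the graph has no predecessor
  have root : ∀ A : RST n lam, A.IsColumnReading → y = ⟨A, 0⟩ →
      (∀ i : Fin n, ¬ UpRel (y.lab i.succ) (y.lab i.castSucc)) ∧
      ∀ x : Vertex n lam, y ≠ x.affine := by
    rintro A hA rfl
    constructor
    · intro i hi
      rw [Vertex.lab_zero, Vertex.lab_zero] at hi
      exact (RST.isColumnReading_iff A).1 hA i (hi.resolve_left (lt_irrefl _)).2
    · intro x hx
      have := congrArg (fun z => z.vec (Fin.last n)) hx
      simp [Vertex.affine_vec_last] at this
  have swaps : ∀ i j : Fin n, UpRel (y.lab i.succ) (y.lab i.castSucc) →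
      UpRel (y.lab j.succ) (y.lab j.castSucc) →
      intertwiner q s i (y.lab i.succ) (y.lab i.castSucc) (macdonald q s (y.sw i)) =
      intertwiner q s j (y.lab j.succ) (y.lab j.castSucc) (macdonald q s (y.sw j)) := by
    intro i j hi hj
    rcases lt_trichotomy (i : ℕ) j with hlt | heq | hlt
    · rcases (show (i : ℕ) + 1 ≤ j from hlt).eq_or_lt with h' | h'
      · exact near i j h'.symm hi hj
      · exact far i j h' hi hj
    · rw [Fin.ext heq]
    · rcases (show (j : ℕ) + 1 ≤ i from hlt).eq_or_lt with h' | h'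
      · exact (near j i h'.symm hj hi).symm
      · exact (far j i h' hj hi).symm
  rcases hP.cases_vertex with ⟨A, hA, e, rfl⟩ | ⟨i, Q, hi, hQ, rfl⟩ | ⟨x, Q, e, hQ, rfl⟩
  · rcases hP'.cases_vertex with ⟨B, hB, e', rfl⟩ | ⟨j, Q', hj, hQ', rfl⟩ | ⟨x', Q', e', hQ', rfl⟩
    · rw [e, Vertex.mk.injEq] at e'
      rw [e'.1]
    · exact absurd hj ((root A hA e).1 j)
    · exact absurd e' ((root A hA e).2 x')
  · rw [U _ (Vertex.smaller_sw hi) Q hQ]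
    rcases hP'.cases_vertex with ⟨B, hB, e', rfl⟩ | ⟨j, Q', hj, hQ', rfl⟩ | ⟨x', Q', e', hQ', rfl⟩
    · exact absurd hi ((root B hB e').1 i)
    · rw [U _ (Vertex.smaller_sw hj) Q' hQ']
      exact swaps i j hi hj
    · rw [U x' (e' ▸ x'.smaller_affine) Q' hQ']
      exact (aff x' e' i hi).symm
  · rw [U x (e ▸ x.smaller_affine) Q hQ]
    rcases hP'.cases_vertex with ⟨B, hB, e', rfl⟩ | ⟨j, Q', hj, hQ', rfl⟩ | ⟨x', Q', e', hQ', rfl⟩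
    · exact absurd e ((root B hB e').2 x)
    · rw [U _ (Vertex.smaller_sw hj) Q' hQ']
      exact aff x e j hj
    · rw [U x' (e' ▸ x'.smaller_affine) Q' hQ', Vertex.affine_injective (e.symm.trans e')]

theorem macdonald_of_sw {q s : K} (h : Generic q s) {y : Vertex n lam} {i : Fin n}
    (hi : UpRel (y.lab i.succ) (y.lab i.castSucc)) : macdonald q s y =
      intertwiner q s i (y.lab i.succ) (y.lab i.castSucc) (macdonald q s (y.sw i)) :=
  (isMacdonald_macdonald q s y).unique h (isMacdonald_of_sw hi (isMacdonald_macdonald q s _))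

theorem macdonald_sw {q s : K} (h : Generic q s) {x : Vertex n lam} {i : Fin n}
    (hi : UpRel (x.lab i.castSucc) (x.lab i.succ)) : macdonald q s (x.sw i) =
      intertwiner q s i (x.lab i.castSucc) (x.lab i.succ) (macdonald q s x) := by
  have e1 := Vertex.sw_lab (Or.inl hi) i.castSucc
  have e2 := Vertex.sw_lab (Or.inl hi) i.succ
  rw [Equiv.swap_apply_left] at e1
  rw [Equiv.swap_apply_right] at e2
  have := macdonald_of_sw h (y := x.sw i) (i := i) (by rwa [e1, e2])
  rwa [e1, e2, Vertex.sw_sw (Or.inl hi)] at this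

theorem macdonald_affine {q s : K} (h : Generic q s) (x : Vertex n lam) :
    macdonald q s x.affine = raising s (macdonald q s x) :=
  (isMacdonald_macdonald q s _).unique h
    (IsMacdonald.affine x _ (isMacdonald_macdonald q s x))

/-- At the vertices with vanishing multi-index the Macdonald polynomials are the tableaux. -/
theorem macdonald_zero {q s : K} (h : Generic q s) (A : RST n lam) :
    macdonald q s ⟨A, 0⟩ = 1 ⊗ₜ Finsupp.single A 1 := by
  obtain ⟨y, hy⟩ : ∃ y : Vertex n lam, y = ⟨A, 0⟩ := ⟨_, rfl⟩
  rw [← hy]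
  induction y using Vertex.graph_induction generalizing A with
  | h y ih =>
  rcases y.predecessor with ⟨B, hB, e⟩ | ⟨i, hi⟩ | ⟨x, e⟩
  · obtain rfl : A = B := by rw [e, Vertex.mk.injEq] at hy; exact hy.1.symm
    exact (isMacdonald_macdonald q s y).unique h (e ▸ IsMacdonald.root A hB)
  · have hab : ((i.succ : Fin (n + 1)) : ℕ) = i.castSucc + 1 := by simp
    have hsm := Vertex.smaller_sw hi
    have hlab : ∀ k, y.lab k = (0, A.cell k) := fun k => by rw [hy, Vertex.lab_zero]
    have hct : A.ct i.castSucc + 2 ≤ A.ct i.succ := by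
      rw [hlab, hlab] at hi
      exact (hi.resolve_left (lt_irrefl _)).2
    have esw : y.sw i = ⟨A.exch i.castSucc i.succ, 0⟩ := by
      rw [hy]; simp [Vertex.sw, rank_zero]
    rw [macdonald_of_sw h hi, ih _ hsm _ esw, intertwiner_apply, bT_one_tmul,
      tabT_single h.nonRoot, A.exch_exch hab (by omega), A.exch_ct hab (by omega),
      A.exch_ct hab (by omega), Equiv.swap_apply_left, Equiv.swap_apply_right,
      ← TensorProduct.tmul_smul, ← TensorProduct.tmul_add]
    congr 1
    rw [tabOff, if_pos (by omega), one_smul, add_right_comm, ← add_smul]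
    have hz : arrowConst q s (y.lab i.succ) (y.lab i.castSucc) =
        - tabDiag s (A.ct i.castSucc - A.ct i.succ) := by
      rw [hlab, hlab, arrowConst, Label.spec, Label.spec, Label.ct_mk_cell, Label.ct_mk_cell,
        tabDiag, pow_zero, one_mul, one_mul, ← zpow_sub₀ h.s_ne_zero]
      ring
    rw [hz, add_neg_cancel, zero_smul, zero_add]
  · have := congrArg (fun z => z.vec (Fin.last n)) (hy.symm.trans e)
    simp [Vertex.affine_vec_last] at this

/-! ### The action of the Hecke generators on the Macdonald polynomials -/

/-- The labels have the same value and lie in cells of neighbouring diagonals. At adjacent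
positions of a vertex this means that the cells are adjacent, so that there is no arrow. -/
def AdjRel (l l' : Label lam) : Prop := l.1 = l'.1 ∧ (l'.ct = l.ct + 1 ∨ l.ct = l'.ct + 1)

theorem AdjRel.up_iff {l l' : Label lam} : AdjRel l.up l'.up ↔ AdjRel l l' := by
  unfold AdjRel Label.up Label.ct; simp

theorem AdjRel.spec_div_ne {q s : K} (h : Generic q s) {l l' : Label lam} (hl : AdjRel l l') :
    1 - l'.spec q s / l.spec q s ≠ 0 :=
  Label.spec_div_ne h fun e => by unfold AdjRel at hl; omega

theorem Vertex.lab_cases (x : Vertex n lam) (i : Fin n) :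
    UpRel (x.lab i.castSucc) (x.lab i.succ) ∨ UpRel (x.lab i.succ) (x.lab i.castSucc) ∨
      AdjRel (x.lab i.castSucc) (x.lab i.succ) := by
  unfold UpRel AdjRel
  rcases lt_trichotomy (x.vec i.castSucc) (x.vec i.succ) with h | h | h
  · exact Or.inl (Or.inl h)
  · have e : (x.lab i.castSucc).1 = (x.lab i.succ).1 := h
    have c : (x.lab i.succ).ct - (x.lab i.castSucc).ct = -1 ∨
        (x.lab i.succ).ct - (x.lab i.castSucc).ct = 1 ∨
        (x.lab i.succ).ct - (x.lab i.castSucc).ct ≤ -2 ∨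
        2 ≤ (x.lab i.succ).ct - (x.lab i.castSucc).ct := by
      rcases x.tab.consecutive_cases (rank_succ_of_eq h) with h' | h' | h' | h'
      · exact Or.inl h'.1
      · exact Or.inr (Or.inl h'.1)
      · exact Or.inr (Or.inr (Or.inl h'.1))
      · exact Or.inr (Or.inr (Or.inr h'.1))
    omega
  · exact Or.inr (Or.inl (Or.inl h))

/-- At a position where no exchange is possible the Macdonald polynomial is an eigenvector of
`𝐓_i`. The relation holds by definition for tableaux, and it is transported along the arrows and the
affine arrows by the Yang-Baxter equation. -/
theorem intertwiner_adj {q s : K} (h : Generic q s) (y : Vertex n lam) {i : Fin n}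
    (hi : AdjRel (y.lab i.castSucc) (y.lab i.succ)) :
    intertwiner q s i (y.lab i.castSucc) (y.lab i.succ) (macdonald q s y) = 0 := by
  induction y using Vertex.graph_induction generalizing i with
  | h y ih =>
  -- If the last value is positive, then an affine arrow can be undone, or two of them at the last
  -- position. Otherwise a descent of the values can be exchanged, and without descents all values
  -- vanish.
  by_cases h0 : y.vec (Fin.last n) = 0
  swap
  · obtain ⟨x, rfl⟩ := Vertex.exists_affine h0
    rw [macdonald_affine h]
    by_cases hin : (i : ℕ) + 1 < n
    · obtain ⟨j, hij⟩ : ∃ j : Fin n, (j : ℕ) = i + 1 := ⟨⟨i + 1, hin⟩, rfl⟩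
      have hs : i.succ = j.castSucc := by ext; simp [hij]
      have e1 : x.affine.lab i.succ = x.lab j.succ := by rw [hs, Vertex.affine_lab_castSucc]
      have e2 : x.affine.lab i.castSucc = x.lab j.castSucc := by
        rw [Vertex.affine_lab_castSucc, hs]
      rw [e1, e2] at hi ⊢
      rw [intertwiner_raising h hij, ih x x.smaller_affine hi, map_zero]
    · obtain ⟨m, rfl⟩ : ∃ m, n = m + 1 := ⟨i, by omega⟩
      obtain rfl : i = Fin.last m := by ext; simp; omega
      have hlast : x.vec (Fin.last (m + 1)) ≠ 0 := by
        rw [Fin.succ_last, Vertex.affine_lab_last, Vertex.affine_lab_castSucc, Fin.succ_last] at hi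
        have : x.vec (Fin.last (m + 1)) = x.vec 0 + 1 := hi.1
        omega
      obtain ⟨z, rfl⟩ := Vertex.exists_affine hlast
      obtain ⟨e1, e2, -⟩ := z.affine_affine_lab
      rw [Fin.succ_last, e1, e2, AdjRel.up_iff] at hi
      rw [Fin.succ_last, e1, e2, macdonald_affine h,
        intertwiner_raising_raising h (j := 0) (by simp) (by simp)]
      have := ih z (z.smaller_affine.trans (Vertex.smaller_affine _)) (i := 0) hi
      exact (congrArg (fun P => raising s (raising s P)) this).trans (by simp)
  by_cases hdesc : ∃ j : Fin n, y.vec j.succ < y.vec j.castSucc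
  · obtain ⟨j, hj⟩ := hdesc
    have hji : j ≠ i := by
      rintro rfl
      have : y.vec j.castSucc = y.vec j.succ := hi.1
      omega
    have hd : UpRel (y.lab j.succ) (y.lab j.castSucc) := Or.inl hj
    have hne : ∀ k l : Fin (n + 1), y.vec k ≠ y.vec l →
        1 - (y.lab l).spec q s / (y.lab k).spec q s ≠ 0 := fun k l hkl =>
      Label.spec_div_ne h fun e => absurd e hkl
    have hvi : y.vec i.castSucc = y.vec i.succ := hi.1
    rcases lt_trichotomy ((i : ℕ) + 1) j with hlt | heq | hlt
    · rw [macdonald_of_sw h hd, intertwiner_comm h (by omega)]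
      have n1 : i.castSucc ≠ j.castSucc := by simp [Fin.ext_iff]; omega
      have n2 : i.castSucc ≠ j.succ := by simp [Fin.ext_iff]; omega
      have n3 : i.succ ≠ j.castSucc := by simp [Fin.ext_iff]; omega
      have n4 : i.succ ≠ j.succ := by simp [Fin.ext_iff]; omega
      have e3 : (y.sw j).lab i.succ = y.lab i.succ := by
        rw [Vertex.sw_lab (Or.inr hd), Equiv.swap_apply_of_ne_of_ne n3 n4]
      have e4 : (y.sw j).lab i.castSucc = y.lab i.castSucc := by
        rw [Vertex.sw_lab (Or.inr hd), Equiv.swap_apply_of_ne_of_ne n1 n2]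
      have := ih _ (Vertex.smaller_sw hd) (i := i) (by rwa [e3, e4])
      rw [e3, e4] at this
      rw [this, map_zero]
    · have hs : i.succ = j.castSucc := by ext; simp [heq]
      obtain ⟨c1, c2, c3⟩ := Vertex.sw_sw_lab' heq.symm hd
      have hj' : y.vec j.succ < y.vec i.castSucc := by rw [hvi, hs]; exact hj
      have h4 : UpRel ((y.sw j).lab i.succ) ((y.sw j).lab i.castSucc) := by
        rw [hs, c1, c2]; exact Or.inl hj'
      obtain ⟨d1, d2, d3⟩ := Vertex.sw_sw_lab heq.symm h4
      have hz := ih _ ((Vertex.smaller_sw h4).trans (Vertex.smaller_sw hd)) (i := j) (by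
        rw [d2, d3, c1, c3, ← hs]; exact hi)
      rw [d2, d3, c1, c3] at hz
      rw [macdonald_of_sw h hd, macdonald_of_sw h h4, hs, c1, c2,
        intertwiner_braid h heq.symm (hne _ _ hj'.ne) (hne _ _ hj.ne)
          (hs ▸ hi.spec_div_ne h), hz, map_zero, map_zero]
    · rcases (show (j : ℕ) ≤ i by omega).eq_or_lt with h' | h'
      · exact absurd (Fin.ext h') hji
      rcases (show (j : ℕ) + 1 ≤ i from h').eq_or_lt with h' | h'
      · have hs : j.succ = i.castSucc := by ext; simp [h']
        obtain ⟨a1, a2, a3⟩ := Vertex.sw_sw_lab h'.symm hd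
        have hj' : y.vec i.succ < y.vec j.castSucc := by rw [← hvi, ← hs]; exact hj
        have h2 : UpRel ((y.sw j).lab i.succ) ((y.sw j).lab i.castSucc) := by
          rw [a2, a3]; exact Or.inl hj'
        obtain ⟨b1, b2, b3⟩ := Vertex.sw_sw_lab' h'.symm h2
        have hz := ih _ ((Vertex.smaller_sw h2).trans (Vertex.smaller_sw hd)) (i := j) (by
          rw [hs, b1, b2, a1, a3]; exact hi)
        rw [hs, b1, b2, a1, a3] at hz
        rw [macdonald_of_sw h hd, macdonald_of_sw h h2, hs, a2, a3,
          ← intertwiner_braid h h'.symm (hi.spec_div_ne h) (hne _ _ (hs ▸ hj.ne))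
            (hne _ _ hj'.ne), hz, map_zero, map_zero]
      · rw [macdonald_of_sw h hd, ← intertwiner_comm h h']
        have n1 : i.castSucc ≠ j.castSucc := by simp [Fin.ext_iff]; omega
        have n2 : i.castSucc ≠ j.succ := by simp [Fin.ext_iff]; omega
        have n3 : i.succ ≠ j.castSucc := by simp [Fin.ext_iff]; omega
        have n4 : i.succ ≠ j.succ := by simp [Fin.ext_iff]; omega
        have e3 : (y.sw j).lab i.succ = y.lab i.succ := by
          rw [Vertex.sw_lab (Or.inr hd), Equiv.swap_apply_of_ne_of_ne n3 n4]
        have e4 : (y.sw j).lab i.castSucc = y.lab i.castSucc := by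
          rw [Vertex.sw_lab (Or.inr hd), Equiv.swap_apply_of_ne_of_ne n1 n2]
        have := ih _ (Vertex.smaller_sw hd) (i := i) (by rwa [e3, e4])
        rw [e3, e4] at this
        rw [this, map_zero]
  · push Not at hdesc
    have hmono : Monotone y.vec := by
      rw [Fin.monotone_iff_le_succ]
      exact hdesc
    obtain ⟨A, v⟩ := y
    -- the tableaux, on which the relation is the definition of `T_i`
    have hv : v = 0 := by
      funext k
      have := hmono (Fin.le_last k)
      simp only at this h0
      simp only [Pi.zero_apply]
      omega
    subst hv
    rw [Vertex.lab_zero, Vertex.lab_zero] at hi ⊢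
    have hct : A.ct i.succ = A.ct i.castSucc + 1 ∨ A.ct i.castSucc = A.ct i.succ + 1 := hi.2
    rw [macdonald_zero h, intertwiner_apply, bT_one_tmul, tabT_single h.nonRoot,
      tabOff_eq_zero s (by omega), zero_smul, add_zero, TensorProduct.tmul_smul, ← add_smul]
    have hz : arrowConst q s (0, A.cell i.castSucc) (0, A.cell i.succ) =
        - tabDiag s (A.ct i.succ - A.ct i.castSucc) := by
      rw [arrowConst, Label.spec, Label.spec, Label.ct_mk_cell, Label.ct_mk_cell,
        tabDiag, pow_zero, one_mul, one_mul, ← zpow_sub₀ h.s_ne_zero]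
      ring
    rw [hz, add_neg_cancel, zero_smul]

theorem bT_macdonald_of_up {q s : K} (h : Generic q s) {x : Vertex n lam} {i : Fin n}
    (hi : UpRel (x.lab i.castSucc) (x.lab i.succ)) : bT s i (macdonald q s x) =
      macdonald q s (x.sw i) -
        arrowConst q s (x.lab i.castSucc) (x.lab i.succ) • macdonald q s x := by
  rw [macdonald_sw h hi, intertwiner_apply, add_sub_cancel_right]

theorem bT_macdonald_of_down {q s : K} (h : Generic q s) {x : Vertex n lam} {i : Fin n}
    (hi : UpRel (x.lab i.succ) (x.lab i.castSucc)) : bT s i (macdonald q s x) =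
      (s - 1 + arrowConst q s (x.lab i.succ) (x.lab i.castSucc)) • macdonald q s x +
      (s - arrowConst q s (x.lab i.succ) (x.lab i.castSucc) *
        (s - 1 + arrowConst q s (x.lab i.succ) (x.lab i.castSucc))) • macdonald q s (x.sw i) := by
  rw [macdonald_of_sw h hi, intertwiner_apply, map_add, map_smul, bT_quadratic h.nonRoot]
  module

theorem bT_macdonald_of_adj {q s : K} (h : Generic q s) {x : Vertex n lam} {i : Fin n}
    (hi : AdjRel (x.lab i.castSucc) (x.lab i.succ)) : bT s i (macdonald q s x) =
      -(arrowConst q s (x.lab i.castSucc) (x.lab i.succ) • macdonald q s x) := by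
  have := intertwiner_adj h x hi
  rw [intertwiner_apply] at this
  exact eq_neg_of_add_eq_zero_left this

/-! ### The Macdonald polynomials span -/

theorem bTinv_bT {s : K} (hs : NonRoot s) (i : Fin n) (v : VVPoly K n lam) :
    bTinv s i (bT s i v) = v := by
  have h := (isDoubleAffine (n := n) (lam := lam) hs 1).inv_mul i.isLt
  rw [heckeInv_bT, natFam_val] at h
  exact congrArg (fun f => f v) h

theorem bT_bTinv {s : K} (hs : NonRoot s) (i : Fin n) (v : VVPoly K n lam) :
    bT s i (bTinv s i v) = v := by
  have h := (isDoubleAffine (n := n) (lam := lam) hs 1).mul_inv i.isLt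
  rw [heckeInv_bT, natFam_val] at h
  exact congrArg (fun f => f v) h

/-- The span of the Macdonald polynomials contains the tableaux and is stable under the Hecke
generators and the raising operator, hence under multiplication by the variables. -/
theorem span_macdonald {q s : K} (h : Generic q s) :
    Submodule.span K (Set.range (macdonald q s : Vertex n lam → _)) = ⊤ := by
  set S := Submodule.span K (Set.range (macdonald q s : Vertex n lam → _)) with hS
  have mem : ∀ x, macdonald q s x ∈ S := fun x => Submodule.subset_span ⟨x, rfl⟩
  have stab : ∀ f : Module.End K (VVPoly K n lam), (∀ x, f (macdonald q s x) ∈ S) →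
      ∀ v ∈ S, f v ∈ S := by
    intro f hf v hv
    have : S ≤ S.comap f := Submodule.span_le.2 (by rintro _ ⟨x, rfl⟩; exact hf x)
    exact this hv
  have hT : ∀ i, ∀ v ∈ S, bT s i v ∈ S := by
    intro i
    refine stab _ fun x => ?_
    rcases x.lab_cases i with hi | hi | hi
    · rw [bT_macdonald_of_up h hi]
      exact S.sub_mem (mem _) (S.smul_mem _ (mem _))
    · rw [bT_macdonald_of_down h hi]
      exact S.add_mem (S.smul_mem _ (mem _)) (S.smul_mem _ (mem _))
    · rw [bT_macdonald_of_adj h hi]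
      exact S.neg_mem (S.smul_mem _ (mem _))
  have hΦ : ∀ v ∈ S, raising s v ∈ S :=
    stab _ fun x => by rw [← macdonald_affine h]; exact mem _
  have hTi : ∀ i, ∀ v ∈ S, bTinv s i v ∈ S := fun i v hv => by
    rw [bTinv_apply]
    exact S.smul_mem _ (S.add_mem (hT i v hv) (S.smul_mem _ hv))
  have hup : ∀ k ≤ n, ∀ v ∈ S,
      upProd (natFam fun i => (bT s i : Module.End K (VVPoly K n lam))) k v ∈ S := by
    intro k
    induction k with
    | zero => intro _ v hv; exact hv
    | succ k ih =>
      intro hk v hv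
      rw [upProd, natFam_of_lt _ (show k < n by omega)]
      exact ih (by omega) _ (hT _ _ hv)
  -- the last variable is `Φ` times the inverse of a product of Hecke generators, and the other
  -- variables are obtained from it by the relation between `𝐓_i` and the variables
  have hX : ∀ j, ∀ v ∈ S, mulX j v ∈ S := by
    intro j
    induction j using Fin.reverseInduction with
    | last =>
      intro v hv
      have H := isDoubleAffine (n := n) (lam := lam) h.nonRoot 1
      have e : (mulX (Fin.last n) : Module.End K (VVPoly K n lam)) =
          raising s * upProd (natFam fun i => bT s i) n := by
        rw [raising_eq, phi, mul_assoc, downProd_mul_upProd (fun i hi => H.inv_mul hi) n le_rfl,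
          mul_one, natFam_of_lt _ (Nat.lt_succ_self n)]
        rfl
      rw [e]
      exact hΦ _ (hup n le_rfl v hv)
    | cast i ih =>
      intro v hv
      have := bT_mulX_castSucc s i v
      have e : mulX i.castSucc v =
          bTinv s i (mulX i.succ (bT s i v) + (1 - s) • mulX i.succ v) := by
        rw [← this, bTinv_bT h.nonRoot]
      rw [e]
      exact hTi i _ (S.add_mem (ih _ (hT i v hv)) (S.smul_mem _ (ih v hv)))
  rw [eq_top_iff]
  rintro v -
  induction v using vv_induction with
  | hone u =>
    induction u using Finsupp.induction_linear with
    | zero => simp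
    | add u w hu hw => rw [TensorProduct.tmul_add]; exact S.add_mem hu hw
    | single A c =>
      rw [← mul_one c, ← smul_eq_mul, ← Finsupp.smul_single, TensorProduct.tmul_smul,
        ← macdonald_zero h]
      exact S.smul_mem _ (mem _)
  | hadd v w hv hw => exact S.add_mem hv hw
  | hX j v hv => exact hX j v hv

theorem end_ext_macdonald {q s : K} (h : Generic q s) {f g : Module.End K (VVPoly K n lam)}
    (hfg : ∀ x, f (macdonald q s x) = g (macdonald q s x)) : f = g :=
  LinearMap.ext_on_range (span_macdonald h) hfg

/-! ### The spectral vectors -/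

/-- The Cherednik operators `Ξ_i`. -/
def cherednik (q s : K) (j : ℕ) : Module.End K (VVPoly K n lam) :=
  desc s n (natFam fun i => bT s i) (cherednikLast q s) j

theorem cherednikLast_one_tmul {s : K} (hs : NonRoot s) (q : K) (u : RST n lam →₀ K) :
    cherednikLast q s (1 ⊗ₜ u) = 1 ⊗ₜ u := by
  have H := isHecke_tabT (n := n) (lam := lam) hs
  have hup : ∀ k ≤ n, ∀ u : RST n lam →₀ K,
      upProd (heckeInv s (natFam fun i => (bT s i : Module.End K (VVPoly K n lam)))) k
        (1 ⊗ₜ u) = 1 ⊗ₜ upProd (heckeInv s (natFam fun i => tabT s i)) k u := by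
    intro k
    induction k with
    | zero => intro _ u; rfl
    | succ k ih =>
      intro hk u
      have e := heckeInv_bT (lam := lam) s ⟨k, hk⟩
      simp only at e
      rw [upProd, upProd, e, Module.End.mul_apply, Module.End.mul_apply, ← ih (by omega),
        bTinv_apply, bT_one_tmul, heckeInv, natFam_of_lt _ hk]
      simp [TensorProduct.tmul_add]
  rw [cherednikLast_eq, xiLast, Module.End.mul_apply, hup n le_rfl, bw_tmul, map_one, tabS_eq]
  congr 1
  have := downProd_mul_upProd (fun i hi => H.mul_inv (i := i) hi) n le_rfl
  exact congrArg (fun f => f u) this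

theorem RST.ct_last (A : RST n lam) : A.ct (Fin.last n) = 0 := by
  obtain ⟨m, h1, h2⟩ := A.mem_of_le (Fin.last n) (Nat.zero_le _) (Nat.zero_le _)
  by_cases hm : m = Fin.last n
  · subst hm; simp [RST.ct, h1, h2]
  · have := A.entry_lt (k := m) (l := Fin.last n) (by omega) (by omega) hm
    exact absurd (Fin.le_last m) (not_le.2 this)

/-- The tableaux are eigenvectors of the Jucys-Murphy elements. -/
theorem cherednik_tableau {s : K} (hs : NonRoot s) (q : K) (j : Fin (n + 1)) (A : RST n lam) :
    cherednik q s j (1 ⊗ₜ Finsupp.single A 1 : VVPoly K n lam) =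
      s ^ A.ct j • (1 ⊗ₜ Finsupp.single A 1) := by
  induction j using Fin.reverseInduction generalizing A with
  | last =>
    rw [A.ct_last, zpow_zero, one_smul, cherednik, Fin.val_last, desc_last,
      cherednikLast_one_tmul hs]
  | cast i ih =>
    have hab : ((i.succ : Fin (n + 1)) : ℕ) = i.castSucc + 1 := by simp
    have e : (cherednik q s i.castSucc : Module.End K (VVPoly K n lam)) =
        s⁻¹ • (bT s i * cherednik q s i.succ * bT s i) := by
      rw [cherednik, Fin.val_castSucc, desc_of_lt s _ _ i.isLt, natFam_val]
      rfl
    have hm0 := A.ct_ne hab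
    obtain ⟨m, hm⟩ : ∃ m, A.ct i.succ - A.ct i.castSucc = m := ⟨_, rfl⟩
    have hx : A.ct i.succ = A.ct i.castSucc + m := by omega
    -- the two terms of `T_i A`
    have e2 : cherednik q s i.succ (1 ⊗ₜ (tabOff s m •
        Finsupp.single (A.exch i.castSucc i.succ) 1) : VVPoly K n lam) = s ^ A.ct i.castSucc •
          (1 ⊗ₜ (tabOff s m • Finsupp.single (A.exch i.castSucc i.succ) 1)) := by
      by_cases h : m ≤ -2 ∨ 2 ≤ m
      · rw [TensorProduct.tmul_smul, map_smul, ih, A.exch_ct hab (by omega),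
          Equiv.swap_apply_right, smul_comm]
      · rw [tabOff_eq_zero s h]; simp
    rw [e, LinearMap.smul_apply, Module.End.mul_apply, Module.End.mul_apply, bT_one_tmul,
      tabT_single hs, hm, TensorProduct.tmul_add, map_add, e2, TensorProduct.tmul_smul, map_smul,
      ih, map_add, map_smul, map_smul, map_smul, bT_one_tmul, bT_one_tmul, tabT_exch hs i A hm,
      tabT_single hs, hm]
    rw [hm] at hm0
    simp only [TensorProduct.tmul_add, TensorProduct.tmul_smul]
    rw [hx, tabProd_eq hs hm0, tabDiag_neg hs hm0, zpow_add₀ hs.ne_zero]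
    have hk : tabDiag s m * s ^ m = tabDiag s m + 1 - s := by
      have := hs.one_sub_zpow hm0
      unfold tabDiag
      field_simp
      ring
    have hs0 := hs.ne_zero
    generalize (1 ⊗ₜ[K] Finsupp.single A 1 : VVPoly K n lam) = a
    generalize (1 ⊗ₜ[K] Finsupp.single (A.exch i.castSucc i.succ) 1 : VVPoly K n lam) = b
    generalize tabDiag s m = d at *
    generalize tabOff s m = o at *
    generalize s ^ m = w at *
    generalize s ^ A.ct i.castSucc = c at *
    -- the coefficients of `A` and of the exchanged tableau in `s⁻¹ T_i Ξ_{i+1} T_i A`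
    have k1 : d * (c * w) = c * (d + 1 - s) := by rw [← hk]; ring
    have k2 : s⁻¹ * (d * (c * w) * d) + s⁻¹ * (c * ((s - d) * (1 + d))) = c := by
      rw [k1]; field_simp; ring
    have k3 : s⁻¹ * (d * (c * w) * o) + s⁻¹ * (c * ((s - 1 - d) * o)) = 0 := by
      rw [k1]; field_simp; ring
    trans (s⁻¹ * (d * (c * w) * d) + s⁻¹ * (c * ((s - d) * (1 + d)))) • a +
      (s⁻¹ * (d * (c * w) * o) + s⁻¹ * (c * ((s - 1 - d) * o))) • b
    · module
    · rw [k2, k3, zero_smul, add_zero]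

/-- The operators `𝐓_i`, with natural numbers as indices. -/
abbrev bTFam (n : ℕ) (lam : YoungDiagram) (s : K) : ℕ → Module.End K (VVPoly K n lam) :=
  natFam fun i => bT s i

theorem cherednik_bT_of_ne {s : K} (hs : NonRoot s) (q : K) {i : Fin n} {j : Fin (n + 1)}
    (h1 : j ≠ i.castSucc) (h2 : j ≠ i.succ) (v : VVPoly K n lam) :
    cherednik q s j (bT s i v) = bT s i (cherednik q s j v) := by
  have H := isDoubleAffine (n := n) (lam := lam) hs q
  have := H.T_desc_comm (E := cherednikLast q s)
    (fun i hi => by rw [cherednikLast_eq]; exact H.T_mul_xi hi) (Nat.lt_succ_iff.1 j.isLt) i.isLt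
    (fun e => h1 (Fin.ext e.symm)) (fun e => h2 (Fin.ext (by simp [← e])))
  rw [natFam_val] at this
  exact (congrArg (fun f => f v) this).symm

theorem cherednik_succ_bT {s : K} (hs : NonRoot s) (q : K) (i : Fin n) (v : VVPoly K n lam) :
    cherednik q s i.succ (bT s i v) =
      bT s i (cherednik q s i.castSucc v) + (1 - s) • cherednik q s i.castSucc v := by
  have H := isDoubleAffine (n := n) (lam := lam) hs q
  have := H.desc_succ_mul_T (cherednikLast q s) i.isLt
  rw [natFam_val] at this
  exact congrArg (fun f => f v) this

theorem cherednik_castSucc_bT {s : K} (hs : NonRoot s) (q : K) (i : Fin n) (v : VVPoly K n lam) :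
    cherednik q s i.castSucc (bT s i v) =
      bT s i (cherednik q s i.succ v) - (1 - s) • cherednik q s i.castSucc v := by
  have H := isDoubleAffine (n := n) (lam := lam) hs q
  have := H.T_mul_desc_succ (cherednikLast q s) i.isLt
  rw [natFam_val] at this
  rw [eq_sub_iff_add_eq]
  exact (congrArg (fun f => f v) this).symm

theorem cherednik_castSucc_raising {s : K} (hs : NonRoot s) (q : K) (i : Fin n)
    (v : VVPoly K n lam) :
    cherednik q s i.castSucc (raising s v) = raising s (cherednik q s i.succ v) := by
  have H := isDoubleAffine (n := n) (lam := lam) hs q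
  have := H.xi_mul_phi (n - (i + 1)) i (by omega)
  rw [← raising_eq, ← cherednikLast_eq] at this
  exact congrArg (fun f => f v) this

theorem cherednik_last_raising {s : K} (hs : NonRoot s) (q : K) (v : VVPoly K n lam) :
    cherednik q s (Fin.last n) (raising s v) = q • raising s (cherednik q s 0 v) := by
  have H := isDoubleAffine (n := n) (lam := lam) hs q
  have := H.xiLast_mul_phi
  rw [← raising_eq, ← cherednikLast_eq] at this
  rw [cherednik, Fin.val_last, desc_last]
  exact congrArg (fun f => f v) this

theorem arrowConst_mul {q s : K} (h : Generic q s) {l l' : Label lam}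
    (hne : 1 - l'.spec q s / l.spec q s ≠ 0) :
    arrowConst q s l l' * (l.spec q s - l'.spec q s) = (1 - s) * l.spec q s := by
  have h0 := l.spec_ne_zero h
  have : l.spec q s - l'.spec q s = (1 - l'.spec q s / l.spec q s) * l.spec q s := by
    field_simp
  rw [arrowConst, this, ← mul_assoc, div_mul_cancel₀ _ hne]

/-- The Macdonald polynomials are simultaneous eigenvectors of the Cherednik operators. -/
theorem cherednik_macdonald {q s : K} (h : Generic q s) (x : Vertex n lam) (j : Fin (n + 1)) :
    cherednik q s j (macdonald q s x) = (x.lab j).spec q s • macdonald q s x := by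
  have hs := h.nonRoot
  induction x using Vertex.graph_induction generalizing j with
  | h x ih =>
  rcases x.predecessor with ⟨A, -, rfl⟩ | ⟨i, hi⟩ | ⟨z, rfl⟩
  · rw [macdonald_zero h, cherednik_tableau hs, Vertex.lab_zero, Label.spec, Label.ct_mk_cell,
      pow_zero, one_mul]
  · have ih' := ih _ (Vertex.smaller_sw hi)
    have hl := fun k => Vertex.sw_lab (Or.inr hi) k
    rw [macdonald_of_sw h hi, intertwiner_apply, map_add, map_smul, ih']
    have hc := arrowConst_mul h (hi.spec_div_ne h)
    by_cases h1 : j = i.castSucc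
    · subst h1
      rw [cherednik_castSucc_bT hs, ih', ih', hl, hl, Equiv.swap_apply_left,
        Equiv.swap_apply_right, map_smul]
      match_scalars
      · ring
      · linear_combination hc
    by_cases h2 : j = i.succ
    · subst h2
      rw [cherednik_succ_bT hs, ih', hl, hl, Equiv.swap_apply_left,
        Equiv.swap_apply_right, map_smul]
      match_scalars
      · ring
      · linear_combination -hc
    rw [cherednik_bT_of_ne hs q h1 h2, ih', hl, Equiv.swap_apply_of_ne_of_ne h1 h2, map_smul]
    module
  · have ih' := ih _ z.smaller_affine
    rw [macdonald_affine h]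
    induction j using Fin.lastCases with
    | last =>
      rw [cherednik_last_raising hs]
      have := ih' 0
      rw [Fin.val_zero] at this
      rw [this, map_smul, smul_smul, Vertex.affine_lab_last, Label.up_spec]
    | cast i =>
      rw [cherednik_castSucc_raising hs, ih', map_smul, Vertex.affine_lab_castSucc]

/-! ### The Dunkl operators commute -/

/-- The last Dunkl operator `𝐃_N`. -/
def dunklLast (q s : K) : Module.End K (VVPoly K n lam) := divLast * (1 - cherednikLast q s)

theorem Vertex.rank_last {v : Fin (n + 1) → ℕ} (h : v (Fin.last n) = 0) :
    rank v (Fin.last n) = Fin.last n := by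
  by_contra hne
  obtain ⟨j, hj⟩ := (rank_bijective v).2 (Fin.last n)
  have hjl : j ≠ Fin.last n := by rintro rfl; exact hne hj
  have := rank_lt (v := v) (i := j) (j := Fin.last n) (by
    unfold Before
    have := Fin.lt_last_iff_ne_last.2 hjl
    omega)
  rw [hj] at this
  exact absurd (Fin.le_last _) (not_le.2 this)

theorem Vertex.spec_last {x : Vertex n lam} (q s : K) (h : x.vec (Fin.last n) = 0) :
    (x.lab (Fin.last n)).spec q s = 1 := by
  have hc : (x.lab (Fin.last n)).ct = 0 := by
    rw [Vertex.lab_ct, Vertex.ct, Vertex.rank_last h, RST.ct_last]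
  rw [Label.spec, hc]
  simp [Vertex.lab, h]

theorem cherednikLast_macdonald {q s : K} (h : Generic q s) {x : Vertex n lam}
    (hx : x.vec (Fin.last n) = 0) : cherednikLast q s (macdonald q s x) = macdonald q s x := by
  have := cherednik_macdonald h x (Fin.last n)
  rwa [Vertex.spec_last q s hx, one_smul, cherednik, Fin.val_last, desc_last] at this

theorem dunklLast_macdonald {q s : K} (h : Generic q s) {x : Vertex n lam}
    (hx : x.vec (Fin.last n) = 0) : dunklLast q s (macdonald q s x) = 0 := by
  rw [dunklLast, Module.End.mul_apply, LinearMap.sub_apply, cherednikLast_macdonald h hx,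
    Module.End.one_apply, sub_self, map_zero]

theorem one_sub_mul_of_eq {R : Type*} [Ring R] [Algebra K R] {c : K} {a b f : R}
    (h : a * f = c • (f * b)) : (1 - a) * f = f * (1 - c • b) := by
  rw [sub_mul, one_mul, h, mul_sub, mul_one, mul_smul_comm]

theorem one_sub_mul_comm {R : Type*} [Ring R] [Algebra K R] {c : K} {a t : R}
    (h : a * t = t * a) : (1 - c • a) * t = t * (1 - c • a) := by
  rw [sub_mul, one_mul, mul_sub, mul_one, mul_smul_comm, smul_mul_assoc, h]

/-- The Dunkl operator undoes the raising operator. -/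
theorem dunklLast_mul_raising {s : K} (hs : NonRoot s) (q : K) :
    (dunklLast q s * raising s : Module.End K (VVPoly K n lam)) =
      downProd (heckeInv s (bTFam n lam s)) n * (1 - q • cherednik q s 0) := by
  have H := isDoubleAffine (n := n) (lam := lam) hs q
  have e := H.xiLast_mul_phi
  rw [← raising_eq, ← cherednikLast_eq] at e
  have e2 : (1 - cherednikLast q s) * raising s =
      (raising s : Module.End K (VVPoly K n lam)) * (1 - q • cherednik q s 0) :=
    one_sub_mul_of_eq e
  rw [dunklLast, mul_assoc, e2, raising_eq, phi, natFam_of_lt _ (Nat.lt_succ_self n),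
    mul_assoc, ← mul_assoc divLast]
  have : (divLast * mulX ⟨n, Nat.lt_succ_self n⟩ : Module.End K (VVPoly K n lam)) = 1 :=
    LinearMap.ext fun v => divLast_mulX v
  rw [this, one_mul]

theorem dunklLast_macdonald_affine {q s : K} (h : Generic q s) (x : Vertex n lam) :
    dunklLast q s (macdonald q s x.affine) = (1 - q * (x.lab 0).spec q s) •
      downProd (heckeInv s (bTFam n lam s)) n (macdonald q s x) := by
  rw [macdonald_affine h, ← Module.End.mul_apply, dunklLast_mul_raising h.nonRoot,
    Module.End.mul_apply, LinearMap.sub_apply, LinearMap.smul_apply]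
  have := cherednik_macdonald h x 0
  rw [Fin.val_zero] at this
  rw [this, Module.End.one_apply, smul_smul, ← map_smul]
  congr 1
  module

/-- `𝐓_i` commutes with the last Dunkl operator, since both sides act in the same way on the image
of the raising operator and vanish at the other Macdonald polynomials. -/
theorem bT_mul_dunklLast {q s : K} (h : Generic q s) {i : ℕ} (hi : i + 1 < n) :
    bTFam n lam s i * dunklLast q s = dunklLast q s * bTFam n lam s i := by
  have H := isDoubleAffine (n := n) (lam := lam) h.nonRoot q
  have hΞ := H.T_mul_xi hi
  rw [← cherednikLast_eq] at hΞ
  refine end_ext_macdonald h fun y => ?_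
  by_cases hy : y.vec (Fin.last n) = 0
  · rw [Module.End.mul_apply, Module.End.mul_apply, dunklLast_macdonald h hy, map_zero, dunklLast,
      Module.End.mul_apply, LinearMap.sub_apply, Module.End.one_apply, ← Module.End.mul_apply,
      ← hΞ, Module.End.mul_apply, cherednikLast_macdonald h hy, sub_self, map_zero]
  · obtain ⟨x, rfl⟩ := Vertex.exists_affine hy
    rw [macdonald_affine h]
    have e1 := H.T_mul_phi hi
    rw [← raising_eq] at e1
    have e2 := dunklLast_mul_raising (n := n) (lam := lam) h.nonRoot q
    have e3 := H.T_mul_down hi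
    have e4 : cherednik q s 0 * bTFam n lam s (i + 1) =
        bTFam n lam s (i + 1) * cherednik q s 0 := by
      have := H.T_desc_comm (E := cherednikLast q s)
        (fun i hi => by rw [cherednikLast_eq]; exact H.T_mul_xi hi) (j := 0) (Nat.zero_le _) hi
        (by omega) (by omega)
      exact this.symm
    have : bTFam n lam s i * dunklLast q s * raising s =
        dunklLast q s * bTFam n lam s i * raising s := by
      have e5 : (1 - q • cherednik q s 0) * bTFam n lam s (i + 1) =
          bTFam n lam s (i + 1) * (1 - q • cherednik q s 0) :=
        one_sub_mul_comm (R := Module.End K (VVPoly K n lam)) e4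
      rw [mul_assoc, e2, mul_assoc, e1, ← mul_assoc, ← mul_assoc, e2, e3, mul_assoc, mul_assoc,
        e5]
    exact congrArg (fun f => f (macdonald q s x)) this

theorem cherednik_commute {q s : K} (h : Generic q s) (i j : Fin (n + 1)) :
    (cherednik q s i * cherednik q s j : Module.End K (VVPoly K n lam)) =
      cherednik q s j * cherednik q s i :=
  end_ext_macdonald h fun x => by
    simp only [Module.End.mul_apply, cherednik_macdonald h, map_smul, smul_smul, mul_comm]

section LastTwo
variable {m : ℕ}

/-- The composition of two Dunkl operators around `𝐓_{N-1}` on the image of the square of the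
raising operator. The factor `C` is symmetric in the Cherednik operators `Ξ_1` and `Ξ_2`, so that it
commutes with `𝐓_1`. -/
theorem dunklLast_raising_raising {q s : K} (h : Generic q s) :
    let T := bTFam (m + 1) lam s
    let C : Module.End K (VVPoly K (m + 1) lam) :=
      (1 - q • cherednik q s 0) * (1 - q • cherednik q s 1)
    dunklLast q s * T m * dunklLast q s * (raising s * raising s) =
      downProd (heckeInv s T) (m + 1) * downProd (fun i => heckeInv s T (i + 1)) m * C := by
  intro T C
  have H := isDoubleAffine (n := m + 1) (lam := lam) h.nonRoot q
  have e1 : cherednik q s 0 * raising s =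
      (raising s * cherednik q s 1 : Module.End K (VVPoly K (m + 1) lam)) :=
    LinearMap.ext fun v => cherednik_castSucc_raising h.nonRoot q 0 v
  have e2 := dunklLast_mul_raising (n := m + 1) (lam := lam) h.nonRoot q
  have e3 : (1 - q • cherednik q s 0) * raising s =
      (raising s * (1 - q • cherednik q s 1) : Module.End K (VVPoly K (m + 1) lam)) :=
    LinearMap.ext fun v => by
      have := congrArg (fun f => f v) e1
      simp only [Module.End.mul_apply] at this
      simp only [Module.End.mul_apply, LinearMap.sub_apply, LinearMap.smul_apply,
        Module.End.one_apply, map_sub, map_smul, this]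
  have e4 : ∀ k ≤ m, downProd (heckeInv s T) k * dunklLast q s =
      dunklLast q s * downProd (heckeInv s T) k := by
    intro k
    induction k with
    | zero => intro _; simp [downProd]
    | succ k ih =>
      intro hk
      rw [downProd, mul_assoc, ih (by omega), ← mul_assoc,
        IsHecke.commute_inv (bT_mul_dunklLast h (by omega)), mul_assoc]
  have e5 := H.last_T_mul_down
  have e6 := H.down_mul_down (j := m) (by omega)
  calc dunklLast q s * T m * dunklLast q s * (raising s * raising s)
      = dunklLast q s * T m * (dunklLast q s * raising s) * raising s := by
        simp only [mul_assoc]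
    _ = dunklLast q s * (T m * downProd (heckeInv s T) (m + 1)) *
          ((1 - q • cherednik q s 0) * raising s) := by
        rw [e2]; simp only [mul_assoc]; rfl
    _ = dunklLast q s * downProd (heckeInv s T) m * raising s * (1 - q • cherednik q s 1) := by
        rw [e5, e3]; simp only [mul_assoc]; rfl
    _ = downProd (heckeInv s T) m * (dunklLast q s * raising s) * (1 - q • cherednik q s 1) := by
        rw [← e4 m le_rfl]; simp only [mul_assoc]
    _ = (downProd (heckeInv s T) m * downProd (heckeInv s T) (m + 1)) * C := by
        rw [e2]; simp only [mul_assoc]; rfl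
    _ = _ := by rw [e6]

theorem commute_of_hecke_rel {R : Type*} [Ring R] [Algebra K R] {q s : K} {t x y : R}
    (a1 : y * t = t * x + (1 - s) • x) (a2 : t * y = x * t + (1 - s) • x) (a3 : x * y = y * x) :
    t * ((1 - q • x) * (1 - q • y)) = (1 - q • x) * (1 - q • y) * t := by
  have hC : (1 - q • x) * (1 - q • y) = 1 - q • (x + y) + (q * q) • (x * y) := by
    simp only [sub_mul, mul_sub, one_mul, mul_one, smul_mul_assoc, mul_smul_comm]
    module
  have b1 : t * (x * y) = x * y * t := by
    rw [mul_assoc, a1, a3, ← mul_assoc, a2, add_mul, mul_add, mul_assoc]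
    simp
  have b2 : t * x = y * t - (1 - s) • x := by rw [a1]; abel
  rw [hC]
  simp only [mul_add, add_mul, mul_sub, sub_mul, mul_one, one_mul, smul_mul_assoc, mul_smul_comm,
    b1, b2, a2]
  module

theorem bT_zero_commute {q s : K} (h : Generic q s) :
    let T := bTFam (m + 1) lam s
    let C : Module.End K (VVPoly K (m + 1) lam) :=
      (1 - q • cherednik q s 0) * (1 - q • cherednik q s 1)
    T 0 * C = C * T 0 := by
  intro T C
  have H := isDoubleAffine (n := m + 1) (lam := lam) h.nonRoot q
  have a1 : cherednik q s 1 * T 0 = T 0 * cherednik q s 0 + (1 - s) • cherednik q s 0 :=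
    H.desc_succ_mul_T (cherednikLast q s) (i := 0) (by omega)
  have a2 : T 0 * cherednik q s 1 = cherednik q s 0 * T 0 + (1 - s) • cherednik q s 0 :=
    H.T_mul_desc_succ (cherednikLast q s) (i := 0) (by omega)
  have a3 : (cherednik q s 0 * cherednik q s 1 : Module.End K (VVPoly K (m + 1) lam)) =
    cherednik q s 1 * cherednik q s 0 := cherednik_commute h 0 1
  exact commute_of_hecke_rel (R := Module.End K (VVPoly K (m + 1) lam)) a1 a2 a3

/-- On a Macdonald polynomial one of whose two last exponents vanishes, the composition of two
Dunkl operators around `𝐓_{N-1}` vanishes. -/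
theorem dunklLast_bT_dunklLast_macdonald {q s : K} (h : Generic q s) {y : Vertex (m + 1) lam}
    (hy : y.vec (Fin.last m).castSucc = 0 ∨ y.vec (Fin.last (m + 1)) = 0) :
    dunklLast q s (bTFam (m + 1) lam s m (dunklLast q s (macdonald q s y))) = 0 := by
  by_cases hl : y.vec (Fin.last (m + 1)) = 0
  · rw [dunklLast_macdonald h hl, map_zero, map_zero]
  have hm := hy.resolve_right hl
  obtain ⟨x, rfl⟩ := Vertex.exists_affine hl
  have H := isDoubleAffine (n := m + 1) (lam := lam) h.nonRoot q
  have hx : x.vec (Fin.last (m + 1)) = 0 := by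
    have := congrArg Prod.fst (x.affine_lab_castSucc (Fin.last m))
    rw [Fin.succ_last] at this
    exact this.symm.trans hm
  have e5 : bTFam (m + 1) lam s m (downProd (heckeInv s (bTFam (m + 1) lam s)) (m + 1)
      (macdonald q s x)) = downProd (heckeInv s (bTFam (m + 1) lam s)) m (macdonald q s x) :=
    congrArg (fun f => f (macdonald q s x)) H.last_T_mul_down
  have e4 : ∀ k ≤ m, dunklLast q s * downProd (heckeInv s (bTFam (m + 1) lam s)) k =
      downProd (heckeInv s (bTFam (m + 1) lam s)) k * dunklLast q s := by
    intro k
    induction k with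
    | zero => intro _; simp [downProd]
    | succ k ih =>
      intro hk
      rw [downProd, mul_assoc _ _ (dunklLast q s), ← ih (by omega), ← mul_assoc, ← mul_assoc,
        IsHecke.commute_inv (bT_mul_dunklLast h (by omega))]
  have e6 := congrArg (fun f => f (macdonald q s x)) (e4 m le_rfl)
  simp only [Module.End.mul_apply] at e6
  rw [dunklLast_macdonald_affine h, map_smul, map_smul, e5, e6, dunklLast_macdonald h hx, map_zero,
    smul_zero]

/-- `𝐓_i` maps a Macdonald polynomial into the span of this polynomial and of the one with the
labels exchanged. -/
theorem exists_bT_macdonald {q s : K} (h : Generic q s) (x : Vertex n lam) (i : Fin n) :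
    ∃ (a b : K) (z : Vertex n lam), z.vec i.castSucc = x.vec i.succ ∧
      z.vec i.succ = x.vec i.castSucc ∧
      bT s i (macdonald q s x) = a • macdonald q s x + b • macdonald q s z := by
  have key : UpRel (x.lab i.castSucc) (x.lab i.succ) ∨ UpRel (x.lab i.succ) (x.lab i.castSucc) →
      (x.sw i).vec i.castSucc = x.vec i.succ ∧ (x.sw i).vec i.succ = x.vec i.castSucc := by
    intro hi
    have h1 := congrArg Prod.fst (Vertex.sw_lab hi i.castSucc)
    have h2 := congrArg Prod.fst (Vertex.sw_lab hi i.succ)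
    rw [Equiv.swap_apply_left] at h1
    rw [Equiv.swap_apply_right] at h2
    exact ⟨h1, h2⟩
  rcases x.lab_cases i with hi | hi | hi
  · obtain ⟨k1, k2⟩ := key (Or.inl hi)
    refine ⟨-arrowConst q s (x.lab i.castSucc) (x.lab i.succ), 1, x.sw i, k1, k2, ?_⟩
    rw [bT_macdonald_of_up h hi]
    module
  · obtain ⟨k1, k2⟩ := key (Or.inr hi)
    exact ⟨_, _, x.sw i, k1, k2, bT_macdonald_of_down h hi⟩
  · refine ⟨-arrowConst q s (x.lab i.castSucc) (x.lab i.succ), 0, x, hi.1, hi.1.symm, ?_⟩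
    rw [bT_macdonald_of_adj h hi]
    module

/-- The relation equivalent to the commutation of the two last Dunkl operators. On a Macdonald
polynomial one of whose two last exponents vanishes both sides are zero; the other Macdonald
polynomials lie in the image of the square of the raising operator. -/
theorem dunklLast_braid {q s : K} (h : Generic q s) :
    let T := bTFam (m + 1) lam s m
    dunklLast q s * T * dunklLast q s * T = T * dunklLast q s * T * dunklLast q s := by
  intro T
  have H := isDoubleAffine (n := m + 1) (lam := lam) h.nonRoot q
  refine end_ext_macdonald h fun y => ?_
  have hT : T = bT s (Fin.last m) := natFam_of_lt _ (Nat.lt_succ_self m)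
  by_cases hy : y.vec (Fin.last m).castSucc = 0 ∨ y.vec (Fin.last (m + 1)) = 0
  · have h1 := dunklLast_bT_dunklLast_macdonald h hy
    obtain ⟨a, b, z, k1, k2, e⟩ := exists_bT_macdonald h y (Fin.last m)
    have h2 := dunklLast_bT_dunklLast_macdonald h (y := z) (by
      rw [Fin.succ_last] at k1 k2; rw [k1, k2]; exact hy.symm)
    change dunklLast q s (T (dunklLast q s (macdonald q s y))) = 0 at h1
    change dunklLast q s (T (dunklLast q s (macdonald q s z))) = 0 at h2
    change dunklLast q s (T (dunklLast q s (T (macdonald q s y)))) =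
      T (dunklLast q s (T (dunklLast q s (macdonald q s y))))
    rw [h1, map_zero, hT, e, ← hT]
    simp only [map_add, map_smul, h1, h2, smul_zero, add_zero]
  · push Not at hy
    obtain ⟨x, rfl⟩ := Vertex.exists_affine hy.2
    have hx : x.vec (Fin.last (m + 1)) ≠ 0 := by
      have := congrArg Prod.fst (x.affine_lab_castSucc (Fin.last m))
      rw [Fin.succ_last] at this
      rw [show x.vec (Fin.last (m + 1)) = _ from this.symm]
      exact hy.1
    obtain ⟨z, rfl⟩ := Vertex.exists_affine hx
    rw [macdonald_affine h, macdonald_affine h]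
    have e1 := H.T_mul_phi_mul_phi
    rw [← raising_eq] at e1
    have e2 := dunklLast_raising_raising (m := m) (lam := lam) h
    have e3 := bT_zero_commute (m := m) (lam := lam) h
    have e4 := H.last_T_mul_down_mul
    simp only at e2 e3
    have : dunklLast q s * T * dunklLast q s * T * (raising s * raising s) =
        T * dunklLast q s * T * dunklLast q s * (raising s * raising s) := by
      calc _ = dunklLast q s * T * dunklLast q s * (raising s * raising s) *
            bTFam (m + 1) lam s 0 := by rw [mul_assoc _ T, e1]; simp only [mul_assoc]
        _ = T * (downProd (heckeInv s (bTFam (m + 1) lam s)) (m + 1) *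
            downProd (fun i => heckeInv s (bTFam (m + 1) lam s) (i + 1)) m) *
            ((1 - q • cherednik q s 0) * (1 - q • cherednik q s 1)) := by
          rw [e4, e2, mul_assoc, ← e3, ← mul_assoc]
        _ = T * (dunklLast q s * T * dunklLast q s * (raising s * raising s)) := by
          rw [e2]; simp only [mul_assoc]
        _ = _ := by simp only [mul_assoc]
    exact congrArg (fun f => f (macdonald q s z)) this

end LastTwo

theorem dunkl_commute {q s : K} (h : Generic q s) (i j : Fin (n + 1)) :
    Commute (dunkl q s i : Module.End K (VVPoly K n lam)) (dunkl q s j) := by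
  have H := isDoubleAffine (n := n) (lam := lam) h.nonRoot q
  have key : ∀ i j : Fin (n + 1), i < j →
      Commute (dunkl q s i : Module.End K (VVPoly K n lam)) (dunkl q s j) := by
    intro i j hij
    rw [dunkl_eq, dunkl_eq]
    refine H.desc_comm (fun i hi => bT_mul_dunklLast h hi) ?_ hij (Nat.lt_succ_iff.1 j.isLt)
    rintro m rfl
    have := dunklLast_braid (m := m) (lam := lam) h
    simp only at this
    change _ * dunklLast q s = dunklLast q s * _
    rw [desc_of_lt s _ _ (Nat.lt_succ_self m), desc_last, smul_mul_assoc, mul_smul_comm]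
    change s⁻¹ • (bTFam (m + 1) lam s m * dunklLast q s * bTFam (m + 1) lam s m *
      dunklLast q s) = _
    rw [← this]
    simp only [mul_assoc]
  rcases lt_trichotomy i j with hij | rfl | hij
  · exact key i j hij
  · exact Commute.refl _
  · exact (key j i hij).symm

/-! ### Adjoints with respect to the bilinear form -/

/-- A product of powers of commuting elements, after raising one exponent by one. -/
theorem list_prod_pow_add_single {ι R : Type*} [DecidableEq ι] [Ring R] (D : ι → R)
    (hD : ∀ i j, Commute (D i) (D j)) (u : ι → ℕ) (j : ι) (l : List ι) :
    (l.map fun i => D i ^ (u i + if i = j then 1 else 0)).prod =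
      (l.map fun i => D i ^ u i).prod * D j ^ l.count j := by
  induction l with
  | nil => simp
  | cons a l ih =>
    have hc : Commute (D j) (l.map fun i => D i ^ u i).prod :=
      Commute.list_prod_right _ _ fun x hx => by
        obtain ⟨i, -, rfl⟩ := List.mem_map.1 hx
        exact (hD j i).pow_right _
    rw [List.map_cons, List.prod_cons, List.map_cons, List.prod_cons, ih]
    by_cases h : a = j
    · subst h
      rw [if_pos rfl, List.count_cons_self, pow_succ, pow_succ', mul_assoc, ← mul_assoc (D a),
        hc.eq]
      simp only [mul_assoc]
    · rw [if_neg h, add_zero, List.count_cons_of_ne h, mul_assoc]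

theorem form_monomial (q s : K) (u : Fin (n + 1) →₀ ℕ) (A : RST n lam) (Q : VVPoly K n lam) :
    form q s (MvPolynomial.monomial u 1 ⊗ₜ Finsupp.single A 1) Q =
      tabPair s A (((List.finRange (n + 1)).map fun i => dunkl q s i ^ u i).prod Q) := by
  have h : (MvPolynomial.monomial u 1 : MvPolynomial (Fin (n + 1)) K) =
      MvPolynomial.basisMonomials (Fin (n + 1)) K u := by
    rw [MvPolynomial.coe_basisMonomials]
  rw [form, h, TensorProduct.lift.tmul, Module.Basis.constr_basis,
    Finsupp.linearCombination_single, one_smul]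
  rfl

theorem vv_ext_monomial {p : VVPoly K n lam → Prop} (hzero : p 0)
    (hadd : ∀ v w, p v → p w → p (v + w)) (hsmul : ∀ (c : K) v, p v → p (c • v))
    (hmon : ∀ u A, p (MvPolynomial.monomial u 1 ⊗ₜ Finsupp.single A 1)) (v : VVPoly K n lam) :
    p v := by
  induction v using TensorProduct.induction_on with
  | zero => exact hzero
  | add v w hv hw => exact hadd v w hv hw
  | tmul f g =>
    induction f using MvPolynomial.induction_on' with
    | add f f' hf hf' => rw [TensorProduct.add_tmul]; exact hadd _ _ hf hf'
    | monomial u a =>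
      induction g using Finsupp.induction_linear with
      | zero => rw [TensorProduct.tmul_zero]; exact hzero
      | add g g' hg hg' => rw [TensorProduct.tmul_add]; exact hadd _ _ hg hg'
      | single A c =>
        have e1 : (MvPolynomial.monomial u a : MvPolynomial (Fin (n + 1)) K) =
            a • MvPolynomial.monomial u 1 := by
          rw [MvPolynomial.smul_monomial, smul_eq_mul, mul_one]
        have e2 : Finsupp.single A c = c • Finsupp.single A (1 : K) := by
          rw [Finsupp.smul_single, smul_eq_mul, mul_one]
        rw [e1, e2, TensorProduct.tmul_smul, ← TensorProduct.smul_tmul']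
        exact hsmul _ _ (hsmul _ _ (hmon u A))

/-- Multiplication by a variable is adjoint to the Dunkl operator. The form is defined on
monomials by an ordered product of Dunkl operators, so this uses that they commute. -/
theorem form_mulX {q s : K} (h : Generic q s) (j : Fin (n + 1)) (P Q : VVPoly K n lam) :
    form q s (mulX j P) Q = form q s P (dunkl q s j Q) := by
  induction P using vv_ext_monomial with
  | hzero => simp
  | hadd v w hv hw => simp only [map_add, LinearMap.add_apply, hv, hw]
  | hsmul c v hv => simp only [map_smul, LinearMap.smul_apply, hv]
  | hmon u A =>
    rw [mulX_tmul, MvPolynomial.X, MvPolynomial.monomial_mul, one_mul, form_monomial,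
      form_monomial, ← Module.End.mul_apply]
    congr 1
    have e := list_prod_pow_add_single (fun i => (dunkl q s i : Module.End K (VVPoly K n lam)))
      (dunkl_commute h) u j (List.finRange (n + 1))
    rw [List.count_eq_one_of_mem (List.nodup_finRange _) (List.mem_finRange j), pow_one] at e
    rw [← e]
    congr 3
    funext i
    have e' : (fun₀ | j => 1) i + u i = u i + if i = j then 1 else 0 := by
      rw [Finsupp.single_apply, add_comm]
      congr 1
      exact if_congr eq_comm rfl rfl
    exact congrArg (fun k => dunkl q s i ^ k) e'

theorem tabPair_tmul (s : K) (A : RST n lam) (f : MvPolynomial (Fin (n + 1)) K)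
    (u : RST n lam →₀ K) : tabPair s A (f ⊗ₜ u) = nu s A * (f.coeff 0 * u A) := by
  simp [tabPair]

theorem form_single (q s : K) (A : RST n lam) (Q : VVPoly K n lam) :
    form q s (1 ⊗ₜ Finsupp.single A 1) Q = tabPair s A Q := by
  have := form_monomial q s 0 A Q
  rw [MvPolynomial.monomial_zero', map_one] at this
  rw [this]
  simp

theorem form_single_single (q s : K) [DecidableEq (RST n lam)] (A B : RST n lam) :
    form q s (1 ⊗ₜ Finsupp.single A 1) (1 ⊗ₜ Finsupp.single B 1) =
      if A = B then nu s A else 0 := by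
  rw [form_single, tabPair_tmul, MvPolynomial.coeff_zero_one, one_mul, Finsupp.single_apply]
  simp [eq_comm]

theorem one_tmul_induction {p : (RST n lam →₀ K) → Prop} (hzero : p 0)
    (hadd : ∀ v w, p v → p w → p (v + w)) (hsmul : ∀ (c : K) v, p v → p (c • v))
    (hsingle : ∀ A, p (Finsupp.single A 1)) (v : RST n lam →₀ K) : p v := by
  induction v using Finsupp.induction_linear with
  | zero => exact hzero
  | add v w hv hw => exact hadd v w hv hw
  | single A c =>
    have e2 : Finsupp.single A c = c • Finsupp.single A (1 : K) := by
      rw [Finsupp.smul_single, smul_eq_mul, mul_one]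
    rw [e2]
    exact hsmul _ _ (hsingle A)

theorem form_one_mulX (q s : K) (u : RST n lam →₀ K) (j : Fin (n + 1)) (Q : VVPoly K n lam) :
    form q s (1 ⊗ₜ u) (mulX j Q) = 0 := by
  induction u using one_tmul_induction with
  | hzero => simp
  | hadd v w hv hw => rw [TensorProduct.tmul_add, map_add, LinearMap.add_apply, hv, hw, add_zero]
  | hsmul c v hv => rw [TensorProduct.tmul_smul, map_smul, LinearMap.smul_apply, hv, smul_zero]
  | hsingle A =>
    rw [form_single]
    induction Q using TensorProduct.induction_on with
    | zero => simp
    | add v w hv hw => rw [map_add, map_add, hv, hw, add_zero]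
    | tmul f w =>
      rw [mulX_tmul, tabPair_tmul, ← MvPolynomial.constantCoeff_eq, map_mul,
        MvPolynomial.constantCoeff_X]
      simp

/-- Exchanging two consecutive entries changes the norm of a tableau by the factor which makes the
Hecke generators unitary. -/
theorem nu_exch {s : K} (A : RST n lam) (i : Fin n) {m : ℤ}
    (hm : A.ct i.succ - A.ct i.castSucc = m) (h : m ≤ -2) (hs : NonRoot s) :
    nu s (A.exch i.castSucc i.succ) = s⁻¹ * tabProd s m * nu s A := by
  let G : ℤ → ℤ → K := fun c d => if c - d ≤ -2 then
    (1 - s ^ (d - c - 1)) * (1 - s ^ (d - c + 1)) / (1 - s ^ (d - c)) ^ 2 else 1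
  have hnu : ∀ B : RST n lam, nu s B =
      ∏ p : Fin (n + 1) × Fin (n + 1) with p.1 < p.2, G (B.ct p.1) (B.ct p.2) := by
    intro B
    rw [nu, ← Finset.filter_filter, Finset.prod_filter]
  have hex := A.exch_ct (a := i.castSucc) (b := i.succ) (by simp) (by omega)
  have key := prod_pairs_swap G A.ct i
  have g1 : G (A.ct i.castSucc) (A.ct i.succ) = 1 := if_neg (by omega)
  have g2 : G (A.ct i.succ) (A.ct i.castSucc) = s⁻¹ * tabProd s m := by
    rw [← tabProd_neg hs (by omega), tabProd]
    have e : A.ct i.castSucc - A.ct i.succ = -m := by omega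
    simp only [G]
    rw [if_pos (by omega), e]
    have := hs.ne_zero
    field_simp
  rw [g1, g2, mul_one] at key
  rw [hnu, hnu, mul_comm, ← key]
  simp only [hex]

theorem tabDiag_inv {s : K} (hs : NonRoot s) {m : ℤ} (hm : m ≠ 0) :
    tabDiag s⁻¹ m = s⁻¹ * (tabDiag s m + 1 - s) := by
  have h1 := hs.one_sub_zpow hm
  have h2 := hs.inv.one_sub_zpow hm
  have h0 := hs.ne_zero
  have h3 : s ^ m ≠ 0 := zpow_ne_zero _ h0
  rw [inv_zpow] at h2
  unfold tabDiag
  rw [inv_zpow]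
  generalize s ^ m = w at *
  have h4 : w - 1 ≠ 0 := fun e => h1 (by rw [← neg_sub, e, neg_zero])
  have e1 : 1 - w⁻¹ = (w - 1) * w⁻¹ := by field_simp
  have e2 : 1 - w = -(w - 1) := by ring
  rw [e1, e2]
  field_simp
  ring

theorem tabProd_inv {s : K} (hs : NonRoot s) {m : ℤ} (hm : m ≠ 0) :
    tabProd s⁻¹ m = s⁻¹ * s⁻¹ * tabProd s m := by
  have h0 := hs.ne_zero
  have hk : tabDiag s m = s - 1 - tabDiag s (-m) := by rw [tabDiag_neg hs hm]; ring
  rw [tabProd_eq hs.inv hm, tabProd_eq hs hm, tabDiag_inv hs hm]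
  field_simp
  ring

/-- The Hecke generators are unitary on the tableaux. -/
theorem form_tabT {s : K} (hs : NonRoot s) (q : K) (i : Fin n) (u w : RST n lam →₀ K) :
    form q s (1 ⊗ₜ tabT s⁻¹ i u) (1 ⊗ₜ w) =
      form q s (1 ⊗ₜ u) (1 ⊗ₜ (s⁻¹ • (tabT s i w + (1 - s) • w))) := by
  classical
  induction u using one_tmul_induction with
  | hzero => simp
  | hadd v w hv hw => simp only [map_add, TensorProduct.tmul_add, LinearMap.add_apply] at *
                      simp only [hv, hw]
  | hsmul c v hv => simp only [map_smul, TensorProduct.tmul_smul, LinearMap.smul_apply] at *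
                    rw [hv, smul_comm]
  | hsingle A =>
  induction w using one_tmul_induction with
  | hzero => simp
  | hadd v w hv hw =>
    rw [TensorProduct.tmul_add, map_add, hv, hw, ← map_add, ← TensorProduct.tmul_add, map_add]
    congr 2
    module
  | hsmul c v hv =>
    rw [TensorProduct.tmul_smul, map_smul, hv, ← map_smul, ← TensorProduct.tmul_smul, map_smul]
    congr 2
    module
  | hsingle B =>
    obtain ⟨m, hm⟩ : ∃ m, A.ct i.succ - A.ct i.castSucc = m := ⟨_, rfl⟩
    obtain ⟨m', hm'⟩ : ∃ m, B.ct i.succ - B.ct i.castSucc = m := ⟨_, rfl⟩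
    have hab : ((i.succ : Fin (n + 1)) : ℕ) = i.castSucc + 1 := by simp
    have hm0 : m ≠ 0 := hm ▸ A.ct_ne hab
    rw [tabT_single hs.inv, tabT_single hs, hm, hm']
    simp only [TensorProduct.tmul_add, TensorProduct.tmul_smul, map_add, map_smul,
      LinearMap.add_apply, LinearMap.smul_apply, form_single_single, smul_eq_mul]
    have exm : ∀ (C : RST n lam) (k : ℤ), C.ct i.succ - C.ct i.castSucc = k →
        (k ≤ -2 ∨ 2 ≤ k) → (C.exch i.castSucc i.succ).ct i.succ -
          (C.exch i.castSucc i.succ).ct i.castSucc = -k := by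
      intro C k hk hk'
      rw [C.exch_ct hab (by omega), C.exch_ct hab (by omega), Equiv.swap_apply_left,
        Equiv.swap_apply_right]
      omega
    by_cases hAB : A = B
    · subst hAB
      obtain rfl : m = m' := hm.symm.trans hm'
      rw [if_pos rfl]
      by_cases hv : m ≤ -2 ∨ 2 ≤ m
      · have hne : A.exch i.castSucc i.succ ≠ A := by
          intro e
          have := exm A m hm hv
          rw [e] at this
          omega
        rw [if_neg hne, if_neg hne.symm, tabDiag_inv hs hm0]
        ring
      · rw [tabOff_eq_zero _ hv, tabOff_eq_zero _ hv, tabDiag_inv hs hm0]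
        ring
    · rw [if_neg hAB]
      by_cases hv : m ≤ -2 ∨ 2 ≤ m
      · by_cases hB : A.exch i.castSucc i.succ = B
        · subst hB
          have hBA := A.exch_exch hab (by omega)
          have hmm := exm A m hm hv
          obtain rfl : m' = -m := hm'.symm.trans hmm
          rw [if_pos rfl, hBA, if_pos rfl]
          rcases hv with hv | hv
          · rw [nu_exch A i hm hv hs]
            simp only [tabOff]
            rw [if_pos hv, if_neg (by omega), if_pos (by omega)]
            change _ = s⁻¹ * (_ + tabProd s (-m) * _ + _)
            rw [tabProd_neg hs hm0]
            ring
          · have := nu_exch (s := s) (A.exch i.castSucc i.succ) i hm' (by omega) hs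
            rw [hBA, tabProd_neg hs hm0] at this
            rw [this]
            simp only [tabOff]
            rw [if_neg (by omega), if_pos hv, if_pos (by omega)]
            change _ + tabProd s⁻¹ m * _ = _
            rw [tabProd_inv hs hm0]
            ring
        · rw [if_neg hB]
          by_cases hv' : m' ≤ -2 ∨ 2 ≤ m'
          · have : ¬ A = B.exch i.castSucc i.succ := by
              rintro rfl
              exact hB (B.exch_exch hab (by omega))
            rw [if_neg this]; ring
          · rw [tabOff_eq_zero _ hv']; ring
      · rw [tabOff_eq_zero _ hv]
        by_cases hv' : m' ≤ -2 ∨ 2 ≤ m'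
        · have : ¬ A = B.exch i.castSucc i.succ := by
            rintro rfl
            have := exm B m' hm' hv'
            omega
          rw [if_neg this]; ring
        · rw [tabOff_eq_zero _ hv']; ring

theorem dunkl_bT_of_ne {q s : K} (h : Generic q s) {i : Fin n} {j : Fin (n + 1)}
    (h1 : j ≠ i.castSucc) (h2 : j ≠ i.succ) (v : VVPoly K n lam) :
    dunkl q s j (bT s i v) = bT s i (dunkl q s j v) := by
  have H := isDoubleAffine (n := n) (lam := lam) h.nonRoot q
  have := H.T_desc_comm (E := dunklLast q s)
    (fun i hi => bT_mul_dunklLast h hi) (Nat.lt_succ_iff.1 j.isLt) i.isLt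
    (fun e => h1 (Fin.ext e.symm)) (fun e => h2 (Fin.ext (by simp [← e])))
  rw [natFam_val] at this
  rw [dunkl_eq]
  exact (congrArg (fun f => f v) this).symm

theorem dunkl_succ_bT {s : K} (hs : NonRoot s) (q : K) (i : Fin n) (v : VVPoly K n lam) :
    dunkl q s i.succ (bT s i v) =
      bT s i (dunkl q s i.castSucc v) + (1 - s) • dunkl q s i.castSucc v := by
  have H := isDoubleAffine (n := n) (lam := lam) hs q
  have := H.desc_succ_mul_T (divLast * (1 - cherednikLast q s)) i.isLt
  rw [natFam_val] at this
  rw [dunkl_eq, dunkl_eq]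
  exact congrArg (fun f => f v) this

theorem dunkl_castSucc_bT {s : K} (hs : NonRoot s) (q : K) (i : Fin n) (v : VVPoly K n lam) :
    dunkl q s i.castSucc (bT s i v) =
      bT s i (dunkl q s i.succ v) - (1 - s) • dunkl q s i.castSucc v := by
  have H := isDoubleAffine (n := n) (lam := lam) hs q
  have := H.T_mul_desc_succ (divLast * (1 - cherednikLast q s)) i.isLt
  rw [natFam_val] at this
  rw [dunkl_eq, dunkl_eq, eq_sub_iff_add_eq]
  exact (congrArg (fun f => f v) this).symm

/-- The operators `𝐓_i` are unitary: the defining relations of the form carry unitarity from the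
tableaux to all vector valued polynomials. -/
theorem form_bT_bT {q s : K} (h : Generic q s) (i : Fin n) (P Q : VVPoly K n lam) :
    form q s (bT s⁻¹ i P) (bT s i Q) = form q s P Q := by
  have hs := h.nonRoot
  have h0 := h.s_ne_zero
  induction P using vv_induction generalizing Q with
  | hone u =>
    rw [bT_one_tmul]
    induction Q using vv_induction with
    | hone w =>
      rw [bT_one_tmul, form_tabT hs, tabT_quadratic hs]
      congr 2
      match_scalars <;> field_simp
      ring
    | hadd v w hv hw => rw [map_add, map_add, map_add, hv, hw]
    | hX j v hv =>
      rw [form_one_mulX]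
      by_cases h1 : j = i.castSucc
      · subst h1
        rw [bT_mulX_castSucc, map_add, map_smul, form_one_mulX, form_one_mulX, smul_zero, add_zero]
      by_cases h2 : j = i.succ
      · subst h2
        rw [bT_mulX_succ, map_sub, map_smul, form_one_mulX, form_one_mulX, smul_zero, sub_zero]
      rw [bT_mulX_of_ne s i h1 h2, form_one_mulX]
  | hadd v w hv hw => simp only [map_add, LinearMap.add_apply, hv, hw]
  | hX j P ih =>
    -- the adjoint of `𝐓_i⁻¹`, in the form in which the induction hypothesis provides it
    have key : ∀ R, form q s (bT s⁻¹ i P) R =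
        s⁻¹ * (form q s P (bT s i R) + (1 - s) * form q s P R) := by
      intro R
      have := ih (bTinv s i R)
      rw [bT_bTinv hs] at this
      rw [this, bTinv_apply, map_smul, map_add, map_smul, smul_eq_mul, smul_eq_mul]
    by_cases h1 : j = i.castSucc
    · subst h1
      rw [bT_mulX_castSucc, map_add, map_smul, LinearMap.add_apply, LinearMap.smul_apply,
        form_mulX h, form_mulX h, form_mulX h, dunkl_succ_bT hs, map_add, map_add, ih, map_smul,
        map_smul, key, smul_eq_mul, smul_eq_mul, smul_eq_mul]
      field_simp
      ring
    by_cases h2 : j = i.succ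
    · subst h2
      rw [bT_mulX_succ, map_sub, map_smul, LinearMap.sub_apply, LinearMap.smul_apply,
        form_mulX h, form_mulX h, form_mulX h, dunkl_castSucc_bT hs, dunkl_succ_bT hs, map_sub,
        map_add, ih, map_smul, map_smul, key, smul_eq_mul, smul_eq_mul, smul_eq_mul]
      field_simp
      ring
    rw [bT_mulX_of_ne _ i h1 h2, form_mulX h, form_mulX h, dunkl_bT_of_ne h h1 h2, ih]

theorem form_bT_left {q s : K} (h : Generic q s) (i : Fin n) (P Q : VVPoly K n lam) :
    form q s (bT s⁻¹ i P) Q = s⁻¹ * (form q s P (bT s i Q) + (1 - s) * form q s P Q) := by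
  have := form_bT_bT h i P (bTinv s i Q)
  rw [bT_bTinv h.nonRoot] at this
  rw [this, bTinv_apply, map_smul, map_add, map_smul, smul_eq_mul, smul_eq_mul]

theorem form_bTinv_left {q s : K} (h : Generic q s) (i : Fin n) (P Q : VVPoly K n lam) :
    form q s (bTinv s⁻¹ i P) Q = form q s P (bT s i Q) := by
  rw [← form_bT_bT h i, bT_bTinv h.inv.nonRoot]

theorem form_downProd {q s : K} (h : Generic q s) (P Q : VVPoly K n lam) : ∀ k ≤ n,
    form q s (downProd (heckeInv s⁻¹ (bTFam n lam s⁻¹)) k P) Q =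
      form q s P (upProd (bTFam n lam s) k Q) := by
  intro k
  induction k generalizing Q with
  | zero => intro _; rfl
  | succ k ih =>
    intro hk
    have e := heckeInv_bT (lam := lam) s⁻¹ ⟨k, hk⟩
    simp only at e
    rw [downProd, upProd, e, Module.End.mul_apply, Module.End.mul_apply, form_bTinv_left h,
      ih _ (by omega), bTFam, natFam_of_lt _ (show k < n from hk)]

theorem form_raising {q s : K} (h : Generic q s) (P Q : VVPoly K n lam) :
    form q s (raising s⁻¹ P) Q = form q s P (upProd (bTFam n lam s) n (dunklLast q s Q)) := by
  rw [raising_eq, phi, natFam_of_lt _ (Nat.lt_succ_self n), Module.End.mul_apply]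
  change form q s (mulX (Fin.last n) _) _ = _
  rw [form_mulX h, form_downProd h _ _ n le_rfl, dunkl_eq, Fin.val_last, desc_last, dunklLast]

/-- The raising operator is adjoint to a lowering operator, which undoes it on the Macdonald
polynomials up to a factor. -/
theorem form_raising_macdonald_affine {q s : K} (h : Generic q s) (P : VVPoly K n lam)
    (z : Vertex n lam) : form q s (raising s⁻¹ P) (macdonald q s z.affine) =
      (1 - q * (z.lab 0).spec q s) * form q s P (macdonald q s z) := by
  have H := isDoubleAffine (n := n) (lam := lam) h.nonRoot q
  have e := congrArg (fun f => f (macdonald q s z))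
    (upProd_mul_downProd (fun i hi => H.mul_inv (i := i) hi) n le_rfl)
  simp only [Module.End.mul_apply, Module.End.one_apply] at e
  rw [form_raising h, dunklLast_macdonald_affine h, map_smul, map_smul, e, smul_eq_mul]

/-! ### Orthogonality and norms -/

/-- Polynomials of degree zero are orthogonal to the Macdonald polynomials of positive degree. -/
theorem form_one_macdonald {q s : K} (h : Generic q s) (u : RST n lam →₀ K) (y : Vertex n lam)
    (hy : y.vec ≠ 0) : form q s (1 ⊗ₜ u) (macdonald q s y) = 0 := by
  have hdeg : ∀ y : Vertex n lam, y.vec ≠ 0 ↔ y.deg ≠ 0 := fun y => by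
    rw [Vertex.deg, Ne, Ne, Finset.sum_eq_zero_iff, funext_iff]; simp
  induction y using Vertex.graph_induction generalizing u with
  | h y ih =>
  rcases y.predecessor with ⟨A, -, rfl⟩ | ⟨i, hi⟩ | ⟨z, rfl⟩
  · exact absurd rfl hy
  · have hy' : (y.sw i).vec ≠ 0 := by rwa [hdeg, Vertex.deg_sw (Or.inr hi), ← hdeg]
    have ih' := fun u => ih _ (Vertex.smaller_sw hi) u hy'
    rw [macdonald_of_sw h hi, intertwiner_apply, map_add, map_smul, ih', smul_zero, add_zero,
      ← form_bTinv_left h, bTinv_apply, bT_one_tmul, ← TensorProduct.tmul_smul,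
      ← TensorProduct.tmul_add, ← TensorProduct.tmul_smul, ih']
  · rw [macdonald_affine h, raising_eq, phi, natFam_of_lt _ (Nat.lt_succ_self n),
      Module.End.mul_apply, form_one_mulX]

theorem UpRel.spec_sub_ne {q s : K} (h : Generic q s) {l l' : Label lam} (hl : UpRel l l') :
    l.spec q s - l'.spec q s ≠ 0 := by
  intro e
  have := hl.spec_div_ne h
  rw [← sub_eq_zero.1 e, div_self (l.spec_ne_zero h), sub_self] at this
  exact this rfl

theorem Label.spec_inv (q s : K) (l : Label lam) : l.spec q⁻¹ s⁻¹ = (l.spec q s)⁻¹ := by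
  rw [Label.spec, Label.spec, inv_pow, inv_zpow, mul_inv]

theorem arrowConst_inv {q s : K} (h : Generic q s) {l l' : Label lam} (hl : UpRel l l') :
    arrowConst q⁻¹ s⁻¹ l l' = s⁻¹ * (arrowConst q s l l' - (1 - s)) := by
  have h1 := arrowConst_mul h (hl.spec_div_ne h)
  have h2 := arrowConst_mul h.inv (hl.spec_div_ne h.inv)
  rw [Label.spec_inv, Label.spec_inv] at h2
  have a0 := l.spec_ne_zero h
  have b0 := l'.spec_ne_zero h
  have s0 := h.s_ne_zero
  have hne := hl.spec_sub_ne h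
  generalize l.spec q s = a at *
  generalize l'.spec q s = b at *
  generalize arrowConst q s l l' = c at *
  generalize arrowConst q⁻¹ s⁻¹ l l' = d at *
  field_simp at h2
  apply mul_right_cancel₀ hne
  have : s⁻¹ * (c - (1 - s)) * (a - b) = s⁻¹ * ((1 - s) * b) := by linear_combination s⁻¹ * h1
  rw [this]
  field_simp
  linear_combination -h2

/-- Macdonald polynomials at different vertices are orthogonal. -/
theorem form_macdonald_of_ne {q s : K} (h : Generic q s) {x y : Vertex n lam} (hxy : x ≠ y) :
    form q s (macdonald q⁻¹ s⁻¹ x) (macdonald q s y) = 0 := by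
  classical
  have s0 := h.s_ne_zero
  induction x using Vertex.graph_induction generalizing y with
  | h x ih =>
  rcases x.predecessor with ⟨A, -, rfl⟩ | ⟨i, hi⟩ | ⟨z, rfl⟩
  · rw [macdonald_zero h.inv]
    by_cases hy : y.vec = 0
    · obtain ⟨B, v⟩ := y
      simp only at hy
      subst hy
      rw [macdonald_zero h, form_single_single, if_neg]
      rintro rfl
      exact hxy rfl
    · exact form_one_macdonald h _ y hy
  · have ih' := fun {y} hy => ih _ (Vertex.smaller_sw hi) (y := y) hy
    have hl := fun k => Vertex.sw_lab (Or.inr hi) k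
    have hi' : UpRel ((x.sw i).lab i.castSucc) ((x.sw i).lab i.succ) := by
      rwa [hl, hl, Equiv.swap_apply_left, Equiv.swap_apply_right]
    have hxx : x.sw i ≠ x := by
      intro e
      have := hi'
      rw [e] at this
      exact this.asymm hi
    rw [macdonald_of_sw h.inv hi, intertwiner_apply, map_add, map_smul, LinearMap.add_apply,
      LinearMap.smul_apply, form_bT_left h, smul_eq_mul]
    -- `𝐓_i` maps `P_y` into the span of `P_y` and of the Macdonald polynomial at `y.sw i`; both are
    -- orthogonal to the one at `x.sw i` unless `y` is `x` or `x.sw i`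
    by_cases hy : x.sw i = y
    · subst hy
      have hx2 : (x.sw i).sw i = x := Vertex.sw_sw (Or.inr hi)
      rw [bT_macdonald_of_up h hi', map_sub, map_smul, hx2, ih' hxx, smul_eq_mul,
        arrowConst_inv h hi, hl, hl, Equiv.swap_apply_left, Equiv.swap_apply_right]
      ring
    · rw [ih' hy, mul_zero, mul_zero, add_zero, add_zero]
      have hsw : UpRel (y.lab i.castSucc) (y.lab i.succ) ∨
          UpRel (y.lab i.succ) (y.lab i.castSucc) → x.sw i ≠ y.sw i := by
        intro hy' e
        apply hxy
        rw [← Vertex.sw_sw (Or.inr hi), e, Vertex.sw_sw hy']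
      rcases y.lab_cases i with hy' | hy' | hy'
      · rw [bT_macdonald_of_up h hy', map_sub, map_smul, ih' hy, ih' (hsw (Or.inl hy'))]
        simp
      · rw [bT_macdonald_of_down h hy', map_add, map_smul, map_smul, ih' hy,
          ih' (hsw (Or.inr hy'))]
        simp
      · rw [bT_macdonald_of_adj h hy', map_neg, map_smul, ih' hy]
        simp
  · rw [macdonald_affine h.inv]
    by_cases hy : y.vec (Fin.last n) = 0
    · rw [form_raising h, dunklLast_macdonald h hy, map_zero, map_zero]
    · obtain ⟨w, rfl⟩ := Vertex.exists_affine hy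
      rw [form_raising_macdonald_affine h, ih _ z.smaller_affine, mul_zero]
      rintro rfl
      exact hxy rfl

/-- The ratio of the norms at the ends of an arrow. -/
theorem form_macdonald_sw {q s : K} (h : Generic q s) {x : Vertex n lam} {i : Fin n}
    (hi : UpRel (x.lab i.castSucc) (x.lab i.succ)) :
    let a := (x.lab i.castSucc).spec q s
    let b := (x.lab i.succ).spec q s
    form q s (macdonald q⁻¹ s⁻¹ (x.sw i)) (macdonald q s (x.sw i)) =
      (s * a - b) * (a - s * b) / (s * (a - b) ^ 2) *
        form q s (macdonald q⁻¹ s⁻¹ x) (macdonald q s x) := by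
  intro a b
  have s0 := h.s_ne_zero
  have hl := fun k => Vertex.sw_lab (Or.inl hi) k
  have hi' : UpRel ((x.sw i).lab i.succ) ((x.sw i).lab i.castSucc) := by
    rwa [hl, hl, Equiv.swap_apply_left, Equiv.swap_apply_right]
  have hxx : x ≠ x.sw i := by
    intro e
    have := hi'
    rw [← e] at this
    exact this.asymm hi
  have hx2 : (x.sw i).sw i = x := Vertex.sw_sw (Or.inl hi)
  have h1 := arrowConst_mul h (hi.spec_div_ne h)
  have hne : a - b ≠ 0 := hi.spec_sub_ne h
  conv_lhs =>
    rw [macdonald_sw h.inv hi, intertwiner_apply, map_add, map_smul, LinearMap.add_apply,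
      LinearMap.smul_apply, form_bT_left h, form_macdonald_of_ne h hxx,
      bT_macdonald_of_down h hi', map_add, map_smul, map_smul, form_macdonald_of_ne h hxx, hx2,
      hl, hl, Equiv.swap_apply_left, Equiv.swap_apply_right]
  simp only [smul_eq_mul, mul_zero, add_zero, zero_add]
  rw [← mul_assoc]
  congr 1
  change arrowConst q s (x.lab i.castSucc) (x.lab i.succ) * (a - b) = (1 - s) * a at h1
  generalize arrowConst q s (x.lab i.castSucc) (x.lab i.succ) = c at *
  obtain rfl : c = (1 - s) * a / (a - b) := by rw [← h1, mul_div_cancel_right₀ _ hne]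
  field_simp
  ring

/-! ### Sums over permutations -/

/-- The permutation `σ` with `σ 0 = p` such that the remaining values, relabelled increasingly,
form the permutation `e`. -/
def consPerm {N : ℕ} (p : Fin (N + 1)) (e : Equiv.Perm (Fin N)) : Equiv.Perm (Fin (N + 1)) :=
  p.cycleRange⁻¹ * Equiv.Perm.decomposeFin.symm (0, e)

theorem consPerm_zero {N : ℕ} (p : Fin (N + 1)) (e : Equiv.Perm (Fin N)) :
    consPerm p e 0 = p := by
  rw [consPerm, Equiv.Perm.mul_apply, Equiv.Perm.decomposeFin_symm_apply_zero]
  exact Fin.cycleRange_symm_zero p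

theorem consPerm_succ {N : ℕ} (p : Fin (N + 1)) (e : Equiv.Perm (Fin N)) (i : Fin N) :
    consPerm p e i.succ = p.succAbove (e i) := by
  rw [consPerm, Equiv.Perm.mul_apply, Equiv.Perm.decomposeFin_symm_apply_succ, Equiv.swap_self]
  exact Fin.cycleRange_symm_succ p (e i)

theorem consPerm_bijective (N : ℕ) : Function.Bijective
    fun x : Fin (N + 1) × Equiv.Perm (Fin N) => consPerm x.1 x.2 := by
  rw [Fintype.bijective_iff_injective_and_card]
  refine ⟨?_, by simp [Fintype.card_perm, Nat.factorial_succ]⟩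
  rintro ⟨p, e⟩ ⟨p', e'⟩ h
  have h0 := congrArg (fun σ : Equiv.Perm _ => σ 0) h
  simp only [consPerm_zero] at h0
  subst h0
  congr 1
  ext1 i
  have h1 := congrArg (fun σ : Equiv.Perm _ => σ i.succ) h
  simp only [consPerm_succ] at h1
  exact Fin.succAbove_right_injective h1

theorem sum_perm_succ {M : Type*} [AddCommMonoid M] {N : ℕ}
    (f : Equiv.Perm (Fin (N + 1)) → M) : ∑ σ, f σ = ∑ p, ∑ e, f (consPerm p e) := by
  rw [← Fintype.sum_prod_type' (f := fun p e => f (consPerm p e))]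
  exact (Fintype.sum_bijective _ (consPerm_bijective N) _ _ fun _ => rfl).symm

theorem prod_pairs_eq_prod_prod {M : Type*} [CommMonoid M] {N : ℕ} (F : Fin N → Fin N → M) :
    ∏ p : Fin N × Fin N with p.1 < p.2, F p.1 p.2 = ∏ i, ∏ j, if i < j then F i j else 1 := by
  rw [Finset.prod_filter, Fintype.prod_prod_type]

theorem prod_pairs_succ {M : Type*} [CommMonoid M] {N : ℕ} (F : Fin (N + 1) → Fin (N + 1) → M) :
    ∏ p : Fin (N + 1) × Fin (N + 1) with p.1 < p.2, F p.1 p.2 =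
      (∏ b : Fin N, F 0 b.succ) *
        ∏ p : Fin N × Fin N with p.1 < p.2, F p.1.succ p.2.succ := by
  rw [prod_pairs_eq_prod_prod, prod_pairs_eq_prod_prod fun i j : Fin N => F i.succ j.succ,
    Fin.prod_univ_succ, Fin.prod_univ_succ]
  congr 1
  · simp
  · refine Finset.prod_congr rfl fun i _ => ?_
    rw [Fin.prod_univ_succ]
    simp

theorem prod_erase_eq_succAbove {M : Type*} [CommMonoid M] {N : ℕ} (p : Fin (N + 1))
    (f : Fin (N + 1) → M) : ∏ j ∈ Finset.univ.erase p, f j = ∏ b, f (p.succAbove b) := by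
  have : Finset.univ.erase p = Finset.univ.image p.succAbove := by
    rw [Fin.image_succAbove_univ, Finset.compl_singleton]
  rw [this, Finset.prod_image fun _ _ _ _ h => Fin.succAbove_right_injective h]

/-- Comparison of the leading coefficients in the Lagrange interpolation of the polynomial
`∏ (s X - z_j)` at the nodes `0` and `z_k`. -/
theorem sum_prod_div {N : ℕ} {s : K} (hs0 : s ≠ 0) (hs1 : s - 1 ≠ 0) (z : Fin (N + 1) → K)
    (hz : Function.Injective z) (h0 : ∀ i, z i ≠ 0) :
    ∑ p, ∏ b, (s * z p - z (p.succAbove b)) / (z p - z (p.succAbove b)) =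
      (s ^ (N + 1) - 1) / (s - 1) := by
  classical
  let v : Fin (N + 2) → K := Fin.cons 0 z
  have hv : Function.Injective v :=
    Fin.cons_injective_iff.2 ⟨by rintro ⟨i, hi⟩; exact h0 i hi, hz⟩
  let P : Polynomial K := ∏ j, (Polynomial.C s * Polynomial.X + Polynomial.C (-z j))
  have hdeg : P.degree = (N + 1 : ℕ) := by
    rw [Polynomial.degree_prod]
    simp only [Polynomial.degree_linear hs0]
    simp
  have hlead : P.leadingCoeff = s ^ (N + 1) := by
    rw [Polynomial.leadingCoeff_prod]
    simp only [Polynomial.leadingCoeff_linear hs0]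
    simp
  have key := Lagrange.leadingCoeff_eq_sum (s := Finset.univ) (v := v) (hvs := hv.injOn) (P := P)
    (by rw [hdeg, Finset.card_univ, Fintype.card_fin]; norm_cast)
  have ev : ∀ x, P.eval x = ∏ j, (s * x - z j) := fun x => by
    simp [P, Polynomial.eval_prod, sub_eq_add_neg]
  -- the contributions of the node `0` and of the nodes `z k`
  have e0 : P.eval (v 0) / ∏ j ∈ Finset.univ.erase 0, (v 0 - v j) = 1 := by
    rw [ev, prod_erase_eq_succAbove]
    simp only [v, Fin.cons_zero, Fin.succAbove_zero, Fin.cons_succ, mul_zero, zero_sub]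
    exact div_self (Finset.prod_ne_zero_iff.2 fun i _ => neg_ne_zero.2 (h0 i))
  have e1 : ∀ k : Fin (N + 1),
      P.eval (v k.succ) / ∏ j ∈ Finset.univ.erase k.succ, (v k.succ - v j) =
        (s - 1) * ∏ b, (s * z k - z (k.succAbove b)) / (z k - z (k.succAbove b)) := by
    intro k
    have ed : ∏ b : Fin (N + 1), (v k.succ - v (k.succ.succAbove b)) =
        z k * ∏ b : Fin N, (z k - z (k.succAbove b)) := by
      rw [Fin.prod_univ_succ]
      simp only [v, Fin.succ_succAbove_zero, Fin.cons_zero, Fin.cons_succ, Fin.succ_succAbove_succ,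
        sub_zero]
    rw [ev, prod_erase_eq_succAbove, ed, Fin.prod_univ_succAbove _ k, Finset.prod_div_distrib]
    simp only [v, Fin.cons_succ]
    have hk := h0 k
    have : s * z k - z k = (s - 1) * z k := by ring
    rw [this]
    field_simp
  rw [hlead, Fin.sum_univ_succ, e0, Finset.sum_congr rfl fun k _ => e1 k, ← Finset.mul_sum] at key
  rw [key]
  field_simp
  ring

theorem poincareSym_succ (N : ℕ) (s : K) (hs : 1 - s ≠ 0) :
    poincareSym (N + 1) s = poincareSym N s * ((1 - s ^ (N + 1)) / (1 - s)) := by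
  rcases N with _ | N
  · simp [poincareSym, hs]
  · rw [poincareSym, Finset.prod_Icc_succ_top (by omega), poincareSym]

/-- The symmetrization of `∏ (s z_i - z_j) / (z_i - z_j)` is the Poincaré polynomial. -/
theorem sum_perm_prod_div {s : K} (hs0 : s ≠ 0) (hs1 : s - 1 ≠ 0) (N : ℕ) (z : Fin N → K)
    (hz : Function.Injective z) (h0 : ∀ i, z i ≠ 0) :
    ∑ σ : Equiv.Perm (Fin N), ∏ p : Fin N × Fin N with p.1 < p.2,
      (s * z (σ p.1) - z (σ p.2)) / (z (σ p.1) - z (σ p.2)) = poincareSym N s := by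
  have hs2 : 1 - s ≠ 0 := by rw [← neg_sub]; exact neg_ne_zero.2 hs1
  induction N with
  | zero => simp [poincareSym]
  | succ N ih =>
    rw [sum_perm_succ, poincareSym_succ N s hs2]
    have step : ∀ (p : Fin (N + 1)) (e : Equiv.Perm (Fin N)),
        (∏ x : Fin (N + 1) × Fin (N + 1) with x.1 < x.2,
          (s * z (consPerm p e x.1) - z (consPerm p e x.2)) /
            (z (consPerm p e x.1) - z (consPerm p e x.2))) =
        (∏ b, (s * z p - z (p.succAbove b)) / (z p - z (p.succAbove b))) *
          ∏ x : Fin N × Fin N with x.1 < x.2,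
            (s * z (p.succAbove (e x.1)) - z (p.succAbove (e x.2))) /
              (z (p.succAbove (e x.1)) - z (p.succAbove (e x.2))) := by
      intro p e
      rw [prod_pairs_succ fun i j => (s * z (consPerm p e i) - z (consPerm p e j)) /
        (z (consPerm p e i) - z (consPerm p e j))]
      simp only [consPerm_zero, consPerm_succ]
      congr 1
      exact Equiv.prod_comp e fun b => (s * z p - z (p.succAbove b)) / (z p - z (p.succAbove b))
    have inner : ∀ p : Fin (N + 1), ∑ e : Equiv.Perm (Fin N),
        (∏ x : Fin (N + 1) × Fin (N + 1) with x.1 < x.2,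
          (s * z (consPerm p e x.1) - z (consPerm p e x.2)) /
            (z (consPerm p e x.1) - z (consPerm p e x.2))) =
        (∏ b, (s * z p - z (p.succAbove b)) / (z p - z (p.succAbove b))) * poincareSym N s := by
      intro p
      rw [Finset.sum_congr rfl fun e _ => step p e, ← Finset.mul_sum,
        ih (fun i => z (p.succAbove i)) (hz.comp Fin.succAbove_right_injective) fun i => h0 _]
    rw [Finset.sum_congr rfl fun p _ => inner p, ← Finset.sum_mul, sum_prod_div hs0 hs1 z hz h0,
      mul_comm]
    congr 1
    rw [← neg_sub (s ^ (N + 1)) 1, ← neg_sub s 1, neg_div_neg_eq]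

/-- The number of inversions of a permutation of `Fin N`. -/
def permInv {N : ℕ} (σ : Equiv.Perm (Fin N)) : ℕ :=
  ∑ p : Fin N × Fin N with p.1 < p.2, if σ p.2 < σ p.1 then 1 else 0

theorem invLength_eq_permInv (σ : Equiv.Perm (Fin (n + 1))) : invLength σ = permInv σ := by
  rw [invLength, permInv, ← Finset.filter_filter, Finset.card_filter]

theorem pow_permInv {N : ℕ} (s : K) (σ : Equiv.Perm (Fin N)) : s ^ permInv σ =
    ∏ p : Fin N × Fin N with p.1 < p.2, if σ p.2 < σ p.1 then s else 1 := by
  rw [permInv, ← Finset.prod_pow_eq_pow_sum]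
  exact Finset.prod_congr rfl fun p _ => by split_ifs <;> simp

theorem pow_permInv_consPerm {N : ℕ} (s : K) (p : Fin (N + 1)) (e : Equiv.Perm (Fin N)) :
    s ^ permInv (consPerm p e) = s ^ (p : ℕ) * s ^ permInv e := by
  rw [pow_permInv, pow_permInv, prod_pairs_succ fun i j =>
    if consPerm p e j < consPerm p e i then s else 1]
  simp only [consPerm_zero, consPerm_succ, Fin.succAbove_lt_succAbove_iff]
  congr 1
  rw [Equiv.prod_comp e fun b => if p.succAbove b < p then s else 1, Finset.prod_ite,
    Finset.prod_const, Finset.prod_const_one, mul_one]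
  congr 1
  have : (Finset.univ.filter fun b => p.succAbove b < p) =
      Finset.univ.filter fun b : Fin N => (b : ℕ) < p := by
    ext b
    simp only [Finset.mem_filter, Finset.mem_univ, true_and, Fin.succAbove_lt_iff_castSucc_lt]
    rfl
  rw [this, Fin.card_filter_val_lt, min_eq_right (Nat.lt_succ_iff.1 p.isLt)]

/-- A family on `Fin N` whose level sets are intervals. -/
def HasIntervalFibers {N : ℕ} {α : Type*} (β : Fin N → α) : Prop :=
  ∀ i j k, i < j → j < k → β i = β k → β j = β i

theorem sum_pow_of_lower {N : ℕ} (s : K) (S : Finset (Fin N))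
    (hS : ∀ i ∈ S, ∀ j, j < i → j ∈ S) :
    ∑ p ∈ S, s ^ (p : ℕ) = ∑ t ∈ Finset.range S.card, s ^ t := by
  have hmap : S.map Fin.valEmbedding = Finset.range S.card := by
    have hsub : Finset.range S.card ⊆ S.map Fin.valEmbedding := by
      intro t ht
      rw [Finset.mem_range] at ht
      by_contra hne
      have : S ⊆ Finset.univ.filter fun b : Fin N => (b : ℕ) < t := by
        intro i hi
        rw [Finset.mem_filter]
        refine ⟨Finset.mem_univ _, ?_⟩
        by_contra hti
        apply hne
        rw [Finset.mem_map]
        rcases (not_lt.1 hti).eq_or_lt with e | hlt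
        · exact ⟨i, hi, e.symm⟩
        · exact ⟨⟨t, hlt.trans i.isLt⟩, hS i hi _ hlt, rfl⟩
      have := Finset.card_le_card this
      rw [Fin.card_filter_val_lt] at this
      have := min_le_right N t
      omega
    exact (Finset.eq_of_subset_of_card_le hsub (by simp)).symm
  rw [← hmap, Finset.sum_map]
  rfl

/-- The length generating function of the Young subgroup of the permutations which preserve the
level sets of `β`: the value at `i` can be chosen among the later positions of its level set. -/
theorem sum_pow_permInv {α : Type*} [DecidableEq α] (s : K) (N : ℕ) (β : Fin N → α)
    (hβ : HasIntervalFibers β) :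
    ∑ σ : Equiv.Perm (Fin N) with ∀ i, β (σ i) = β i, s ^ permInv σ =
      ∏ i, ∑ t ∈ Finset.range (Finset.card {j | i < j ∧ β j = β i} + 1), s ^ t := by
  induction N with
  | zero =>
    have : ∀ σ : Equiv.Perm (Fin 0), ∀ i, β (σ i) = β i := fun _ i => i.elim0
    simp [permInv, this]
  | succ N ih =>
    -- the value `p` at `0` has to lie in the level set of `0`, which is an initial segment, and the
    -- values which are shifted by its removal stay in their level sets
    have hcond : ∀ (p : Fin (N + 1)) (e : Equiv.Perm (Fin N)),
        (∀ i, β (consPerm p e i) = β i) ↔ β p = β 0 ∧ ∀ i, β (e i).succ = β i.succ := by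
      intro p e
      rw [Fin.forall_fin_succ, consPerm_zero]
      refine and_congr_right fun hp => forall_congr' fun i => ?_
      rw [consPerm_succ]
      have : β (p.succAbove (e i)) = β (e i).succ := by
        rcases lt_or_ge (e i).castSucc p with hlt | hge
        · rw [Fin.succAbove_of_castSucc_lt _ _ hlt]
          have low : ∀ k, k ≤ p → β k = β 0 := by
            intro k hk
            rcases eq_or_ne k 0 with rfl | hk0
            · rfl
            rcases hk.eq_or_lt with rfl | hk
            · exact hp
            · exact hβ 0 k p (Fin.pos_of_ne_zero hk0) hk hp.symm
          rw [low _ hlt.le, low (e i).succ (by rw [Fin.le_def, Fin.val_succ]; exact hlt)]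
        · rw [Fin.succAbove_of_le_castSucc _ _ hge]
      rw [this]
    have hβ' : HasIntervalFibers fun i => β i.succ := fun i j k hij hjk h =>
      hβ _ _ _ (Fin.succ_lt_succ_iff.2 hij) (Fin.succ_lt_succ_iff.2 hjk) h
    rw [Finset.sum_filter, sum_perm_succ]
    simp only [hcond, pow_permInv_consPerm]
    have e1 : ∀ p : Fin (N + 1), (∑ e : Equiv.Perm (Fin N),
        if β p = β 0 ∧ ∀ i, β (e i).succ = β i.succ then s ^ (p : ℕ) * s ^ permInv e else 0) =
        (if β p = β 0 then s ^ (p : ℕ) else 0) *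
          ∑ e : Equiv.Perm (Fin N) with ∀ i, β (e i).succ = β i.succ, s ^ permInv e := by
      intro p
      by_cases hp : β p = β 0
      · simp only [hp, true_and, if_true]
        rw [Finset.mul_sum, Finset.sum_filter]
      · simp [hp]
    rw [Finset.sum_congr rfl fun p _ => e1 p, ← Finset.sum_mul, ih _ hβ', Fin.prod_univ_succ,
      ← Finset.sum_filter]
    congr 1
    · rw [sum_pow_of_lower]
      · congr 2
        have : (Finset.univ.filter fun p => β p = β 0) =
            insert 0 (Finset.univ.filter fun p => 0 < p ∧ β p = β 0) := by
          ext p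
          simp only [Finset.mem_filter, Finset.mem_univ, true_and, Finset.mem_insert]
          rcases eq_or_ne p 0 with rfl | hp
          · simp
          · simp [hp, Fin.pos_of_ne_zero hp]
        rw [this, Finset.card_insert_of_notMem (by simp)]
      · intro i hi j hj
        simp only [Finset.mem_filter, Finset.mem_univ, true_and] at hi ⊢
        rcases eq_or_ne j 0 with rfl | hj0
        · rfl
        · exact hβ 0 j i (Fin.pos_of_ne_zero hj0) hj hi.symm
    · refine Finset.prod_congr rfl fun i _ => ?_
      congr 3
      rw [← Finset.card_map (Fin.succEmb N)]
      congr 1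
      ext j
      simp only [Finset.mem_map, Finset.mem_filter, Finset.mem_univ, true_and, Fin.coe_succEmb]
      constructor
      · rintro ⟨k, ⟨h1, h2⟩, rfl⟩
        exact ⟨Fin.succ_lt_succ_iff.2 h1, h2⟩
      · rintro ⟨h1, h2⟩
        obtain ⟨k, rfl⟩ := Fin.exists_succ_eq.2 (Fin.ne_zero_of_lt h1)
        exact ⟨k, ⟨Fin.succ_lt_succ_iff.1 h1, h2⟩, rfl⟩

/-- A telescoping product over a set `S` of natural numbers which is an interval ending just
before `c`. -/
theorem prod_telescope {s : K} (hs : NonRoot s) (S : Finset ℕ) (c : ℕ) (h1 : ∀ x ∈ S, x < c)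
    (h2 : ∀ x ∈ S, ∀ y, x ≤ y → y < c → y ∈ S) :
    ∏ x ∈ S, (1 - s ^ (c - x + 1)) / (1 - s ^ (c - x)) =
      ∑ t ∈ Finset.range (S.card + 1), s ^ t := by
  obtain ⟨m, hm⟩ : ∃ m, m ≤ c ∧ S = Finset.Ico m c := by
    rcases S.eq_empty_or_nonempty with rfl | hne
    · exact ⟨c, le_rfl, by simp⟩
    · refine ⟨S.min' hne, (h1 _ (S.min'_mem hne)).le, ?_⟩
      ext y
      rw [Finset.mem_Ico]
      exact ⟨fun hy => ⟨S.min'_le y hy, h1 y hy⟩, fun hy => h2 _ (S.min'_mem hne) y hy.1 hy.2⟩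
  obtain ⟨hmc, rfl⟩ := hm
  obtain ⟨k, rfl⟩ := Nat.exists_eq_add_of_le hmc
  have e : ∀ k : ℕ, 1 - s ^ (k + 1) ≠ 0 := fun k => by
    have := hs.one_sub_zpow (m := (k + 1 : ℕ)) (by omega)
    rwa [zpow_natCast] at this
  have hg : ∑ t ∈ Finset.range (k + 1), s ^ t = (1 - s ^ (k + 1)) / (1 - s) := by
    rw [eq_div_iff hs.one_sub]
    exact geom_sum_mul_neg s (k + 1)
  rw [Nat.card_Ico, Nat.add_sub_cancel_left, hg, Finset.prod_Ico_eq_prod_range,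
    Nat.add_sub_cancel_left, ← Finset.prod_range_reflect]
  clear hg h1 h2 hmc
  have : ∏ j ∈ Finset.range k, (1 - s ^ (m + k - (m + (k - 1 - j)) + 1)) /
      (1 - s ^ (m + k - (m + (k - 1 - j)))) =
      ∏ j ∈ Finset.range k, (1 - s ^ (j + 1 + 1)) / (1 - s ^ (j + 1)) := by
    refine Finset.prod_congr rfl fun j hj => ?_
    rw [Finset.mem_range] at hj
    rw [show m + k - (m + (k - 1 - j)) = j + 1 by omega]
  rw [this]
  induction k with
  | zero => simp [div_self hs.one_sub]
  | succ k ih =>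
    have h1 := e k
    have h2 := hs.one_sub
    rw [Finset.prod_range_succ, ih ?_]
    · field_simp
    · exact Finset.prod_congr rfl fun j hj => by
        rw [Finset.mem_range] at hj
        rw [show m + k - (m + (k - 1 - j)) = j + 1 by omega]

/-! ### The order of the labels at the root and at the sink of a component -/

/-- The order in which the labels occur at the root of a component: by increasing value, equal
values column by column from the last column, and in a column from the bottom. -/
def RootLt (l l' : Label lam) : Prop :=
  l.1 < l'.1 ∨ (l.1 = l'.1 ∧
    (l'.2.1.2 < l.2.1.2 ∨ (l'.2.1.2 = l.2.1.2 ∧ l'.2.1.1 < l.2.1.1)))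

/-- The order in which the labels occur at the sink of a component: by decreasing value, equal
values row by row from the last row, and in a row from the right. -/
def SinkLt (l l' : Label lam) : Prop :=
  l'.1 < l.1 ∨ (l.1 = l'.1 ∧
    (l'.2.1.1 < l.2.1.1 ∨ (l'.2.1.1 = l.2.1.1 ∧ l'.2.1.2 < l.2.1.2)))

theorem RootLt.trans {l l' l'' : Label lam} (h : RootLt l l') (h' : RootLt l' l'') :
    RootLt l l'' := by unfold RootLt at *; omega

theorem SinkLt.trans {l l' l'' : Label lam} (h : SinkLt l l') (h' : SinkLt l' l'') :
    SinkLt l l'' := by unfold SinkLt at *; omega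

theorem RootLt.asymm {l l' : Label lam} (h : RootLt l l') : ¬ RootLt l' l := by
  unfold RootLt at *; omega

theorem SinkLt.asymm {l l' : Label lam} (h : SinkLt l l') : ¬ SinkLt l' l := by
  unfold SinkLt at *; omega

instance : IsTrans (Label lam) RootLt := ⟨fun _ _ _ => RootLt.trans⟩

instance : IsTrans (Label lam) SinkLt := ⟨fun _ _ _ => SinkLt.trans⟩

/-- Adjacent labels are in the order of the root, in the order of the sink, or in both of them; the
last case occurs exactly when there is no arrow in either direction. -/
theorem Vertex.lab_order (x : Vertex n lam) (i : Fin n) :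
    (UpRel (x.lab i.castSucc) (x.lab i.succ) ∧ RootLt (x.lab i.castSucc) (x.lab i.succ) ∧
      SinkLt (x.lab i.succ) (x.lab i.castSucc)) ∨
    (UpRel (x.lab i.succ) (x.lab i.castSucc) ∧ RootLt (x.lab i.succ) (x.lab i.castSucc) ∧
      SinkLt (x.lab i.castSucc) (x.lab i.succ)) ∨
    (AdjRel (x.lab i.castSucc) (x.lab i.succ) ∧ RootLt (x.lab i.castSucc) (x.lab i.succ) ∧
      SinkLt (x.lab i.castSucc) (x.lab i.succ)) := by
  rcases lt_trichotomy (x.vec i.castSucc) (x.vec i.succ) with h | h | h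
  · exact Or.inl ⟨Or.inl h, Or.inl h, Or.inl h⟩
  · have e : (x.lab i.castSucc).1 = (x.lab i.succ).1 := h
    have c := x.tab.consecutive_cases (rank_succ_of_eq h)
    have hct : ∀ k, (x.lab k).ct = x.tab.ct (rank x.vec k) := fun _ => rfl
    have hrow : ∀ k, (x.lab k).2.1.1 = x.tab.row (rank x.vec k) := fun _ => rfl
    have hcol : ∀ k, (x.lab k).2.1.2 = x.tab.col (rank x.vec k) := fun _ => rfl
    unfold UpRel RootLt SinkLt AdjRel
    rw [hct, hct, hrow, hrow, hcol, hcol]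
    omega
  · exact Or.inr (Or.inl ⟨Or.inl h, Or.inl h, Or.inl h⟩)

theorem Vertex.rootLt_of_up {x : Vertex n lam} {i : Fin n}
    (h : UpRel (x.lab i.castSucc) (x.lab i.succ)) : RootLt (x.lab i.castSucc) (x.lab i.succ) := by
  rcases x.lab_order i with h' | h' | h'
  · exact h'.2.1
  · exact absurd h'.1 h.asymm
  · exact h'.2.1

theorem Vertex.forall_rootLt {x : Vertex n lam} (h : ∀ i y, ¬ Arrow i y x) {a b : Fin (n + 1)}
    (hab : a < b) : RootLt (x.lab a) (x.lab b) := by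
  refine (Fin.liftFun_iff_succ RootLt (f := x.lab)).2 (fun i => ?_) hab
  rcases x.lab_order i with h' | h' | h'
  · exact h'.2.1
  · exact absurd (arrow_iff'.2 ⟨h'.1, rfl⟩) (h i _)
  · exact h'.2.1

theorem Vertex.forall_sinkLt {x : Vertex n lam} (h : ∀ i y, ¬ Arrow i x y) {a b : Fin (n + 1)}
    (hab : a < b) : SinkLt (x.lab a) (x.lab b) := by
  refine (Fin.liftFun_iff_succ SinkLt (f := x.lab)).2 (fun i => ?_) hab
  rcases x.lab_order i with h' | h' | h'
  · exact absurd (arrow_iff.2 ⟨h'.1, rfl⟩) (h i _)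
  · exact h'.2.2
  · exact h'.2.2

/-! ### The vertices of a component as orderings of the cells -/

/-- The label of the cell `c` in the component of the filling `T`. -/
def mkLabel (T : ℕ × ℕ → ℕ) (c : {c : ℕ × ℕ // c ∈ lam.cells}) : Label lam := (T c.1, c)

/-- The ordering of the cells defined by a vertex. -/
def Vertex.cellEquiv (x : Vertex n lam) : Fin (n + 1) ≃ {c : ℕ × ℕ // c ∈ lam.cells} :=
  Equiv.ofBijective _ x.lab_snd_bijective

/-- `r_v[i]` is a position of the value `v[i]` in the decreasing rearrangement of `v`. -/
theorem decr_rank (v : Fin (n + 1) → ℕ) (i : Fin (n + 1)) : decr v (rank v i) = v i := by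
  let e := Equiv.ofBijective _ (rank_bijective v)
  let σ : Equiv.Perm (Fin (n + 1)) := Fin.revPerm.trans e.symm
  have hmono : Monotone (v ∘ σ) := by
    intro i j hij
    by_contra hlt
    have hlt : v (σ j) < v (σ i) := not_le.1 hlt
    have h1 := rank_lt (v := v) (i := σ i) (j := σ j) (Or.inl hlt)
    have h2 : ∀ k, rank v (σ k) = k.rev := fun k => e.apply_symm_apply k.rev
    rw [h2, h2, Fin.rev_lt_rev] at h1
    exact absurd hij (not_le.2 h1)
  have h := congrFun (Tuple.comp_sort_eq_comp_iff_monotone.2 hmono) (rank v i).rev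
  simp only [Function.comp_apply] at h
  rw [decr, ← h]
  congr 1
  change e.symm ((rank v i).rev.rev) = i
  rw [Fin.rev_rev]
  exact e.symm_apply_apply i

/-- A vertex belongs to the component of `T` if and only if the value of each of its labels is the
entry of `T` in the cell of this label. -/
theorem mem_component_iff {T : ℕ × ℕ → ℕ} {x : Vertex n lam} :
    x ∈ component n lam T ↔ ∀ i, x.lab i = mkLabel T (x.cellEquiv i) := by
  change (∀ k, T (x.tab.cell k).1 = decr x.vec k) ↔ _
  rw [(rank_bijective x.vec).surjective.forall]
  refine forall_congr' fun i => ?_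
  rw [decr_rank]
  constructor
  · intro h
    exact Prod.ext h.symm rfl
  · intro h
    exact (congrArg Prod.fst h).symm

theorem sw_mem_component {T : ℕ × ℕ → ℕ} {x : Vertex n lam} {i : Fin n}
    (h : UpRel (x.lab i.castSucc) (x.lab i.succ) ∨ UpRel (x.lab i.succ) (x.lab i.castSucc))
    (hx : x ∈ component n lam T) : x.sw i ∈ component n lam T := by
  rw [mem_component_iff] at hx ⊢
  intro k
  have e : (x.sw i).cellEquiv k = x.cellEquiv (Equiv.swap i.castSucc i.succ k) :=
    congrArg Prod.snd (Vertex.sw_lab h k)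
  rw [Vertex.sw_lab h, hx, e]

/-- Every vertex of a component is reached from a root. -/
theorem component_induction {T : ℕ × ℕ → ℕ} {p : ∀ x : Vertex n lam, x ∈ component n lam T → Prop}
    (hroot : ∀ x (hx : IsRoot T x), p x hx.1)
    (harrow : ∀ i x hx (h : UpRel (x.lab i.castSucc) (x.lab i.succ)), p x hx →
      p (x.sw i) (sw_mem_component (Or.inl h) hx))
    (x : Vertex n lam) (hx : x ∈ component n lam T) : p x hx := by
  induction x using Vertex.graph_induction with
  | h x ih =>
  by_cases h : ∀ i y, ¬ Arrow i y x
  · exact hroot x ⟨hx, h⟩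
  · push Not at h
    obtain ⟨i, y, hy⟩ := h
    obtain ⟨hup, rfl⟩ := arrow_iff'.1 hy
    have hl := fun k => Vertex.sw_lab (Or.inr hup) k
    have hm := sw_mem_component (Or.inr hup) hx
    have := harrow i (x.sw i) hm (by
      rwa [hl, hl, Equiv.swap_apply_left, Equiv.swap_apply_right])
      (ih _ (Vertex.smaller_sw hup) hm)
    simpa only [Vertex.sw_sw (Or.inr hup)] using this

theorem cellEquiv_injOn (T : ℕ × ℕ → ℕ) :
    Set.InjOn Vertex.cellEquiv (component n lam T) := by
  intro x hx y hy h
  rw [mem_component_iff] at hx hy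
  apply Vertex.lab_injective
  funext i
  rw [hx, hy, h]

/-- Both vertices order the same labels by the strict order `RootLt`. -/
theorem IsRoot.unique {T : ℕ × ℕ → ℕ} {x y : Vertex n lam} (hx : IsRoot T x) (hy : IsRoot T y) :
    x = y := by
  apply cellEquiv_injOn T hx.1 hy.1
  let e : Equiv.Perm (Fin (n + 1)) := x.cellEquiv.trans y.cellEquiv.symm
  have he : ∀ i, x.lab i = y.lab (e i) := fun i => by
    rw [mem_component_iff.1 hx.1, mem_component_iff.1 hy.1]
    congr 1
    exact (y.cellEquiv.apply_symm_apply _).symm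
  have hmono : StrictMono e := by
    intro i j hij
    have h1 := Vertex.forall_rootLt hx.2 hij
    rw [he, he] at h1
    by_contra hlt
    rcases (not_lt.1 hlt).eq_or_lt with h | h
    · exact hij.ne' (e.injective h)
    · exact h1.asymm (Vertex.forall_rootLt hy.2 h)
  have h : hmono.orderIsoOfSurjective e e.surjective = OrderIso.refl _ := Subsingleton.elim _ _
  ext1 i
  have : e i = i := congrArg (fun f : Fin (n + 1) ≃o Fin (n + 1) => f i) h
  rw [← y.cellEquiv.apply_symm_apply (x.cellEquiv i)]
  exact congrArg y.cellEquiv this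

/-- An ordering of the cells comes from a vertex of the component of `T` provided that the cells of
each row and of each column with equal values occur in decreasing order. -/
theorem exists_vertex {T : ℕ × ℕ → ℕ} (w : Fin (n + 1) ≃ {c : ℕ × ℕ // c ∈ lam.cells})
    (H : ∀ c d : {c : ℕ × ℕ // c ∈ lam.cells},
      (c.1.1 = d.1.1 ∧ c.1.2 < d.1.2) ∨ (c.1.2 = d.1.2 ∧ c.1.1 < d.1.1) →
        T c.1 < T d.1 ∨ (T c.1 = T d.1 ∧ w.symm d < w.symm c)) :
    ∃ x ∈ component n lam T, x.cellEquiv = w := by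
  let v : Fin (n + 1) → ℕ := fun i => T (w i).1
  let e := Equiv.ofBijective _ (rank_bijective v)
  have key : ∀ k l : Fin (n + 1),
      ((w (e.symm k)).1.1 = (w (e.symm l)).1.1 ∧ (w (e.symm k)).1.2 < (w (e.symm l)).1.2) ∨
      ((w (e.symm k)).1.2 = (w (e.symm l)).1.2 ∧ (w (e.symm k)).1.1 < (w (e.symm l)).1.1) →
        l < k := by
    intro k l h
    have h' := H _ _ h
    rw [w.symm_apply_apply, w.symm_apply_apply] at h'
    have : Before v (e.symm l) (e.symm k) := by
      rcases h' with h' | h'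
      · exact Or.inl h'
      · exact Or.inr ⟨h'.1.symm, h'.2⟩
    have := rank_lt this
    have h2 : ∀ k, rank v (e.symm k) = k := fun k => e.apply_symm_apply k
    rwa [h2, h2] at this
  let x : Vertex n lam := ⟨⟨e.symm.trans w, fun k l h1 h2 => key k l (Or.inl ⟨h1, h2⟩),
    fun k l h1 h2 => key k l (Or.inr ⟨h1, h2⟩)⟩, v⟩
  have hx : ∀ i, x.cellEquiv i = w i := fun i => congrArg w (e.symm_apply_apply i)
  refine ⟨x, ?_, Equiv.ext hx⟩
  rw [mem_component_iff]
  intro i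
  refine Prod.ext ?_ rfl
  change T (w i).1 = T (x.cellEquiv i).1
  rw [hx]

/-! ### Products over inversions -/

open Classical in
/-- The product of `G` over the pairs of labels which are exchanged relatively to the root. -/
def invProd (G : Label lam → Label lam → K) (x : Vertex n lam) : K :=
  ∏ p : Fin (n + 1) × Fin (n + 1) with p.1 < p.2,
    if RootLt (x.lab p.2) (x.lab p.1) then G (x.lab p.2) (x.lab p.1) else 1

/-- The product of `W` over all pairs of labels, in the order given by the vertex. -/
def pairProd (W : Label lam → Label lam → K) (x : Vertex n lam) : K :=
  ∏ p : Fin (n + 1) × Fin (n + 1) with p.1 < p.2, W (x.lab p.1) (x.lab p.2)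

theorem invProd_sw (G : Label lam → Label lam → K) {x : Vertex n lam} {i : Fin n}
    (h : UpRel (x.lab i.castSucc) (x.lab i.succ)) :
    invProd G (x.sw i) = G (x.lab i.castSucc) (x.lab i.succ) * invProd G x := by
  classical
  have key := prod_pairs_swap
    (fun l l' : Label lam => if RootLt l' l then G l' l else 1) x.lab i
  have hr := Vertex.rootLt_of_up h
  simp only [if_pos hr, if_neg hr.asymm, mul_one] at key
  rw [invProd, invProd, mul_comm, ← key]
  simp only [Vertex.sw_lab (Or.inl h)]

theorem pairProd_sw (W : Label lam → Label lam → K) {x : Vertex n lam} {i : Fin n}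
    (h : UpRel (x.lab i.castSucc) (x.lab i.succ)) :
    pairProd W (x.sw i) * W (x.lab i.castSucc) (x.lab i.succ) =
      pairProd W x * W (x.lab i.succ) (x.lab i.castSucc) := by
  have key := prod_pairs_swap W x.lab i
  rw [pairProd, pairProd, ← key]
  simp only [Vertex.sw_lab (Or.inl h)]

theorem invProd_root (G : Label lam → Label lam → K) {T : ℕ × ℕ → ℕ} {x : Vertex n lam}
    (h : IsRoot T x) : invProd G x = 1 := by
  refine Finset.prod_eq_one fun p hp => ?_
  rw [Finset.mem_filter] at hp
  rw [if_neg (Vertex.forall_rootLt h.2 hp.2).asymm]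

/-- The factor of the coefficients `b` along an arrow. -/
def symFactor (q s : K) (l l' : Label lam) : K :=
  (l.spec q s - l'.spec q s) / (s * l.spec q s - l'.spec q s)

/-- The factor of the coefficients `b^a` along an arrow. -/
def antiFactor (q s : K) (l l' : Label lam) : K :=
  -((l.spec q s - l'.spec q s) / (l.spec q s - s * l'.spec q s))

theorem symCoeff_eq (q s : K) {T : ℕ × ℕ → ℕ} {x : Vertex n lam} (hx : x ∈ component n lam T) :
    symCoeff q s T x = invProd (symFactor q s) x := by
  have h1 : ∀ b, IsSymCoeff q s T x b → b = invProd (symFactor q s) x := by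
    intro b hb
    clear hx
    induction hb with
    | root x hx => rw [invProd_root _ hx]
    | arrow i x y b hb h ih =>
      obtain ⟨hup, rfl⟩ := arrow_iff.1 h
      rw [invProd_sw _ hup, ih]
      rfl
  have h2 : ∃ b, IsSymCoeff q s T x b := by
    clear h1
    induction x, hx using component_induction with
    | hroot x hx => exact ⟨1, .root x hx⟩
    | harrow i x hx h ih =>
      obtain ⟨b, hb⟩ := ih
      exact ⟨_, .arrow i x _ b hb (arrow_iff.2 ⟨h, rfl⟩)⟩
  rw [symCoeff, dif_pos h2]
  exact h1 _ h2.choose_spec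

theorem antiCoeff_eq (q s : K) {T : ℕ × ℕ → ℕ} {x : Vertex n lam} (hx : x ∈ component n lam T) :
    antiCoeff q s T x = invProd (antiFactor q s) x := by
  have h1 : ∀ b, IsAntiCoeff q s T x b → b = invProd (antiFactor q s) x := by
    intro b hb
    clear hx
    induction hb with
    | root x hx => rw [invProd_root _ hx]
    | arrow i x y b hb h ih =>
      obtain ⟨hup, rfl⟩ := arrow_iff.1 h
      rw [invProd_sw _ hup, ih]
      rfl
  have h2 : ∃ b, IsAntiCoeff q s T x b := by
    clear h1
    induction x, hx using component_induction with
    | hroot x hx => exact ⟨1, .root x hx⟩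
    | harrow i x hx h ih =>
      obtain ⟨b, hb⟩ := ih
      exact ⟨_, .arrow i x _ b hb (arrow_iff.2 ⟨h, rfl⟩)⟩
  rw [antiCoeff, dif_pos h2]
  exact h1 _ h2.choose_spec

/-- The parity of the distance from the root is the parity of the number of exchanged pairs. -/
theorem neg_one_pow_pathLength {T : ℕ × ℕ → ℕ} {r x : Vertex n lam} (hr : IsRoot T r)
    (hx : x ∈ component n lam T) :
    (-1 : K) ^ pathLength r x = invProd (fun _ _ => -1) x := by
  have h1 : ∀ d y, HPath d r y → (-1 : K) ^ d = invProd (fun _ _ => -1) y := by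
    intro d y h
    have : invProd (fun _ _ => -1) y = (-1 : K) ^ d * invProd (fun _ _ => -1) r := by
      clear hr
      induction h with
      | nil x => simp
      | cons d i x y z h h' ih =>
        obtain ⟨hup, rfl⟩ := arrow_iff.1 h'
        rw [invProd_sw _ hup, ih, pow_succ']
        ring
    rw [this, invProd_root _ hr, mul_one]
  have h2 : ∃ d, HPath d r x := by
    induction x, hx using component_induction with
    | hroot x hx => obtain rfl := hr.unique hx; exact ⟨0, .nil r⟩
    | harrow i x hx h ih =>
      obtain ⟨d, hd⟩ := ih
      exact ⟨_, .cons d i _ _ _ hd (arrow_iff.2 ⟨h, rfl⟩)⟩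
  exact h1 _ _ (Nat.sInf_mem (s := {d | HPath d r x}) h2)

/-! ### The Poincaré polynomial of the stabilizer of a filling -/

/-- The cells of a Young diagram, as a type. -/
abbrev Cell (lam : YoungDiagram) : Type := {c : ℕ × ℕ // c ∈ lam.cells}

/-- The order of the cells opposite to the numbering `std`. -/
def StdLt (T : ℕ × ℕ → ℕ) (c d : ℕ × ℕ) : Prop :=
  T c < T d ∨ (T d = T c ∧ (c.1 < d.1 ∨ (d.1 = c.1 ∧ c.2 < d.2)))

open Classical in
theorem std_eq (T : ℕ × ℕ → ℕ) (c : ℕ × ℕ) :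
    std lam T c = Finset.card {d ∈ lam.cells | StdLt T c d ∨ c = d} := by
  have h1 : Disjoint {d ∈ lam.cells | T c < T d} {d ∈ lam.cells | c.1 < d.1 ∧ T d = T c} := by
    rw [Finset.disjoint_filter]; intro d _ h; omega
  have h2 : Disjoint ({d ∈ lam.cells | T c < T d} ∪ {d ∈ lam.cells | c.1 < d.1 ∧ T d = T c})
      {d ∈ lam.cells | d.1 = c.1 ∧ c.2 ≤ d.2 ∧ T d = T c} := by
    rw [← Finset.filter_or, Finset.disjoint_filter]; intro d _ h; omega
  rw [std, ← Finset.card_union_of_disjoint h1, ← Finset.card_union_of_disjoint h2,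
    ← Finset.filter_or, ← Finset.filter_or]
  congr 1
  refine Finset.filter_congr fun d _ => ?_
  unfold StdLt
  constructor
  · rintro ((h | h) | h)
    · omega
    · omega
    · by_cases hc : c.2 = d.2
      · exact Or.inr (Prod.ext h.1.symm hc)
      · omega
  · rintro (h | rfl)
    · omega
    · exact Or.inr ⟨rfl, le_rfl, rfl⟩

theorem std_lt {T : ℕ × ℕ → ℕ} {c d : ℕ × ℕ} (hc : c ∈ lam.cells) (h : StdLt T c d) :
    std lam T d < std lam T c := by
  classical
  rw [std_eq, std_eq]
  refine Finset.card_lt_card ((Finset.ssubset_iff_of_subset ?_).2 ⟨c, ?_, ?_⟩)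
  · intro e
    simp only [Finset.mem_filter]
    rintro ⟨he, h' | rfl⟩
    · refine ⟨he, Or.inl ?_⟩
      unfold StdLt at *; omega
    · exact ⟨he, Or.inl h⟩
  · simp [hc]
  · simp only [Finset.mem_filter, not_and, not_or]
    refine fun _ => ⟨?_, ?_⟩
    · unfold StdLt at *; omega
    · rintro rfl; unfold StdLt at h; omega

theorem stdLt_or {T : ℕ × ℕ → ℕ} {c d : ℕ × ℕ} (h : c ≠ d) : StdLt T c d ∨ StdLt T d c := by
  by_contra hn
  apply h
  unfold StdLt at hn
  ext <;> omega

theorem one_le_std {T : ℕ × ℕ → ℕ} {c : ℕ × ℕ} (hc : c ∈ lam.cells) :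
    1 ≤ std lam T c ∧ std lam T c ≤ lam.card := by
  classical
  rw [std_eq]
  exact ⟨Finset.card_pos.2 ⟨c, by simp [hc]⟩, Finset.card_filter_le _ _⟩

/-- The numbering `std` as a bijection, with the numbers starting at `0`. -/
theorem exists_stdEquiv (hlam : lam.card = n + 1) (T : ℕ × ℕ → ℕ) :
    ∃ e : Cell lam ≃ Fin (n + 1), ∀ c, std lam T c.1 = e c + 1 := by
  let f : Cell lam → Fin (n + 1) := fun c => ⟨std lam T c.1 - 1, by
    have := one_le_std (T := T) c.2; omega⟩
  have hf : ∀ c, std lam T c.1 = f c + 1 := fun c => by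
    have := one_le_std (T := T) c.2
    simp only [f]
    omega
  have hinj : Function.Injective f := by
    intro c d h
    by_contra hne
    have e : std lam T c.1 = std lam T d.1 := by rw [hf, hf, h]
    rcases stdLt_or (T := T) (fun h => hne (Subtype.ext h)) with h' | h'
    · exact (std_lt c.2 h').ne' e
    · exact (std_lt d.2 h').ne e
  have hbij : Function.Bijective f := by
    rw [Fintype.bijective_iff_injective_and_card]
    refine ⟨hinj, ?_⟩
    rw [Fintype.card_coe, Fintype.card_fin]
    exact hlam
  exact ⟨Equiv.ofBijective f hbij, hf⟩

/-- The group of the filling is a Young subgroup with one factor for each set of equal entries of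
a row, and its Poincaré polynomial is the product over the cells of the numbers `1 + s + … + s^r`,
where `r` is the number of equal entries to the left. -/
theorem poincare_eq_prod_sum (hlam : lam.card = n + 1) (T : ℕ × ℕ → ℕ) (s : K) :
    poincare n lam T s = ∏ c : Cell lam, ∑ t ∈ Finset.range (Finset.card
      {d : Cell lam | d.1.1 = c.1.1 ∧ T d.1 = T c.1 ∧ d.1.2 < c.1.2} + 1), s ^ t := by
  classical
  obtain ⟨e, he⟩ := exists_stdEquiv hlam T
  have hlt : ∀ c d : Cell lam, e c < e d ↔ StdLt T d.1 c.1 := by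
    intro c d
    have key : ∀ c d : Cell lam, StdLt T d.1 c.1 → e c < e d := fun c d h => by
      have := std_lt d.2 h
      rw [he, he] at this
      exact Fin.lt_def.2 (by omega)
    refine ⟨fun h => ?_, key c d⟩
    rcases stdLt_or (T := T) (c := d.1) (d := c.1)
      (fun h' => h.ne (by rw [Subtype.ext h'])) with h' | h'
    · exact h'
    · exact absurd h (key d c h').asymm
  let β : Fin (n + 1) → ℕ × ℕ := fun k => ((e.symm k).1.1, T (e.symm k).1)
  have hβe : ∀ c, β (e c) = (c.1.1, T c.1) := fun c => by simp [β]
  have hβ : HasIntervalFibers β := by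
    intro i j k hij hjk h
    obtain ⟨a, rfl⟩ := e.surjective i
    obtain ⟨b, rfl⟩ := e.surjective j
    obtain ⟨c, rfl⟩ := e.surjective k
    rw [hlt] at hij hjk
    rw [hβe, hβe, Prod.mk.injEq] at *
    unfold StdLt at *
    omega
  have hst : ∀ σ, InStabilizer n lam T σ ↔ ∀ k, β (σ k) = β k := by
    intro σ
    constructor
    · intro h k
      have := h (e.symm k).1 (e.symm k).2 (e.symm (σ k)).1 (e.symm (σ k)).2 k
        (by rw [he, e.apply_symm_apply]) (by rw [he, e.apply_symm_apply])
      exact Prod.ext this.1.symm this.2.symm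
    · intro h c hc d hd k h1 h2
      have e1 : e ⟨c, hc⟩ = k := Fin.ext (by
        have : std lam T c = e ⟨c, hc⟩ + 1 := he ⟨c, hc⟩
        omega)
      have e2 : e ⟨d, hd⟩ = σ k := Fin.ext (by
        have : std lam T d = e ⟨d, hd⟩ + 1 := he ⟨d, hd⟩
        omega)
      have := h k
      rw [← e2, ← e1, hβe, hβe, Prod.mk.injEq] at this
      exact ⟨this.1.symm, this.2.symm⟩
  have h1 : poincare n lam T s =
      ∑ σ : Equiv.Perm (Fin (n + 1)) with ∀ i, β (σ i) = β i, s ^ permInv σ := by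
    rw [poincare]
    refine Finset.sum_congr ?_ fun σ _ => by rw [invLength_eq_permInv]
    ext σ
    simp only [Finset.mem_filter, Finset.mem_univ, true_and, hst]
  rw [h1, sum_pow_permInv s (n + 1) β hβ, ← Equiv.prod_comp e]
  refine Finset.prod_congr rfl fun c _ => ?_
  congr 3
  rw [← Finset.card_map e.toEmbedding]
  congr 1
  ext j
  obtain ⟨d, rfl⟩ := e.surjective j
  simp only [Finset.mem_map, Finset.mem_filter, Finset.mem_univ, true_and, Equiv.coe_toEmbedding,
    e.injective.eq_iff, exists_eq_right, hlt, hβe, Prod.mk.injEq]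
  unfold StdLt
  omega

/-- The contribution to a Poincaré polynomial of two cells at distance `k` in a row. -/
def hookFactor (s : K) (k : ℕ) : K := (1 - s ^ (k + 1)) / (1 - s ^ k)

/-- If equal entries of a row are adjacent, then `1 + s + … + s^r` is a telescoping product of
quotients over the equal entries to the left, which can be compared with the weights of pairs. -/
theorem poincare_eq_prod (hlam : lam.card = n + 1) {T : ℕ × ℕ → ℕ} {s : K} (hs : NonRoot s)
    (hT : ∀ c ∈ lam.cells, ∀ d ∈ lam.cells, c.1 = d.1 → c.2 < d.2 → T c ≤ T d) :
    poincare n lam T s = ∏ c : Cell lam, ∏ d : Cell lam,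
      if d.1.1 = c.1.1 ∧ T d.1 = T c.1 ∧ d.1.2 < c.1.2 then hookFactor s (c.1.2 - d.1.2)
      else 1 := by
  classical
  rw [poincare_eq_prod_sum hlam]
  refine Finset.prod_congr rfl fun c _ => ?_
  rw [← Finset.prod_filter]
  set S := Finset.univ.filter fun d : Cell lam =>
    d.1.1 = c.1.1 ∧ T d.1 = T c.1 ∧ d.1.2 < c.1.2 with hS
  have hmem : ∀ d, d ∈ S ↔ d.1.1 = c.1.1 ∧ T d.1 = T c.1 ∧ d.1.2 < c.1.2 := by simp [hS]
  have hinj : Set.InjOn (fun d : Cell lam => d.1.2) S := by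
    intro d hd d' hd' h
    rw [Finset.mem_coe, hmem] at hd hd'
    exact Subtype.ext (Prod.ext (hd.1.trans hd'.1.symm) h)
  have key := prod_telescope hs (S.image fun d : Cell lam => d.1.2) c.1.2 (by
    intro x hx
    obtain ⟨d, hd, rfl⟩ := Finset.mem_image.1 hx
    exact ((hmem d).1 hd).2.2) (by
    intro x hx y hxy hyc
    obtain ⟨d, hd, rfl⟩ := Finset.mem_image.1 hx
    obtain ⟨h1, h2, h3⟩ := (hmem d).1 hd
    have hy : (c.1.1, y) ∈ lam.cells :=
      lam.isLowerSet (show ((c.1.1, y) : ℕ × ℕ) ≤ c.1 from ⟨le_rfl, hyc.le⟩) c.2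
    have a1 : T (c.1.1, y) ≤ T c.1 := hT _ hy _ c.2 rfl hyc
    have a2 : T d.1 ≤ T (c.1.1, y) := by
      rcases hxy.eq_or_lt with h | h
      · exact le_of_eq (congrArg T (Prod.ext h1 h))
      · exact hT _ d.2 _ hy h1 h
    have a3 : T (c.1.1, y) = T c.1 := by omega
    exact Finset.mem_image.2 ⟨⟨_, hy⟩, (hmem _).2 ⟨rfl, a3, hyc⟩, rfl⟩)
  rw [Finset.prod_image hinj, Finset.card_image_of_injOn hinj] at key
  exact key.symm

theorem poincare_transpose_eq_prod (hlam : lam.card = n + 1) {T : ℕ × ℕ → ℕ} {s : K}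
    (hs : NonRoot s)
    (hT : ∀ c ∈ lam.cells, ∀ d ∈ lam.cells, c.2 = d.2 → c.1 < d.1 → T c ≤ T d) :
    poincare n lam.transpose (conj T) s = ∏ c : Cell lam, ∏ d : Cell lam,
      if d.1.2 = c.1.2 ∧ T d.1 = T c.1 ∧ d.1.1 < c.1.1 then hookFactor s (c.1.1 - d.1.1)
      else 1 := by
  have hmem : ∀ c : ℕ × ℕ, c ∈ lam.transpose.cells ↔ c.swap ∈ lam.cells := fun c => by
    rw [YoungDiagram.mem_cells, YoungDiagram.mem_cells, YoungDiagram.mem_transpose]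
  have hcard : lam.transpose.card = n + 1 :=
    hlam ▸ Finset.card_bij' (fun c _ => c.swap) (fun c _ => c.swap) (fun c hc => (hmem c).1 hc)
      (fun c hc => (hmem _).2 (by rwa [Prod.swap_swap])) (by simp) (by simp)
  rw [poincare_eq_prod (T := conj T) hcard hs
    fun c hc d hd h1 h2 => hT _ ((hmem c).1 hc) _ ((hmem d).1 hd) h1 h2]
  let e : Cell lam ≃ Cell lam.transpose :=
    (Equiv.prodComm ℕ ℕ).subtypeEquiv fun c => by rw [hmem]; rfl
  rw [← Equiv.prod_comp e]
  refine Finset.prod_congr rfl fun c _ => ?_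
  rw [← Equiv.prod_comp e]
  rfl

/-! ### Summation over the orderings of the cells -/

/-- The factor `(s ζ - ζ') / (ζ - ζ')` of the weight of a vertex in the symmetric case. -/
def symWeight (q s : K) (l l' : Label lam) : K :=
  (s * l.spec q s - l'.spec q s) / (l.spec q s - l'.spec q s)

/-- The factor `(ζ - s ζ') / (ζ - ζ')` of the weight of a vertex in the antisymmetric case. -/
def antiWeight (q s : K) (l l' : Label lam) : K :=
  (l.spec q s - s * l'.spec q s) / (l.spec q s - l'.spec q s)

theorem eq_of_ct_eq {T : ℕ × ℕ → ℕ} (hT : IsColumnStrict lam T ∨ IsRowStrict lam T)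
    {c d : Cell lam} (h1 : T c.1 = T d.1) (h2 : (mkLabel T c).ct = (mkLabel T d).ct) : c = d := by
  have key : ∀ c d : Cell lam, c.1.1 < d.1.1 → c.1.2 < d.1.2 → T c.1 < T d.1 := by
    intro c d hr hc
    have hm : (c.1.1, d.1.2) ∈ lam.cells :=
      lam.isLowerSet (show ((c.1.1, d.1.2) : ℕ × ℕ) ≤ d.1 from ⟨hr.le, le_rfl⟩) d.2
    rcases hT with hT | hT
    · exact (hT.1 _ c.2 _ hm rfl hc).trans_lt (hT.2 _ hm _ d.2 rfl hr)
    · exact (hT.1 _ c.2 _ hm rfl hc).trans_le (hT.2 _ hm _ d.2 rfl hr)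
  have e : (c.1.2 : ℤ) - c.1.1 = d.1.2 - d.1.1 := h2
  rcases lt_trichotomy c.1.1 d.1.1 with h | h | h
  · exact absurd h1 (key c d h (by omega)).ne
  · exact Subtype.ext (Prod.ext h (by omega))
  · exact absurd h1 (key d c h (by omega)).ne'

/-- Distinct cells of a row strict or column strict filling have distinct spectral values: cells on
a diagonal have distinct entries. -/
theorem spec_mkLabel_injective {q s : K} (h : Generic q s) {T : ℕ × ℕ → ℕ}
    (hT : IsColumnStrict lam T ∨ IsRowStrict lam T) :
    Function.Injective fun c : Cell lam => (mkLabel T c).spec q s := by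
  intro c d hcd
  have := Label.spec_eq h (k := 0) (l := mkLabel T c) (l' := mkLabel T d)
    (by rw [zpow_zero, one_mul]; exact hcd)
  exact eq_of_ct_eq hT this.1 (by omega)

/-- The sum of the weights over the component is a sum over all orderings of the cells, provided
that the orderings which are not vertices have weight zero. -/
theorem sum_component {T : ℕ × ℕ → ℕ} (W : Label lam → Label lam → K)
    (hW : ∀ w : Fin (n + 1) ≃ Cell lam, (∏ p : Fin (n + 1) × Fin (n + 1) with p.1 < p.2,
      W (mkLabel T (w p.1)) (mkLabel T (w p.2))) ≠ 0 → ∃ x ∈ component n lam T, x.cellEquiv = w)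
    (e : Fin (n + 1) ≃ Cell lam) :
    ∑ x ∈ (component_finite n lam T).toFinset, pairProd W x =
      ∑ σ : Equiv.Perm (Fin (n + 1)), ∏ p : Fin (n + 1) × Fin (n + 1) with p.1 < p.2,
        W (mkLabel T (e (σ p.1))) (mkLabel T (e (σ p.2))) := by
  refine Finset.sum_of_injOn (fun x => x.cellEquiv.trans e.symm) ?_ (fun _ _ => by simp) ?_ ?_
  · intro x hx y hy h
    rw [Set.Finite.coe_toFinset] at hx hy
    refine cellEquiv_injOn T hx hy (Equiv.ext fun i => ?_)
    exact e.symm.injective (congrArg (fun f : Equiv.Perm (Fin (n + 1)) => f i) h)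
  · intro σ _ hσ
    by_contra hne
    obtain ⟨x, hx, hxw⟩ := hW (σ.trans e) hne
    refine hσ ⟨x, by simpa using hx, ?_⟩
    simp only [hxw]
    ext1 i
    simp
  · intro x hx
    rw [Set.Finite.mem_toFinset, mem_component_iff] at hx
    refine Finset.prod_congr rfl fun p _ => ?_
    simp only [hx, Equiv.trans_apply, Equiv.apply_symm_apply]

theorem spec_mkLabel_right {q s : K} (hs : s ≠ 0) {T : ℕ × ℕ → ℕ} {c d : Cell lam}
    (h1 : T d.1 = T c.1) (h2 : d.1.1 = c.1.1) (h3 : d.1.2 = c.1.2 + 1) :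
    (mkLabel T d).spec q s = s * (mkLabel T c).spec q s := by
  have hct : (mkLabel T d).ct = (mkLabel T c).ct + 1 := by
    change (d.1.2 : ℤ) - d.1.1 = (c.1.2 : ℤ) - c.1.1 + 1
    omega
  rw [Label.spec, Label.spec, hct, zpow_add_one₀ hs]
  change q ^ T d.1 * _ = s * (q ^ T c.1 * _)
  rw [h1]; ring

theorem spec_mkLabel_below {q s : K} (hs : s ≠ 0) {T : ℕ × ℕ → ℕ} {c d : Cell lam}
    (h1 : T d.1 = T c.1) (h2 : d.1.2 = c.1.2) (h3 : d.1.1 = c.1.1 + 1) :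
    (mkLabel T c).spec q s = s * (mkLabel T d).spec q s := by
  have hct : (mkLabel T c).ct = (mkLabel T d).ct + 1 := by
    change (c.1.2 : ℤ) - c.1.1 = (d.1.2 : ℤ) - d.1.1 + 1
    omega
  rw [Label.spec, Label.spec, hct, zpow_add_one₀ hs]
  change q ^ T c.1 * _ = s * (q ^ T d.1 * _)
  rw [h1]; ring

/-- An ordering of nonzero weight comes from a vertex: two equal neighbours in a row which occur
in the wrong order contribute a vanishing factor. -/
theorem exists_vertex_of_symWeight {q s : K} (hs : s ≠ 0) {T : ℕ × ℕ → ℕ}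
    (hT : IsColumnStrict lam T) (w : Fin (n + 1) ≃ Cell lam)
    (hw : (∏ p : Fin (n + 1) × Fin (n + 1) with p.1 < p.2,
      symWeight q s (mkLabel T (w p.1)) (mkLabel T (w p.2))) ≠ 0) :
    ∃ x ∈ component n lam T, x.cellEquiv = w := by
  have adj : ∀ c d : Cell lam, T d.1 = T c.1 → d.1.1 = c.1.1 → d.1.2 = c.1.2 + 1 →
      w.symm d < w.symm c := by
    intro c d h1 h2 h3
    by_contra hlt
    rcases (not_lt.1 hlt).eq_or_lt with h | h
    · have := w.symm.injective h
      rw [this] at h3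
      omega
    · refine hw (Finset.prod_eq_zero (i := (w.symm c, w.symm d)) (by simpa using h) ?_)
      simp only [Equiv.apply_symm_apply]
      rw [symWeight, spec_mkLabel_right hs h1 h2 h3, sub_self, zero_div]
  have row : ∀ (c : Cell lam) (k : ℕ) (d : Cell lam), T d.1 = T c.1 → d.1.1 = c.1.1 →
      d.1.2 = c.1.2 + k + 1 → w.symm d < w.symm c := by
    intro c k
    induction k with
    | zero => exact fun d h1 h2 h3 => adj c d h1 h2 h3
    | succ k ih =>
      intro d h1 h2 h3
      have hm : (c.1.1, c.1.2 + k + 1) ∈ lam.cells :=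
        lam.isLowerSet (show ((c.1.1, c.1.2 + k + 1) : ℕ × ℕ) ≤ d.1 from
          ⟨h2.ge, by change c.1.2 + k + 1 ≤ d.1.2; omega⟩) d.2
      have a1 := hT.1 _ c.2 _ hm rfl (by change c.1.2 < c.1.2 + k + 1; omega)
      have a2 := hT.1 _ hm _ d.2 h2.symm (by change c.1.2 + k + 1 < d.1.2; omega)
      have e1 : T (c.1.1, c.1.2 + k + 1) = T c.1 := by omega
      exact (adj ⟨_, hm⟩ d (h1.trans e1.symm) h2 h3).trans (ih ⟨_, hm⟩ e1 rfl rfl)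
  refine exists_vertex w fun c d h => ?_
  rcases h with ⟨h1, h2⟩ | ⟨h1, h2⟩
  · rcases (hT.1 _ c.2 _ d.2 h1 h2).lt_or_eq with h | h
    · exact Or.inl h
    · exact Or.inr ⟨h, row c (d.1.2 - c.1.2 - 1) d h.symm h1.symm (by omega)⟩
  · exact Or.inl (hT.2 _ c.2 _ d.2 h1 h2)

/-- The analogue for columns of `exists_vertex_of_symWeight`. -/
theorem exists_vertex_of_antiWeight {q s : K} (hs : s ≠ 0) {T : ℕ × ℕ → ℕ}
    (hT : IsRowStrict lam T) (w : Fin (n + 1) ≃ Cell lam)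
    (hw : (∏ p : Fin (n + 1) × Fin (n + 1) with p.1 < p.2,
      antiWeight q s (mkLabel T (w p.1)) (mkLabel T (w p.2))) ≠ 0) :
    ∃ x ∈ component n lam T, x.cellEquiv = w := by
  have adj : ∀ c d : Cell lam, T d.1 = T c.1 → d.1.2 = c.1.2 → d.1.1 = c.1.1 + 1 →
      w.symm d < w.symm c := by
    intro c d h1 h2 h3
    by_contra hlt
    rcases (not_lt.1 hlt).eq_or_lt with h | h
    · have := w.symm.injective h
      rw [this] at h3
      omega
    · refine hw (Finset.prod_eq_zero (i := (w.symm c, w.symm d)) (by simpa using h) ?_)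
      simp only [Equiv.apply_symm_apply]
      rw [antiWeight, ← spec_mkLabel_below hs h1 h2 h3, sub_self, zero_div]
  have col : ∀ (c : Cell lam) (k : ℕ) (d : Cell lam), T d.1 = T c.1 → d.1.2 = c.1.2 →
      d.1.1 = c.1.1 + k + 1 → w.symm d < w.symm c := by
    intro c k
    induction k with
    | zero => exact fun d h1 h2 h3 => adj c d h1 h2 h3
    | succ k ih =>
      intro d h1 h2 h3
      have hm : (c.1.1 + k + 1, c.1.2) ∈ lam.cells :=
        lam.isLowerSet (show ((c.1.1 + k + 1, c.1.2) : ℕ × ℕ) ≤ d.1 from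
          ⟨by change c.1.1 + k + 1 ≤ d.1.1; omega, h2.ge⟩) d.2
      have a1 := hT.2 _ c.2 _ hm rfl (by change c.1.1 < c.1.1 + k + 1; omega)
      have a2 := hT.2 _ hm _ d.2 h2.symm (by change c.1.1 + k + 1 < d.1.1; omega)
      have e1 : T (c.1.1 + k + 1, c.1.2) = T c.1 := by omega
      exact (adj ⟨_, hm⟩ d (h1.trans e1.symm) h2 h3).trans (ih ⟨_, hm⟩ e1 rfl rfl)
  refine exists_vertex w fun c d h => ?_
  rcases h with ⟨h1, h2⟩ | ⟨h1, h2⟩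
  · exact Or.inl (hT.1 _ c.2 _ d.2 h1 h2)
  · rcases (hT.2 _ c.2 _ d.2 h1 h2).lt_or_eq with h | h
    · exact Or.inl h
    · exact Or.inr ⟨h, col c (d.1.1 - c.1.1 - 1) d h.symm h1.symm (by omega)⟩

theorem sum_symWeight {q s : K} (h : Generic q s) {T : ℕ × ℕ → ℕ} (hT : IsColumnStrict lam T)
    (e : Fin (n + 1) ≃ Cell lam) :
    ∑ x ∈ (component_finite n lam T).toFinset, pairProd (symWeight q s) x =
      poincareSym (n + 1) s := by
  rw [sum_component _ (exists_vertex_of_symWeight h.s_ne_zero hT) e]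
  exact sum_perm_prod_div h.s_ne_zero h.nonRoot.sub_one (n + 1)
    (fun i => (mkLabel T (e i)).spec q s)
    ((spec_mkLabel_injective h (Or.inl hT)).comp e.injective) fun i => Label.spec_ne_zero h _

theorem prod_pairs_rev {M : Type*} [CommMonoid M] {N : ℕ} (F : Fin N → Fin N → M) :
    ∏ p : Fin N × Fin N with p.1 < p.2, F p.2.rev p.1.rev =
      ∏ p : Fin N × Fin N with p.1 < p.2, F p.1 p.2 := by
  refine Finset.prod_bij' (fun p _ => (p.2.rev, p.1.rev)) (fun p _ => (p.2.rev, p.1.rev))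
    ?_ ?_ ?_ ?_ ?_ <;> simp

/-- Reversing the orderings of the cells turns the antisymmetric weights into the symmetric ones. -/
theorem sum_antiWeight {q s : K} (h : Generic q s) {T : ℕ × ℕ → ℕ} (hT : IsRowStrict lam T)
    (e : Fin (n + 1) ≃ Cell lam) :
    ∑ x ∈ (component_finite n lam T).toFinset, pairProd (antiWeight q s) x =
      poincareSym (n + 1) s := by
  rw [sum_component _ (exists_vertex_of_antiWeight h.s_ne_zero hT) e,
    ← sum_perm_prod_div h.s_ne_zero h.nonRoot.sub_one (n + 1)
    (fun i => (mkLabel T (e i)).spec q s)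
    ((spec_mkLabel_injective h (Or.inr hT)).comp e.injective) fun i => Label.spec_ne_zero h _,
    ← Equiv.sum_comp (Equiv.mulRight Fin.revPerm)]
  refine Finset.sum_congr rfl fun σ _ => ?_
  refine (prod_pairs_rev fun i j => antiWeight q s (mkLabel T (e (Equiv.mulRight Fin.revPerm σ i)))
    (mkLabel T (e (Equiv.mulRight Fin.revPerm σ j)))).symm.trans ?_
  refine Finset.prod_congr rfl fun p _ => ?_
  simp only [Equiv.coe_mulRight, Equiv.Perm.mul_apply, Fin.revPerm_apply, Fin.rev_rev]
  rw [antiWeight, ← neg_div_neg_eq, neg_sub, neg_sub]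

/-! ### The norm of the sums over a component -/

/-- The norm of a linear combination of orthogonal polynomials. -/
theorem form_sum {q s : K} (h : Generic q s) (S : Finset (Vertex n lam)) (b b' : Vertex n lam → K) :
    form q s (∑ x ∈ S, b x • macdonald q⁻¹ s⁻¹ x) (∑ x ∈ S, b' x • macdonald q s x) =
      ∑ x ∈ S, b x * b' x * form q s (macdonald q⁻¹ s⁻¹ x) (macdonald q s x) := by
  rw [map_sum (form q s), LinearMap.sum_apply]
  refine Finset.sum_congr rfl fun x hx => ?_
  rw [map_smul, LinearMap.smul_apply, map_sum, Finset.sum_eq_single x]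
  · rw [map_smul, smul_eq_mul, smul_eq_mul, mul_assoc]
  · intro y _ hy
    rw [map_smul, form_macdonald_of_ne h hy.symm, smul_zero]
  · exact fun hn => absurd hx hn

/-- Along a component the norms, weighted by the coefficients, are proportional to the weights. -/
theorem norm_mul_pairProd {q s : K} (h : Generic q s) {T : ℕ × ℕ → ℕ} {r : Vertex n lam}
    (hr : IsRoot T r) (G G' W : Label lam → Label lam → K)
    (hW : ∀ l l', UpRel l l' → W l l' ≠ 0)
    (hG : ∀ l l', UpRel l l' → G' l l' * G l l' *
      ((s * l.spec q s - l'.spec q s) * (l.spec q s - s * l'.spec q s) /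
        (s * (l.spec q s - l'.spec q s) ^ 2)) * W l l' = W l' l)
    (x : Vertex n lam) (hx : x ∈ component n lam T) :
    invProd G' x * invProd G x * form q s (macdonald q⁻¹ s⁻¹ x) (macdonald q s x) *
      pairProd W r = form q s (macdonald q⁻¹ s⁻¹ r) (macdonald q s r) * pairProd W x := by
  induction x, hx using component_induction with
  | hroot x hx =>
    obtain rfl := hr.unique hx
    rw [invProd_root _ hr, invProd_root _ hr, one_mul, one_mul]
  | harrow i x hx hi ih =>
    apply mul_right_cancel₀ (hW _ _ hi)
    rw [mul_assoc _ (pairProd W (x.sw i)), pairProd_sw W hi, invProd_sw _ hi, invProd_sw _ hi,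
      form_macdonald_sw h hi, ← hG _ _ hi]
    generalize ((s * _ - _) * _ / _ : K) = c
    linear_combination (G' (x.lab i.castSucc) (x.lab i.succ) * G (x.lab i.castSucc) (x.lab i.succ) *
      c * W (x.lab i.castSucc) (x.lab i.succ)) * ih

theorem UpRel.spec_sub_mul_ne {q s : K} (h : Generic q s) {l l' : Label lam} (hl : UpRel l l') :
    l.spec q s - s * l'.spec q s ≠ 0 := by
  intro e
  have := Label.spec_eq h (k := 1) (l := l) (l' := l') (by rw [zpow_one]; exact sub_eq_zero.1 e)
  unfold UpRel at hl
  omega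

theorem UpRel.mul_spec_sub_ne {q s : K} (h : Generic q s) {l l' : Label lam} (hl : UpRel l l') :
    s * l.spec q s - l'.spec q s ≠ 0 := by
  intro e
  have := Label.spec_eq h (k := 1) (l := l') (l' := l)
    (by rw [zpow_one]; exact (sub_eq_zero.1 e).symm)
  unfold UpRel at hl
  omega

theorem symFactor_inv {q s : K} (h : Generic q s) {l l' : Label lam} (hl : UpRel l l') :
    symFactor q⁻¹ s⁻¹ l l' = s * symFactor q s l l' := by
  have a0 := l.spec_ne_zero h
  have b0 := l'.spec_ne_zero h
  have s0 := h.s_ne_zero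
  have h1 := hl.mul_spec_sub_ne h
  rw [symFactor, symFactor, Label.spec_inv, Label.spec_inv]
  generalize l.spec q s = a at *
  generalize l'.spec q s = b at *
  have e1 : a⁻¹ - b⁻¹ = (a - b) * -(a⁻¹ * b⁻¹) := by field_simp; ring
  have e2 : s⁻¹ * a⁻¹ - b⁻¹ = (s * a - b) * -(s⁻¹ * (a⁻¹ * b⁻¹)) := by field_simp; ring
  rw [e1, e2]
  field_simp

theorem antiFactor_inv {q s : K} (h : Generic q s) {l l' : Label lam} (hl : UpRel l l') :
    antiFactor q⁻¹ s⁻¹ l l' = s * antiFactor q s l l' := by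
  have a0 := l.spec_ne_zero h
  have b0 := l'.spec_ne_zero h
  have s0 := h.s_ne_zero
  have h1 := hl.spec_sub_mul_ne h
  rw [antiFactor, antiFactor, Label.spec_inv, Label.spec_inv]
  generalize l.spec q s = a at *
  generalize l'.spec q s = b at *
  have e1 : a⁻¹ - b⁻¹ = (a - b) * -(a⁻¹ * b⁻¹) := by field_simp; ring
  have e2 : a⁻¹ - s⁻¹ * b⁻¹ = (a - s * b) * -(s⁻¹ * (a⁻¹ * b⁻¹)) := by field_simp; ring
  rw [e1, e2]
  field_simp

theorem form_symMacdonald {q s : K} (h : Generic q s) {T : ℕ × ℕ → ℕ} (hT : IsColumnStrict lam T)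
    {r : Vertex n lam} (hr : IsRoot T r) :
    form q s (symMacdonald n lam q⁻¹ s⁻¹ T) (symMacdonald n lam q s T) *
        pairProd (symWeight q s) r =
      poincareSym (n + 1) s * form q s (macdonald q⁻¹ s⁻¹ r) (macdonald q s r) := by
  have s0 := h.s_ne_zero
  rw [symMacdonald, symMacdonald, form_sum h, Finset.sum_mul, ← sum_symWeight h hT r.cellEquiv,
    Finset.sum_mul]
  refine Finset.sum_congr rfl fun x hx => ?_
  rw [Set.Finite.mem_toFinset] at hx
  rw [symCoeff_eq _ _ hx, symCoeff_eq _ _ hx,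
    norm_mul_pairProd h hr (symFactor q s) (symFactor q⁻¹ s⁻¹) (symWeight q s) _ _ x hx, mul_comm]
  · exact fun l l' hl => div_ne_zero (hl.mul_spec_sub_ne h) (hl.spec_sub_ne h)
  · intro l l' hl
    have h1 := hl.mul_spec_sub_ne h
    have h2 := hl.spec_sub_ne h
    rw [symFactor_inv h hl, symFactor, symWeight, symWeight, ← neg_div_neg_eq (s * l'.spec q s - _),
      neg_sub, neg_sub]
    field_simp

theorem form_antiMacdonald {q s : K} (h : Generic q s) {T : ℕ × ℕ → ℕ} (hT : IsRowStrict lam T)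
    {r : Vertex n lam} (hr : IsRoot T r) :
    form q s (antiMacdonald n lam q⁻¹ s⁻¹ T) (antiMacdonald n lam q s T) *
        pairProd (antiWeight q s) r =
      poincareSym (n + 1) s * form q s (macdonald q⁻¹ s⁻¹ r) (macdonald q s r) := by
  have s0 := h.s_ne_zero
  rw [antiMacdonald, antiMacdonald, form_sum h, Finset.sum_mul, ← sum_antiWeight h hT r.cellEquiv,
    Finset.sum_mul]
  refine Finset.sum_congr rfl fun x hx => ?_
  rw [Set.Finite.mem_toFinset] at hx
  rw [antiCoeff_eq _ _ hx, antiCoeff_eq _ _ hx,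
    norm_mul_pairProd h hr (antiFactor q s) (antiFactor q⁻¹ s⁻¹) (antiWeight q s) _ _ x hx,
    mul_comm]
  · exact fun l l' hl => div_ne_zero (hl.spec_sub_mul_ne h) (hl.spec_sub_ne h)
  · intro l l' hl
    have h1 := hl.spec_sub_mul_ne h
    have h2 := hl.spec_sub_ne h
    rw [antiFactor_inv h hl, antiFactor, antiWeight, antiWeight,
      ← neg_div_neg_eq (l'.spec q s - _), neg_sub, neg_sub]
    field_simp

/-! ### The weight of the root -/

/-- Labels which change their order between the root and the sink are exchanged by an arrow. -/
theorem RootLt.upRel {l l' : Label lam} (h : RootLt l l') (h' : SinkLt l' l) : UpRel l l' := by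
  unfold RootLt SinkLt at *
  unfold UpRel Label.ct
  omega

open Classical in
theorem prod_pairs_cells {T : ℕ × ℕ → ℕ} {x : Vertex n lam} (hx : x ∈ component n lam T)
    (R : Label lam → Label lam → Prop) (hR : ∀ a b, a < b ↔ R (x.lab a) (x.lab b))
    (F : Label lam → Label lam → K) :
    ∏ p : Fin (n + 1) × Fin (n + 1) with p.1 < p.2, F (x.lab p.1) (x.lab p.2) =
      ∏ c : Cell lam, ∏ d : Cell lam,
        if R (mkLabel T c) (mkLabel T d) then F (mkLabel T c) (mkLabel T d) else 1 := by
  rw [mem_component_iff] at hx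
  rw [prod_pairs_eq_prod_prod fun i j => F (x.lab i) (x.lab j), ← Equiv.prod_comp x.cellEquiv]
  refine Finset.prod_congr rfl fun i _ => ?_
  rw [← Equiv.prod_comp x.cellEquiv]
  refine Finset.prod_congr rfl fun j _ => ?_
  rw [← hx, ← hx]
  exact if_congr (hR i j) rfl rfl

theorem lt_iff_of_forall {x : Vertex n lam} {R : Label lam → Label lam → Prop}
    (h : ∀ {a b}, a < b → R (x.lab a) (x.lab b)) (hR : ∀ {l l'}, R l l' → ¬ R l' l)
    (a b : Fin (n + 1)) : a < b ↔ R (x.lab a) (x.lab b) := by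
  refine ⟨h, fun hab => ?_⟩
  by_contra hlt
  rcases (not_lt.1 hlt).eq_or_lt with e | e
  · subst e; exact hR hab hab
  · exact hR hab (h e)

open Classical in
/-- The product of the weight of the root and of the coefficient at the sink: the pairs exchanged
between the root and the sink cancel. -/
theorem pairProd_mul_invProd {T : ℕ × ℕ → ℕ} {r x : Vertex n lam} (hr : IsRoot T r)
    (hx : IsSink T x) (W G : Label lam → Label lam → K) :
    pairProd W r * invProd G x = ∏ c : Cell lam, ∏ d : Cell lam,
      if RootLt (mkLabel T c) (mkLabel T d) then W (mkLabel T c) (mkLabel T d) *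
        (if SinkLt (mkLabel T d) (mkLabel T c) then G (mkLabel T c) (mkLabel T d) else 1)
      else 1 := by
  rw [pairProd, prod_pairs_cells hr.1 RootLt
    (lt_iff_of_forall (fun hab => Vertex.forall_rootLt hr.2 hab) RootLt.asymm), invProd,
    prod_pairs_cells hx.1 SinkLt
    (lt_iff_of_forall (fun hab => Vertex.forall_sinkLt hx.2 hab) SinkLt.asymm)
    (fun l l' => if RootLt l' l then G l' l else 1),
    Finset.prod_comm (s := Finset.univ (α := Cell lam))
    (f := fun c d => if SinkLt (mkLabel T c) (mkLabel T d) then _ else _),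
    ← Finset.prod_mul_distrib]
  refine Finset.prod_congr rfl fun c _ => ?_
  rw [← Finset.prod_mul_distrib]
  refine Finset.prod_congr rfl fun d _ => ?_
  split_ifs <;> simp

theorem hookFactor_ne_zero {s : K} (hs : NonRoot s) {k : ℕ} (hk : k ≠ 0) : hookFactor s k ≠ 0 := by
  have e : ∀ k : ℕ, k ≠ 0 → 1 - s ^ k ≠ 0 := fun k hk => by
    have := hs.one_sub_zpow (m := k) (by omega)
    rwa [zpow_natCast] at this
  exact div_ne_zero (e _ (by omega)) (e _ hk)

/-- The pairs of labels which are in the same order at the root and at the sink have equal values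
and lie in the same row, since the columns are strict; their weights are the factors of `φ_T`. -/
theorem symWeight_root {q s : K} (h : Generic q s) (hlam : lam.card = n + 1) {T : ℕ × ℕ → ℕ}
    (hT : IsColumnStrict lam T) {r x : Vertex n lam} (hr : IsRoot T r) (hx : IsSink T x) :
    pairProd (symWeight q s) r * invProd (symFactor q s) x = poincare n lam T s := by
  classical
  rw [pairProd_mul_invProd hr hx, poincare_eq_prod hlam h.nonRoot hT.1]
  refine Finset.prod_congr rfl fun c _ => Finset.prod_congr rfl fun d _ => ?_
  by_cases h1 : RootLt (mkLabel T c) (mkLabel T d)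
  swap
  · rw [if_neg h1, if_neg]
    rintro ⟨e1, e2, e3⟩
    exact h1 (Or.inr ⟨e2.symm, Or.inl e3⟩)
  rw [if_pos h1]
  -- a pair exchanged between the root and the sink: its weight and its coefficient cancel
  by_cases h2 : SinkLt (mkLabel T d) (mkLabel T c)
  · have hu := h1.upRel h2
    have a1 := hu.mul_spec_sub_ne h
    have a2 := hu.spec_sub_ne h
    rw [if_pos h2, if_neg]
    · rw [symWeight, symFactor]
      field_simp
    · rintro ⟨e1, e2, e3⟩
      rcases h2 with h2 | ⟨-, h2⟩
      · exact h2.ne e2.symm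
      · change c.1.1 < d.1.1 ∨ (c.1.1 = d.1.1 ∧ c.1.2 < d.1.2) at h2
        omega
  · have hTcd : T d.1 = T c.1 := by
      by_contra hne
      rcases h1 with h1 | ⟨h1, -⟩
      · exact h2 (Or.inl h1)
      · exact hne h1.symm
    have h1' : d.1.2 < c.1.2 ∨ (d.1.2 = c.1.2 ∧ d.1.1 < c.1.1) := by
      rcases h1 with h1 | ⟨-, h1⟩
      · exact absurd hTcd h1.ne'
      · exact h1
    have h2' : ¬ (c.1.1 < d.1.1 ∨ (c.1.1 = d.1.1 ∧ c.1.2 < d.1.2)) := fun h' =>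
      h2 (Or.inr ⟨hTcd, h'⟩)
    -- otherwise the cell in the row of `d` and the column of `c` violates strictness of the columns
    have hrow : d.1.1 = c.1.1 := by
      by_contra hne
      have hlt : d.1.1 < c.1.1 := by omega
      have hm : (d.1.1, c.1.2) ∈ lam.cells :=
        lam.isLowerSet (show ((d.1.1, c.1.2) : ℕ × ℕ) ≤ c.1 from ⟨hlt.le, le_rfl⟩) c.2
      have a1 := hT.2 _ hm _ c.2 rfl hlt
      have a2 : T d.1 ≤ T (d.1.1, c.1.2) := by
        rcases h1' with h | h
        · exact hT.1 _ d.2 _ hm rfl h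
        · exact le_of_eq (congrArg T (Prod.ext rfl h.1))
      omega
    have hcol : d.1.2 < c.1.2 := by omega
    rw [if_neg h2, if_pos ⟨hrow, hTcd, hcol⟩, mul_one, symWeight, hookFactor]
    have hct : (mkLabel T c).ct = (mkLabel T d).ct + ((c.1.2 - d.1.2 : ℕ) : ℤ) := by
      change (c.1.2 : ℤ) - c.1.1 = (d.1.2 : ℤ) - d.1.1 + _
      omega
    have hspec : (mkLabel T c).spec q s = (mkLabel T d).spec q s * s ^ (c.1.2 - d.1.2) := by
      rw [Label.spec, Label.spec, hct, zpow_add₀ h.s_ne_zero, zpow_natCast, ← mul_assoc]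
      change q ^ T c.1 * _ * _ = q ^ T d.1 * _ * _
      rw [hTcd]
    have hz := (mkLabel T d).spec_ne_zero h
    rw [hspec]
    generalize (mkLabel T d).spec q s = z at *
    rw [show s * (z * s ^ (c.1.2 - d.1.2)) - z = z * -(1 - s ^ (c.1.2 - d.1.2 + 1)) by ring,
      show z * s ^ (c.1.2 - d.1.2) - z = z * -(1 - s ^ (c.1.2 - d.1.2)) by ring,
      mul_div_mul_left _ _ hz, neg_div_neg_eq]

/-- The pairs of labels which are in the same order at the root and at the sink have equal values
and lie in the same column, since the rows are strict; their weights are the factors of the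
Poincaré polynomial of the conjugate filling. -/
theorem antiWeight_root {q s : K} (h : Generic q s) (hlam : lam.card = n + 1) {T : ℕ × ℕ → ℕ}
    (hT : IsRowStrict lam T) {r x : Vertex n lam} (hr : IsRoot T r) (hx : IsSink T x) :
    pairProd (antiWeight q s) r * invProd (fun l l' => -1 * antiFactor q s l l') x =
      poincare n lam.transpose (conj T) s := by
  classical
  rw [pairProd_mul_invProd hr hx, poincare_transpose_eq_prod hlam h.nonRoot hT.2]
  refine Finset.prod_congr rfl fun c _ => Finset.prod_congr rfl fun d _ => ?_
  by_cases h1 : RootLt (mkLabel T c) (mkLabel T d)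
  swap
  · rw [if_neg h1, if_neg]
    rintro ⟨e1, e2, e3⟩
    exact h1 (Or.inr ⟨e2.symm, Or.inr ⟨e1, e3⟩⟩)
  rw [if_pos h1]
  -- a pair exchanged between the root and the sink: its weight and its coefficient cancel, up to
  -- the sign
  by_cases h2 : SinkLt (mkLabel T d) (mkLabel T c)
  · have hu := h1.upRel h2
    have a1 := hu.spec_sub_mul_ne h
    have a2 := hu.spec_sub_ne h
    rw [if_pos h2, if_neg]
    · rw [antiWeight, antiFactor]
      field_simp
    · rintro ⟨e1, e2, e3⟩
      rcases h2 with h2 | ⟨-, h2⟩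
      · exact h2.ne e2.symm
      · change c.1.1 < d.1.1 ∨ (c.1.1 = d.1.1 ∧ c.1.2 < d.1.2) at h2
        omega
  · have hTcd : T d.1 = T c.1 := by
      by_contra hne
      rcases h1 with h1 | ⟨h1, -⟩
      · exact h2 (Or.inl h1)
      · exact hne h1.symm
    have h1' : d.1.2 < c.1.2 ∨ (d.1.2 = c.1.2 ∧ d.1.1 < c.1.1) := by
      rcases h1 with h1 | ⟨-, h1⟩
      · exact absurd hTcd h1.ne'
      · exact h1
    have h2' : ¬ (c.1.1 < d.1.1 ∨ (c.1.1 = d.1.1 ∧ c.1.2 < d.1.2)) := fun h' =>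
      h2 (Or.inr ⟨hTcd, h'⟩)
    -- otherwise the cell in the row of `c` and the column of `d` violates strictness of the rows
    have hcol : d.1.2 = c.1.2 := by
      by_contra hne
      have hlt : d.1.2 < c.1.2 := by omega
      have hm : (c.1.1, d.1.2) ∈ lam.cells :=
        lam.isLowerSet (show ((c.1.1, d.1.2) : ℕ × ℕ) ≤ c.1 from ⟨le_rfl, hlt.le⟩) c.2
      have a1 := hT.1 _ hm _ c.2 rfl hlt
      have a2 : T d.1 ≤ T (c.1.1, d.1.2) := by
        rcases (show d.1.1 ≤ c.1.1 by omega).eq_or_lt with h | h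
        · exact le_of_eq (congrArg T (Prod.ext h rfl))
        · exact hT.2 _ d.2 _ hm rfl h
      omega
    have hrow : d.1.1 < c.1.1 := by omega
    rw [if_neg h2, if_pos ⟨hcol, hTcd, hrow⟩, mul_one, antiWeight, hookFactor]
    have hct : (mkLabel T d).ct = (mkLabel T c).ct + ((c.1.1 - d.1.1 : ℕ) : ℤ) := by
      change (d.1.2 : ℤ) - d.1.1 = (c.1.2 : ℤ) - c.1.1 + _
      omega
    have hspec : (mkLabel T d).spec q s = (mkLabel T c).spec q s * s ^ (c.1.1 - d.1.1) := by
      rw [Label.spec, Label.spec, hct, zpow_add₀ h.s_ne_zero, zpow_natCast, ← mul_assoc]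
      change q ^ T d.1 * _ * _ = q ^ T c.1 * _ * _
      rw [hTcd]
    have hz := (mkLabel T c).spec_ne_zero h
    rw [hspec]
    generalize (mkLabel T c).spec q s = z at *
    rw [show z - s * (z * s ^ (c.1.1 - d.1.1)) = z * (1 - s ^ (c.1.1 - d.1.1 + 1)) by ring,
      show z - z * s ^ (c.1.1 - d.1.1) = z * (1 - s ^ (c.1.1 - d.1.1)) by ring,
      mul_div_mul_left _ _ hz]

theorem poincare_ne_zero (hlam : lam.card = n + 1) {T : ℕ × ℕ → ℕ} {s : K} (hs : NonRoot s)
    (hT : ∀ c ∈ lam.cells, ∀ d ∈ lam.cells, c.1 = d.1 → c.2 < d.2 → T c ≤ T d) :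
    poincare n lam T s ≠ 0 := by
  rw [poincare_eq_prod hlam hs hT]
  refine Finset.prod_ne_zero_iff.2 fun c _ => Finset.prod_ne_zero_iff.2 fun d _ => ?_
  split_ifs with h
  · exact hookFactor_ne_zero hs (by omega)
  · exact one_ne_zero

theorem poincare_transpose_ne_zero (hlam : lam.card = n + 1) {T : ℕ × ℕ → ℕ} {s : K}
    (hs : NonRoot s)
    (hT : ∀ c ∈ lam.cells, ∀ d ∈ lam.cells, c.2 = d.2 → c.1 < d.1 → T c ≤ T d) :
    poincare n lam.transpose (conj T) s ≠ 0 := by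
  rw [poincare_transpose_eq_prod hlam hs hT]
  refine Finset.prod_ne_zero_iff.2 fun c _ => Finset.prod_ne_zero_iff.2 fun d _ => ?_
  split_ifs with h
  · exact hookFactor_ne_zero hs (by omega)
  · exact one_ne_zero

theorem invProd_neg (G : Label lam → Label lam → K) (x : Vertex n lam) :
    invProd (fun l l' => -1 * G l l') x = invProd (fun _ _ => -1) x * invProd G x := by
  rw [invProd, invProd, invProd, ← Finset.prod_mul_distrib]
  exact Finset.prod_congr rfl fun p _ => by split_ifs <;> simp

end VVMac

end

theorem mainTheorem8 {K : Type*} [Field K] (q s : K) (hq : q ≠ 0) (hs : s ≠ 0)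
    (hgen : ∀ a b : ℤ, q ^ a * s ^ b = 1 → a = 0 ∧ b = 0)
    (n : ℕ) (lam : YoungDiagram) (hlam : lam.card = n + 1) (T : ℕ × ℕ → ℕ)
    (root sink : VVMac.Vertex n lam)
    (hroot : VVMac.IsRoot T root) (hsink : VVMac.IsSink T sink) :
    (VVMac.IsColumnStrict lam T →
      VVMac.form q s (VVMac.symMacdonald n lam q⁻¹ s⁻¹ T) (VVMac.symMacdonald n lam q s T) =
        VVMac.poincareSym (n + 1) s / VVMac.poincare n lam T s *
          VVMac.symCoeff q s T sink *
          VVMac.form q s (VVMac.macdonald q⁻¹ s⁻¹ root) (VVMac.macdonald q s root)) ∧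
    (VVMac.IsRowStrict lam T →
      VVMac.form q s (VVMac.antiMacdonald n lam q⁻¹ s⁻¹ T) (VVMac.antiMacdonald n lam q s T) =
        (-1) ^ VVMac.pathLength root sink *
          (VVMac.poincareSym (n + 1) s /
            VVMac.poincare n lam.transpose (VVMac.conj T) s) *
          VVMac.antiCoeff q s T sink *
          VVMac.form q s (VVMac.macdonald q⁻¹ s⁻¹ root) (VVMac.macdonald q s root)) := by
  have h : VVMac.Generic q s := ⟨hq, hs, hgen⟩
  refine ⟨fun hT => ?_, fun hT => ?_⟩
  · have h1 := VVMac.form_symMacdonald h hT hroot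
    have h2 := VVMac.symWeight_root h hlam hT hroot hsink
    have h3 := VVMac.poincare_ne_zero hlam h.nonRoot hT.1
    rw [VVMac.symCoeff_eq _ _ hsink.1]
    rw [← h2] at h3 ⊢
    obtain ⟨hw, hb⟩ := mul_ne_zero_iff.1 h3
    -- multiplied by the weight of the root, both sides contain the norm of `P_root` and `φ_N`
    apply mul_right_cancel₀ hw
    rw [h1]
    field_simp
  · have h1 := VVMac.form_antiMacdonald h hT hroot
    have h2 := VVMac.antiWeight_root h hlam hT hroot hsink
    have h3 := VVMac.poincare_transpose_ne_zero hlam h.nonRoot hT.2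
    rw [VVMac.antiCoeff_eq _ _ hsink.1]
    rw [← h2, VVMac.invProd_neg, ← VVMac.neg_one_pow_pathLength hroot hsink.1] at h3 ⊢
    obtain ⟨hw, hb⟩ := mul_ne_zero_iff.1 h3
    obtain ⟨hp, hb⟩ := mul_ne_zero_iff.1 hb
    -- multiplied by the weight of the root, both sides contain the norm of `P_root` and `φ_N`
    apply mul_right_cancel₀ hw
    rw [h1]
    field_simp
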